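/- Fix integers $1\le k<n$. Let $[\overline n]=\{1<2<\dots<n<\overline n<\dots<\overline 1\}$, where $\overline{\overline\imath}=i$; the letters $1,\dots,n$ are positive, the barred ones are negative, and $|i|=|\overline\imath|=i$ for $i\in[n]$. For $a\in[\overline n]$ let $\prec_a$ be the circular order on $[\overline n]$ starting at $a$; a chain $a\prec b\prec c\prec\cdots$ (or with $\preceq$) refers to $\prec_a$. Columns of height $k$ are sequences $C=(C(1),\dots,C(k))$ of letters of $[\overline n]$, and $C't_{il}$ is $C'$ with the entries in positions $i$ and $l$ exchanged. *Quantum Bruhat graph.* Let $W$ be the group of signed permutations, i.e. bijections $w$ of $[\overline n]$ with $w(\overline\imath)=\overline{w(i)}$; it is the Weyl group of type $B_n$, acting on $\mathbb R^n$ by $\varepsilon_i\mapsto\varepsilon_{w(i)}$, where $\varepsilon_{\overline\imath}=-\varepsilon_i$. The positive roots are $\varepsilon_i\mp\varepsilon_j$ ($i<j$) and $\varepsilon_i$; write $(i,\overline\jmath)=(j,\overline\imath)$ for $\varepsilon_i+\varepsilon_j$ and $(i,\overline\imath)$ for $\varepsilon_i$. Let $\ell$ be the length function and $\rho$ half the sum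 of the positive roots. The quantum Bruhat graph has vertex set $W$ and an edge $w\to ws_\alpha$ labelled by the positive root $\alpha$ whenever $\ell(ws_\alpha)=\ell(w)+1$ or $\ell(ws_\alpha)=\ell(w)-2\langle\rho,\alpha^\vee\rangle+1$. Put $$\Gamma_r(k)=\Gamma^k\Gamma^{k-1}\cdots\Gamma^1,\qquad \Gamma^i=\big((i,\overline\imath),(i,\overline{i-1}),(i,\overline{i-2}),\dots,(i,\overline 1)\big).$$ *Conditions.* Columns $C,C'$ are blocked off at $i$ by $b=C'(i)$ if: (a) $|C(i)|\le b<n$ (so $b$ is positive), where $|C(i)|=b$ if and only if $C(i)=\overline b$; (b) $\{1,\dots,b\}$ is contained in $\{|C(1)|,\dots,|C(i)|\}$ and in $\{|C'(1)|,\dots,|C'(i)|\}$; (c) the number of $j\le i$ with $C(j)$ negative and $C'(j)$ positive is odd. The pair $CC'$ satisfies Conditions 1–3 if for all $1\le i<l\le k$: 1. $C(i)\ne C'(l)$; 2. $C(i)\prec C'(l)\prec C'(i)$ only if $C$ and $C't_{il}$ are blocked off at $i$ by $C'(l)$; 3. $C$ and $C'$ are not blocked off at $i$ by $C'(i)$ (for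 every $1\le i<k$). *Split columns.* A KN column of type $B_n$ is a column $D$ with entries in $\{1<\dots<n<0<\overline n<\dots<\overline1\}$, strictly increasing from top to bottom except that $0$ may be repeated, such that if $j$ is in the $a$-th box from the top and $\overline\jmath$ in the $b$-th box from the bottom then $a+b\le j$. Let $z_1\ge z_2\ge\dots\ge z_s$ be the entries $0$ of $D$ with repetitions, together with the unbarred letters $z$ such that both $z$ and $\overline z$ occur in $D$. Let $t_i$ be the greatest letter of $[n]$ with $t_i<z_i$, $t_i<t_{i-1}$ (if $i>1$) and $t_i,\overline{t_i}\notin D$. Changing each $z_i$ into $t_i$ gives the left column, and changing each $\overline{z_i}$ (each $0$, if $z_i=0$) into $\overline{t_i}$ gives the right column. If $D$ has height $r\le k$ with $k-r$ even ($r=0$ allowed), let $i_1<\dots<i_{k-r}$ be the smallest letters of $[n]$ such that neither they nor their bars occur in these two columns; append $\overline{\imath_1},\dots,\overline{\imath_{k-r}}$ to the left and $i_1,\dots,i_{k-r}$ to the right column, and sort both increasingly. The result is the split pair $(lD,rD)$ of height $k$. **Proposition.** Let $u$ be a signed permutation, $C=u[1,k]=(u(1),\dots,u(k))$, and let $C'$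 be a column of height $k$. Then $CC'$ satisfies Conditions 1–3 and the pair obtained from $(C,C')$ by sorting both columns increasingly equals $(lD,rD)$ for some KN column $D$ of type $B_n$ as above, if and only if there is a path $u=u_0,u_1,\dots,u_p=v$ in the quantum Bruhat graph with $v[1,k]=C'$ whose edge labels form a subsequence of $\Gamma_r(k)$. Moreover, such a path is unique when it exists, and along it, for each $i=1,\dots,k$, $$C(i)=u_0(i)\preceq u_1(i)\preceq\dots\preceq u_p(i)=C'(i).$$ -/

import Mathlib

namespace TypeB

/-! ### The alphabet `[n̄] = {1 < ⋯ < n < n̄ < ⋯ < 1̄}` -/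

/-- The letters of `[n̄]`. For `i : Fin n`, `pos i` is the letter `i + 1` and `neg i` is the barred
letter `\overline{i + 1}`. -/
inductive Letter (n : ℕ) where
  | pos (i : Fin n) : Letter n
  | neg (i : Fin n) : Letter n
  deriving DecidableEq, Fintype

namespace Letter

variable {n : ℕ}

/-- The position (from `0` to `2n - 1`) of a letter in `1 < ⋯ < n < n̄ < ⋯ < 1̄`. -/
def key : Letter n → ℕ
  | pos i => i
  | neg i => 2 * n - 1 - i

theorem key_injective : Function.Injective (key : Letter n → ℕ) := by
  intro a b h
  cases a <;> cases b <;> simp only [key] at h <;> (congr 1; omega)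

instance : LinearOrder (Letter n) := LinearOrder.lift' key key_injective

/-- The barring involution `a ↦ ā`. -/
def bar : Letter n → Letter n
  | pos i => neg i
  | neg i => pos i

/-- The absolute value `|a|`; the element `i` of `Fin n` stands for the number `i + 1`. -/
def abs : Letter n → Fin n
  | pos i => i
  | neg i => i

/-- `sign a = 1`. -/
def IsPos (a : Letter n) : Prop := ∃ i, a = pos i

/-- `sign a = -1`. -/
def IsNeg (a : Letter n) : Prop := ∃ i, a = neg i

instance : DecidablePred (IsPos (n := n)) := fun a => by unfold IsPos; infer_instance
instance : DecidablePred (IsNeg (n := n)) := fun a => by unfold IsNeg; infer_instance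

/-- The number of clockwise steps from `a` to `x` when `[n̄]` is arranged on a circle. -/
def circRank (a x : Letter n) : ℕ := (x.key + 2 * n - a.key) % (2 * n)

/-- `x ≺_a y` in the circular order starting at `a`. -/
def CircLT (a x y : Letter n) : Prop := circRank a x < circRank a y

/-- `x ⪯_a y` in the circular order starting at `a`. -/
def CircLE (a x y : Letter n) : Prop := circRank a x ≤ circRank a y

/-- `a ≺ b ≺ c`, where, as usual, the order is the circular order starting at `a`. -/
def CircBetween (a b c : Letter n) : Prop := CircLT a a b ∧ CircLT a b c

end Letter

/-! ### Signed permutations -/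

/-- The group of signed permutations: bijections `w` of `[n̄]` with `w(ā) = \overline{w(a)}`. -/
def SignedPerm (n : ℕ) : Subgroup (Equiv.Perm (Letter n)) where
  carrier := {w | ∀ a, w a.bar = (w a).bar}
  mul_mem' := by
    intro v w hv hw a
    simp only [Set.mem_ofPred_eq] at hv hw
    simp [hv, hw]
  one_mem' := by intro a; simp
  inv_mem' := by
    intro w hw a
    simp only [Set.mem_ofPred_eq] at hw
    apply w.injective
    simp [hw]

/-! ### The root system of type `B_n` -/

/-- The positive roots of type `B_n`: `sub i j` is `(i, j) = ε_i - ε_j` and `add i j` is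
`(i, j̄) = (j, ī) = ε_i + ε_j`, for `i < j`; `single i` is `(i, ī) = ε_i`. -/
inductive PosRoot (n : ℕ) where
  | sub (i j : Fin n) (h : i < j) : PosRoot n
  | add (i j : Fin n) (h : i < j) : PosRoot n
  | single (i : Fin n) : PosRoot n
  deriving DecidableEq, Fintype

/-- The vector `ε_a` for a letter `a`, with `ε_{ī} = -ε_i`. -/
def eps {n : ℕ} : Letter n → (Fin n → ℚ)
  | .pos i => Pi.single i 1
  | .neg i => -Pi.single i 1

/-- The vector of a positive root. -/
def PosRoot.vec {n : ℕ} : PosRoot n → (Fin n → ℚ)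
  | .sub i j _ => eps (.pos i) - eps (.pos j)
  | .add i j _ => eps (.pos i) + eps (.pos j)
  | .single i => eps (.pos i)

/-- The coroot `α^∨ = 2α / ⟨α, α⟩`. -/
def PosRoot.coroot {n : ℕ} (α : PosRoot n) : Fin n → ℚ :=
  (2 / (α.vec ⬝ᵥ α.vec)) • α.vec

/-- `ρ`, half the sum of the positive roots. -/
def rho (n : ℕ) : Fin n → ℚ := (1 / 2 : ℚ) • ∑ α : PosRoot n, α.vec

/-- The linear action of signed permutations: `w` sends `ε_i` to `ε_{w(i)}`. -/
def act {n : ℕ} (w : SignedPerm n) (x : Fin n → ℚ) : Fin n → ℚ :=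
  ∑ i, x i • eps (w.1 (.pos i))

/-- The length of `w`: the number of positive roots which `w` sends to negative roots. -/
def length {n : ℕ} (w : SignedPerm n) : ℕ :=
  (Finset.univ.filter fun α : PosRoot n => ∃ β : PosRoot n, act w α.vec = -β.vec).card

/-- The permutation of `[n̄]` underlying a reflection: `t_{ij} t_{j̄ ī}` for `(i, j)`,
`t_{i j̄} t_{j ī}` for `(i, j̄)`, and `t_{i ī}` for `(i, ī)`. -/
def PosRoot.reflPerm {n : ℕ} : PosRoot n → Equiv.Perm (Letter n)
  | .sub i j _ => Equiv.swap (Letter.pos i) (Letter.pos j) * Equiv.swap (Letter.neg j) (Letter.neg i)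
  | .add i j _ => Equiv.swap (Letter.pos i) (Letter.neg j) * Equiv.swap (Letter.pos j) (Letter.neg i)
  | .single i => Equiv.swap (Letter.pos i) (Letter.neg i)

theorem PosRoot.reflPerm_mem {n : ℕ} (α : PosRoot n) : α.reflPerm ∈ SignedPerm n := by
  change ∀ a, _ = _
  intro a
  rcases α with ⟨i, j, h⟩ | ⟨i, j, h⟩ | i
  · rcases a with x | x <;> by_cases h1 : x = i <;> by_cases h2 : x = j <;>
      simp_all [PosRoot.reflPerm, Letter.bar, Equiv.swap_apply_def, h.ne, h.ne']
  · rcases a with x | x <;> by_cases h1 : x = i <;> by_cases h2 : x = j <;>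
      simp_all [PosRoot.reflPerm, Letter.bar, Equiv.swap_apply_def, h.ne, h.ne']
  · rcases a with x | x <;> by_cases h1 : x = i <;>
      simp_all [PosRoot.reflPerm, Letter.bar, Equiv.swap_apply_def]

/-- The reflection `s_α` as a signed permutation. -/
def PosRoot.refl {n : ℕ} (α : PosRoot n) : SignedPerm n := ⟨α.reflPerm, α.reflPerm_mem⟩

/-! ### The quantum Bruhat graph -/

/-- The edge `w → v` labelled by `α` of the quantum Bruhat graph: `v = w s_α`, and either
`ℓ(v) = ℓ(w) + 1` or `ℓ(v) = ℓ(w) - 2⟨ρ, α^∨⟩ + 1`. -/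
def QEdge {n : ℕ} (w : SignedPerm n) (α : PosRoot n) (v : SignedPerm n) : Prop :=
  v = w * α.refl ∧
    (length v = length w + 1 ∨ (length v : ℚ) = length w - 2 * (rho n ⬝ᵥ α.coroot) + 1)

/-- `P` lists the consecutive steps (edge label and end vertex) of a path of the quantum Bruhat
graph that starts at the given vertex. -/
def IsQPath {n : ℕ} : SignedPerm n → List (PosRoot n × SignedPerm n) → Prop
  | _, [] => True
  | w, (α, v) :: P => QEdge w α v ∧ IsQPath v P

/-- The vertices `u_0, …, u_p` of the path `P` starting at `u`. -/
def vertices {n : ℕ} (u : SignedPerm n) (P : List (PosRoot n × SignedPerm n)) :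
    List (SignedPerm n) := u :: P.map Prod.snd

/-- The last vertex `u_p` of the path `P` starting at `u`. -/
def endpoint {n : ℕ} (u : SignedPerm n) (P : List (PosRoot n × SignedPerm n)) : SignedPerm n :=
  (vertices u P).getLast (by simp [vertices])

/-- `Γ^i = ((i, ī), (i, \overline{i-1}), …, (i, 1̄))`. -/
def gammaRow {n : ℕ} (i : Fin n) : List (PosRoot n) :=
  .single i ::
    (List.finRange n).reverse.filterMap fun j => if h : j < i then some (.add j i h) else none

/-- `Γ_r(k) = Γ^k Γ^{k-1} ⋯ Γ^1`. -/
def gammaR (n k : ℕ) : List (PosRoot n) :=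
  ((List.finRange n).reverse.filter fun i : Fin n => i.val < k).flatMap gammaRow

/-! ### Columns and the conditions on pairs of columns -/

/-- The column `u[1, k]`. -/
def column {n k : ℕ} (hk : k ≤ n) (u : SignedPerm n) : Fin k → Letter n :=
  fun i => u.1 (.pos (Fin.castLE hk i))

/-- The columns `C` and `C'` are blocked off at `i` by `b = C'(i)`. In the numbering of `Fin n` the
condition `b < n` on the letter `b` reads `b + 1 < n`. -/
def BlockedOff {n k : ℕ} (C C' : Fin k → Letter n) (i : Fin k) : Prop :=
  ∃ b : Fin n, C' i = .pos b ∧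
    ((C i).abs ≤ b ∧ (b : ℕ) + 1 < n ∧ ((C i).abs = b ↔ C i = .neg b)) ∧
    ((∀ x ≤ b, ∃ j ≤ i, (C j).abs = x) ∧ (∀ x ≤ b, ∃ j ≤ i, (C' j).abs = x)) ∧
    Odd (Finset.univ.filter fun j => j ≤ i ∧ (C j).IsNeg ∧ (C' j).IsPos).card

/-- The three conditions on a pair of adjacent columns `C C'`. -/
structure Conditions {n k : ℕ} (C C' : Fin k → Letter n) : Prop where
  cond1 : ∀ i l : Fin k, i < l → C i ≠ C' l
  cond2 : ∀ i l : Fin k, i < l → Letter.CircBetween (C i) (C' l) (C' i) →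
    BlockedOff C (C' ∘ Equiv.swap i l) i
  cond3 : ∀ i : Fin k, (i : ℕ) + 1 < k → ¬ BlockedOff C C' i

/-- The column `C`, reordered increasingly. -/
def sortColumn {n k : ℕ} (C : Fin k → Letter n) : List (Letter n) :=
  (Finset.univ.val.map C).sort (· ≤ ·)

/-! ### Kashiwara–Nakashima columns of type `B_n`, splitting and extending -/

/-- The alphabet `1 < ⋯ < n < 0 < n̄ < ⋯ < 1̄`, with the same numbering as in `Letter`. -/
inductive KNLetter (n : ℕ) where
  | pos (i : Fin n) : KNLetter n
  | zero : KNLetter n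
  | neg (i : Fin n) : KNLetter n
  deriving DecidableEq, Fintype

/-- The position (from `0` to `2n`) of a letter in `1 < ⋯ < n < 0 < n̄ < ⋯ < 1̄`. -/
def KNLetter.key {n : ℕ} : KNLetter n → ℕ
  | pos i => i
  | zero => n
  | neg i => 2 * n - i

theorem KNLetter.key_injective {n : ℕ} : Function.Injective (key : KNLetter n → ℕ) := by
  intro a b h
  cases a <;> cases b <;> simp only [key] at h <;>
    first | rfl | (congr 1; omega)

instance {n : ℕ} : LinearOrder (KNLetter n) := LinearOrder.lift' KNLetter.key KNLetter.key_injective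

/-- KN columns of height `r` in type `B_n`, read from top to bottom. In `adm`, the letter `j + 1`
is in box `p + 1` from the top and its bar is in box `r - q` from the bottom. -/
structure IsKNColumn {n r : ℕ} (D : Fin r → KNLetter n) : Prop where
  increasing : ∀ p q : Fin r, p < q → D p < D q ∨ (D p = .zero ∧ D q = .zero)
  adm : ∀ (p q : Fin r) (j : Fin n), D p = .pos j → D q = .neg j →
    ((p : ℕ) + 1) + (r - q) ≤ (j : ℕ) + 1

/-- The list `z_1 ≥ z_2 ≥ ⋯` of letters that are to be split: the letters `0` of the KN column `D`
(with repetitions), then the unbarred `z` such that both `z` and `z̄` occur in `D`. -/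
def splitSource {n r : ℕ} (D : Fin r → KNLetter n) : List (KNLetter n) :=
  (List.ofFn D).reverse.filter fun x =>
    match x with
    | .zero => true
    | .pos j => decide (∃ q, D q = .neg j)
    | .neg _ => false

/-- `t` is the greatest element of `[n]` with `t < m`, `t < z`, `t ∉ D` and `t̄ ∉ D`, and the
following entries of the second list are obtained in the same way from the following entries of the
first list, where each entry of the second list is to be smaller than the preceding one. -/
def IsSplittingFrom {n r : ℕ} (D : Fin r → KNLetter n) :
    ℕ → List (KNLetter n) → List (Fin n) → Prop
  | _, [], [] => True
  | m, z :: zs, t :: ts =>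
    IsGreatest {x : Fin n | (x : ℕ) < m ∧ KNLetter.pos x < z ∧
      ∀ q, D q ≠ .pos x ∧ D q ≠ .neg x} t ∧ IsSplittingFrom D t zs ts
  | _, _, _ => False

/-- `t_1 > t_2 > ⋯` are the letters used in splitting the column `D`. -/
def IsSplitting {n r : ℕ} (D : Fin r → KNLetter n) (t : List (Fin n)) : Prop :=
  IsSplittingFrom D n (splitSource D) t

/-- The set of entries of `lD`: each `z_i` is changed into `t_i`. -/
def leftEntries {n r : ℕ} (D : Fin r → KNLetter n) (t : List (Fin n)) : Finset (Letter n) :=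
  (Finset.univ.filter fun i =>
      ((∃ q, D q = .pos i) ∧ ¬ ∃ q, D q = .neg i) ∨ i ∈ t).image Letter.pos ∪
    (Finset.univ.filter fun i => ∃ q, D q = .neg i).image Letter.neg

/-- The set of entries of `rD`: each `\overline{z_i}` (which is `0` if `z_i = 0`) is changed into
`\overline{t_i}`. -/
def rightEntries {n r : ℕ} (D : Fin r → KNLetter n) (t : List (Fin n)) : Finset (Letter n) :=
  (Finset.univ.filter fun i => ∃ q, D q = .pos i).image Letter.pos ∪
    (Finset.univ.filter fun i =>
      ((∃ q, D q = .neg i) ∧ ¬ ∃ q, D q = .pos i) ∨ i ∈ t).image Letter.neg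

/-- The `i` in `[n]` such that neither `i` nor `ī` occurs in the columns with entries `L` and `R`. -/
def freeLetters {n : ℕ} (L R : Finset (Letter n)) : Finset (Fin n) :=
  Finset.univ.filter fun i => ∀ a ∈ L ∪ R, a.abs ≠ i

/-- The `m` smallest free letters `i_1 < ⋯ < i_m`. -/
def extLetters {n : ℕ} (L R : Finset (Letter n)) (m : ℕ) : Finset (Fin n) :=
  (freeLetters L R).filter fun i => ((freeLetters L R).filter fun j => j < i).card < m

/-- `(L, R)` is the pair of increasing columns `(lD, rD)` of height `k` of a KN column `D` of type
`B_n`: `D` has height `r ≤ k` with `k - r` even, it is split, and its split columns are extended to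
height `k` by appending `ī_1, …, ī_{k-r}` on the left and `i_1, …, i_{k-r}` on the right. -/
def IsSplitPair {n : ℕ} (k : ℕ) (L R : List (Letter n)) : Prop :=
  ∃ r ≤ k, Even (k - r) ∧ ∃ D : Fin r → KNLetter n, IsKNColumn D ∧
    ∃ t, IsSplitting D t ∧
      L = (leftEntries D t ∪
        (extLetters (leftEntries D t) (rightEntries D t) (k - r)).image .neg).sort (· ≤ ·) ∧
      R = (rightEntries D t ∪
        (extLetters (leftEntries D t) (rightEntries D t) (k - r)).image .pos).sort (· ≤ ·)

/-- `P` is a path of the quantum Bruhat graph from `u` to some `v` with `v[1, k] = C'` whose edge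
labels form a subsequence of `Γ_r(k)`. -/
structure IsColumnPath {n k : ℕ} (hk : k ≤ n) (u : SignedPerm n) (C' : Fin k → Letter n)
    (P : List (PosRoot n × SignedPerm n)) : Prop where
  path : IsQPath u P
  labels : (P.map Prod.fst).Sublist (gammaR n k)
  target : column hk (endpoint u P) = C'

end TypeB

/-! Letters are coded by integers so that barring is `z ↦ -1 - z` and the circular order on the
alphabet is the cyclic order of `-n, …, n - 1`. A pair of columns is completed to two windows `u`,
`v` that agree from position `k` on. No label of the chain touches these positions, and since `k <
n` there is at least one such unused letter; no row may pass over it or over its bar.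

In these terms an edge labelled `ε_p + ε_q` moves the entry of row `q` forward to the bar of the
entry of row `p`, without passing over the bars of the entries of the rows in between, nor over the
later entries and their bars (`addEdge_iff`). It is a quantum edge exactly when this move crosses
zero. An edge labelled `ε_q` turns a positive entry into its bar when all later entries have smaller
absolute value (`singleEdge_iff`). A path therefore treats the rows from the last to the first: each
row is flipped at most once, and then hops over the bars of the rows above it.

Given the target `v`, every decision is forced: flip row `q` if and only if `u q` is positive and `v
q` negative, and hop with row `p` if and only if the bar of `u p` lies in `(u q, v q]`. The
invariant is `Good`: no row passes over an unused letter or its bar, an even number of rows goes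
from a negative to a positive letter, and Conditions 1–3 hold. The forced step is an edge and keeps
the invariant (`Good.flip`, `Good.hop`); conversely, an edge that leads to a good state comes from a
good state in which this step was forced (`Good.flip_back`, `Good.hop_back`). Induction along the
chain gives existence and uniqueness of the path together (`characterizes_gammaR`).

The heart is a parity argument. By `IsWindow.closed_symm`, a set of absolute values that the rows do
not leave is not entered either. By `Good.false_of_odd`, the letters of absolute value below some
bound cannot be closed in this sense, avoid the last row and contain an odd number of rows crossing
zero: a descent on the bound ends in a violation of Condition 3.

Split columns enter through counting. For each gap between neighbouring letters one counts the rows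
that cross it. The count at the gap after `x`, and at its mirror image, is the count at zero plus
the difference of the numbers of positive letters up to `x` in both columns (`gapCount_of_nonneg`,
`gapCount_bar`). Hence, given Conditions 1–3, goodness means that this difference has an even lower
bound attained at every unused letter (`good_iff_splitCondition`). The same condition describes
extended split columns: the letters appended in the extension are those at which the difference
reaches a new minimum, and the remaining ones are matched by the greedy splitting (`exists_split`).
-/

namespace TypeB.Coded

/-! ### Coded windows, and the parity obstruction. -/

/-- `y` lies strictly between `a` and `c` on the circle. -/
def Sbt (a y c : ℤ) : Prop := (a < y ∧ y < c) ∨ (y < c ∧ c < a) ∨ (c < a ∧ a < y)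

/-- The sequence `u 0, …, u (n - 1)` codes the window of a signed permutation: the letter `i` is
coded by `i - 1` and its bar by `-i`, so that barring is `z ↦ -1 - z`. -/
structure IsWindow (n : ℕ) (u : ℕ → ℤ) : Prop where
  lower : ∀ i < n, -(n : ℤ) ≤ u i
  upper : ∀ i < n, u i < n
  inj : ∀ i < n, ∀ j < n, i ≠ j → u i ≠ u j
  inj_bar : ∀ i < n, ∀ j < n, i ≠ j → u i ≠ -1 - u j

/-- The absolute value of a coded letter. -/
def mag (z : ℤ) : ℕ := if 0 ≤ z then z.toNat else (-1 - z).toNat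

theorem mag_cases (z : ℤ) : (0 ≤ z ∧ (mag z : ℤ) = z) ∨ (z < 0 ∧ (mag z : ℤ) = -1 - z) := by
  unfold mag
  split_ifs <;> omega

namespace IsWindow

variable {n : ℕ} {u v : ℕ → ℤ}

theorem image_mag (hu : IsWindow n u) :
    (Finset.range n).image (fun i => mag (u i)) = Finset.range n := by
  apply Finset.eq_of_subset_of_card_le
  · intro x hx
    simp only [Finset.mem_image, Finset.mem_range] at hx ⊢
    obtain ⟨i, hi, rfl⟩ := hx
    have := hu.lower i hi
    have := hu.upper i hi
    have := mag_cases (u i)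
    omega
  · rw [Finset.card_image_of_injOn]
    intro i hi j hj hij
    simp only [Finset.coe_range, Set.mem_Iio] at hi hj hij
    by_contra hne
    have h1 := hu.inj i hi j hj hne
    have h2 := hu.inj_bar i hi j hj hne
    have := mag_cases (u i)
    have := mag_cases (u j)
    omega

theorem exists_eq (hu : IsWindow n u) {x : ℤ} (h0 : 0 ≤ x) (hn : x < n) :
    ∃ i < n, u i = x ∨ u i = -1 - x := by
  have hx : x.toNat ∈ (Finset.range n).image (fun i => mag (u i)) := by
    rw [hu.image_mag, Finset.mem_range]
    omega
  obtain ⟨i, hi, hix⟩ := Finset.mem_image.1 hx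
  refine ⟨i, Finset.mem_range.1 hi, ?_⟩
  have := mag_cases (u i)
  omega

-- A property invariant under barring depends on the absolute value only, and a window takes each
-- absolute value below `n` exactly once.
open Classical in
theorem card_filter (hu : IsWindow n u) {V : ℤ → Prop} (hV : ∀ z, V z → V (-1 - z)) :
    ((Finset.range n).filter fun i => V (u i)).card =
      ((Finset.range n).filter fun x : ℕ => V x).card := by
  have key : ∀ i, V (u i) ↔ V (mag (u i) : ℤ) := by
    intro i
    rcases mag_cases (u i) with h | h
    · rw [h.2]
    · rw [h.2]
      exact ⟨hV _, fun h' => by simpa using hV _ h'⟩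
  conv_rhs => rw [← hu.image_mag]
  rw [Finset.filter_image, Finset.card_image_of_injOn]
  · simp only [key]
  · intro i hi j hj hij
    simp only [Finset.coe_filter, Finset.mem_range, Set.mem_ofPred_eq] at hi hj hij
    by_contra hne
    have h1 := hu.inj i hi.1 j hj.1 hne
    have h2 := hu.inj_bar i hi.1 j hj.1 hne
    have := mag_cases (u i)
    have := mag_cases (u j)
    omega

/-- A set of absolute values which is closed under passing from the entries of `u` to the entries
of `v` in the same positions is also closed under passing from `v` to `u`. -/
theorem closed_symm (hu : IsWindow n u) (hv : IsWindow n v) (V : ℤ → Prop)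
    (hV : ∀ z, V z → V (-1 - z)) (h : ∀ m < n, V (u m) → V (v m)) :
    ∀ m < n, V (v m) → V (u m) := by
  classical
  have hsub : ((Finset.range n).filter fun i => V (u i)) ⊆
      (Finset.range n).filter fun i => V (v i) := by
    intro i hi
    simp only [Finset.mem_filter, Finset.mem_range] at hi ⊢
    exact ⟨hi.1, h i hi.1 hi.2⟩
  -- Both sets have as many elements as there are absolute values satisfying `V`, so the inclusion
  -- is an equality.
  have heq := Finset.eq_of_subset_of_card_le hsub
    (by rw [hu.card_filter hV, hv.card_filter hV])
  intro m hm hvm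
  have : m ∈ (Finset.range n).filter fun i => V (v i) := by simp [hm, hvm]
  rw [← heq] at this
  exact (Finset.mem_filter.1 this).2

theorem swap (hv : IsWindow n v) {i j : ℕ} (hi : i < n) (hj : j < n) :
    IsWindow n (v ∘ Equiv.swap i j) := by
  have hlt : ∀ m < n, Equiv.swap i j m < n := by
    intro m hm
    rw [Equiv.swap_apply_def]
    split_ifs <;> assumption
  have hne : ∀ a b, a ≠ b → Equiv.swap i j a ≠ Equiv.swap i j b :=
    fun a b h h' => h ((Equiv.swap i j).injective h')
  exact ⟨fun m hm => hv.lower _ (hlt m hm), fun m hm => hv.upper _ (hlt m hm),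
    fun a ha b hb h => hv.inj _ (hlt a ha) _ (hlt b hb) (hne a b h),
    fun a ha b hb h => hv.inj_bar _ (hlt a ha) _ (hlt b hb) (hne a b h)⟩

end IsWindow

/-- The number of positions before `s` in which a negative letter becomes positive. -/
def crossings (u v : ℕ → ℤ) (s : ℕ) : ℕ :=
  ((Finset.range s).filter fun j => u j < 0 ∧ 0 ≤ v j).card

theorem crossings_succ (u v : ℕ → ℤ) (s : ℕ) :
    crossings u v (s + 1) = crossings u v s + if u s < 0 ∧ 0 ≤ v s then 1 else 0 := by
  unfold crossings
  rw [Finset.range_add_one, Finset.filter_insert]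
  split_ifs with h
  · rw [Finset.card_insert_of_notMem (by simp)]
  · rfl

/-- The columns `u` and `v`, the latter with entry `b` in position `i`, are blocked off at `i` by
`b`. -/
structure Blocked (n : ℕ) (u v : ℕ → ℤ) (i : ℕ) (b : ℤ) : Prop where
  nonneg : 0 ≤ b
  lt_last : b + 1 < n
  lower : -1 - b ≤ u i
  upper : u i < b
  source : ∀ x, 0 ≤ x → x ≤ b → ∃ j ≤ i, u j = x ∨ u j = -1 - x
  target : ∀ x, 0 ≤ x → x < b → ∃ j < i, v j = x ∨ v j = -1 - x
  odd : Odd (crossings u v i + if u i < 0 then 1 else 0)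

/-- The condition on the first `k` entries of `u` and `v` that characterizes the existence of a
path. -/
structure Good (n k : ℕ) (u v : ℕ → ℤ) : Prop where
  lt : k < n
  src : IsWindow n u
  tgt : IsWindow n v
  agree : ∀ m, k ≤ m → m < n → u m = v m
  avoid : ∀ i < k, ∀ m, k ≤ m → m < n → ¬ Sbt (u i) (u m) (v i)
  avoid_bar : ∀ i < k, ∀ m, k ≤ m → m < n → ¬ Sbt (u i) (-1 - u m) (v i)
  even : Even (crossings u v k)
  cond1 : ∀ i l, i < l → l < k → u i ≠ v l
  cond2 : ∀ i l, i < l → l < k → Sbt (u i) (v l) (v i) → Blocked n u v i (v l)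
  cond3 : ∀ i, i + 1 < k → ¬ Blocked n u v i (v i)

namespace Good

variable {n k : ℕ} {u v : ℕ → ℤ}

/-- If the letters of absolute value less than `g` are closed under passing from `u` to `v`, they
lie before the last active position, and their rows cross zero an odd number of times, then the
third condition fails. -/
theorem false_of_odd (h : Good n k u v) (g : ℕ)
    (hg : ∀ m < n, -(g : ℤ) ≤ u m → u m < g → m + 1 < k ∧ -(g : ℤ) ≤ v m ∧ v m < g)
    (hodd : Odd ((Finset.range k).filter
      fun m => (-(g : ℤ) ≤ u m ∧ u m < g) ∧ u m < 0 ∧ 0 ≤ v m).card) : False := by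
  induction g using Nat.strong_induction_on with
  | _ g ih =>
  have hkn := h.lt
  -- the closed set of rows is nonempty; take its last row
  obtain ⟨m₀, hm₀⟩ := Finset.card_pos.1 hodd.pos
  simp only [Finset.mem_filter, Finset.mem_range] at hm₀
  obtain ⟨i, hi, himax⟩ := Finset.exists_max_image
    ((Finset.range k).filter fun m => -(g : ℤ) ≤ u m ∧ u m < g) id
    ⟨m₀, by simp only [Finset.mem_filter, Finset.mem_range]; exact ⟨hm₀.1, hm₀.2.1⟩⟩
  simp only [Finset.mem_filter, Finset.mem_range, id] at hi himax
  have himax' : ∀ m < n, -(g : ℤ) ≤ u m → u m < g → m ≤ i := fun m hm h1 h2 =>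
    himax m ⟨by have := (hg m hm h1 h2).1; omega, h1, h2⟩
  have hik := (hg i (by omega) hi.2.1 hi.2.2)
  have hin : i < n := by omega
  -- the complement is closed as well
  have hg' : ∀ m < n, -(g : ℤ) ≤ v m → v m < g → -(g : ℤ) ≤ u m ∧ u m < g := fun m hm h1 h2 =>
    h.src.closed_symm h.tgt (fun z => -(g : ℤ) ≤ z ∧ z < g) (fun z hz => by omega)
      (fun m hm hz => (hg m hm hz.1 hz.2).2) m hm ⟨h1, h2⟩
  -- rows in the closed set increase
  have hle : ∀ m < n, -(g : ℤ) ≤ u m → u m < g → u m ≤ v m := by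
    intro m hm h1 h2
    have h3 := hg m hm h1 h2
    have h4 := h.avoid m (by omega) k le_rfl hkn
    have h5 := h.avoid_bar m (by omega) k le_rfl hkn
    -- The unused letter `u k` and its bar lie outside `[-g, g)`, one on each side. A row that
    -- starts and ends inside but decreases would wrap around the circle and pass over both.
    have h6 : ¬ (-(g : ℤ) ≤ u k ∧ u k < g) := fun h7 => by
      have := (hg k hkn h7.1 h7.2).1
      omega
    unfold Sbt at h4 h5
    omega
  rcases lt_or_ge (v i) 0 with hneg | hpos
  · -- the last row ends in a negative letter
    obtain ⟨z, hz⟩ : ∃ z : ℕ, v i = -1 - (z : ℤ) := ⟨(-1 - v i).toNat, by omega⟩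
    -- A row from below `v i` to above it would pass over `v i`, and by Condition 2 be blocked off
    -- by it; but only positive letters block off.
    have hrow : ∀ m < n, -(g : ℤ) ≤ u m → u m < -1 - (z : ℤ) → v m ≤ -1 - (z : ℤ) := by
      intro m hm h1 h2
      by_contra hcon
      have hmi : m ≤ i := himax' m hm h1 (by omega)
      have hmi' : m ≠ i := fun h' => by subst h'; omega
      have := (h.cond2 m i (by omega) (by omega) (by unfold Sbt; omega)).nonneg
      omega
    have hend : ∀ m < n, -(g : ℤ) ≤ u m → u m = -1 - (z : ℤ) → m = i := by
      intro m hm h1 h2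
      have hmi : m ≤ i := himax' m hm h1 (by omega)
      by_contra hne
      exact h.cond1 m i (by omega) (by omega) (by omega)
    -- The shell of absolute values from `z` to `g - 1` is closed: rows that start in its negative
    -- part stay there, and rows that start in its positive part increase. So its complement `[-z,
    -- z)` is closed too. The rows crossing zero all start in `[-z, z)`, and the descent goes on
    -- with `z`.
    have hclosed := h.src.closed_symm h.tgt
      (fun y => (-(g : ℤ) ≤ y ∧ y < g) ∧ ¬ (-(z : ℤ) ≤ y ∧ y < z)) (fun y hy => by omega)
      (fun m hm hy => by
        have h1 := hg m hm hy.1.1 hy.1.2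
        have h2 := hle m hm hy.1.1 hy.1.2
        have h3 := hrow m hm hy.1.1
        have h4 := hend m hm hy.1.1
        by_cases hmi : m = i
        · subst hmi; omega
        · omega)
    refine ih z (by omega) (fun m hm h1 h2 => ?_) ?_
    · have h3 := hg m hm (by omega) (by omega)
      have h4 := hclosed m hm
      refine ⟨h3.1, ?_⟩
      by_contra h5
      have := h4 ⟨h3.2, h5⟩
      omega
    · convert hodd using 2
      ext m
      simp only [Finset.mem_filter, Finset.mem_range]
      refine ⟨fun h1 => ⟨h1.1, by omega, h1.2.2⟩, fun h1 => ⟨h1.1, ?_, h1.2.2⟩⟩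
      have h2 := hrow m (by omega) h1.2.1.1
      have h3 := hend m (by omega) h1.2.1.1
      by_cases hmi : m = i
      · subst hmi; omega
      · omega
  · -- the last row ends in a positive letter
    obtain ⟨b, hb⟩ : ∃ b : ℕ, v i = (b : ℤ) := ⟨(v i).toNat, by omega⟩
    by_cases hex : ∃ m < i, -(g : ℤ) ≤ u m ∧ u m < g ∧ Sbt (u m) b (v m)
    · obtain ⟨m, hmi, hm1, hm2, hm3⟩ := hex
      have hB : Blocked n u v m b := hb ▸ h.cond2 m i hmi (by omega) (by rw [hb]; exact hm3)
      have hmg := hg m (by omega) hm1 hm2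
      have hmle := hle m (by omega) hm1 hm2
      have hpos' : ∀ j < n, -1 - (b : ℤ) ≤ u j → u j ≤ b → j ≤ m := by
        intro j hj h1 h2
        obtain ⟨j', hj', h3⟩ := hB.source (if 0 ≤ u j then u j else -1 - u j)
          (by split_ifs <;> omega) (by split_ifs <;> omega)
        by_contra hcon
        have h4 := h.src.inj j hj j' (by omega) (by omega)
        have h5 := h.src.inj_bar j hj j' (by omega) (by omega)
        split_ifs at h3 <;> omega
      have htgt : ∀ j < n, 0 ≤ v j → v j < b → j < m := by
        intro j hj h1 h2
        obtain ⟨j', hj', h3⟩ := hB.target (v j) h1 h2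
        by_contra hcon
        have h4 := h.tgt.inj j hj j' (by omega) (by omega)
        have h5 := h.tgt.inj_bar j hj j' (by omega) (by omega)
        omega
      have hilow : u i < -1 - (b : ℤ) := by
        have h1 := hle i hin hi.2.1 hi.2.2
        by_contra hcon
        have := hpos' i hin (by omega) (by omega)
        omega
      have hvm : (b : ℤ) < v m := by unfold Sbt at hm3; omega
      -- The rows crossing zero are row `i` and those up to row `m`. The blocking at `m` makes the
      -- latter odd in number, so the total is even.
      have hset : ((Finset.range k).filter
          fun m => (-(g : ℤ) ≤ u m ∧ u m < g) ∧ u m < 0 ∧ 0 ≤ v m) =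
          insert i ((Finset.range (m + 1)).filter fun j => u j < 0 ∧ 0 ≤ v j) := by
        ext j
        simp only [Finset.mem_filter, Finset.mem_range, Finset.mem_insert]
        constructor
        · rintro ⟨h1, h2, h3⟩
          by_contra hcon
          have hji := himax' j (by omega) h2.1 h2.2
          have hji' : j < i := by omega
          have h4 := hpos' j (by omega)
          have h5 := htgt j (by omega)
          have h6 := h.tgt.inj j (by omega) i hin (by omega)
          have h7 := (h.cond2 j i hji' (by omega) (by unfold Sbt; omega)).lower
          omega
        · rintro (h1 | h1)
          · subst h1; omega
          · refine ⟨by omega, ?_, h1.2⟩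
            by_contra hcon
            have h4 := hg' j (by omega)
            have h5 := h.tgt.upper i hin
            have h7 := (h.cond2 j i (by omega) (by omega) (by unfold Sbt; omega)).lower
            omega
      rw [hset, Finset.card_insert_of_notMem (by simp; omega)] at hodd
      have h1 := hB.odd
      have h2 := crossings_succ u v m
      have h3 : 0 ≤ v m := by omega
      simp only [h3, and_true] at h2
      rw [← h2] at h1
      change Odd (crossings u v (m + 1) + 1) at hodd
      grind
    · push Not at hex
      have hrow : ∀ m < n, -(g : ℤ) ≤ u m → u m < g → m ≠ i → ¬ (u m ≤ b ∧ b ≤ v m) := by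
        intro m hm h1 h2 hmi h3
        have h4 := himax' m hm h1 h2
        have h5 := h.cond1 m i (by omega) (by omega)
        have h6 := hex m (by omega) h1 h2
        have h7 := h.tgt.inj m hm i hin hmi
        unfold Sbt at h6
        omega
      have hcl : ∀ m < n, -1 - (b : ℤ) ≤ u m → u m ≤ b → -1 - (b : ℤ) ≤ v m ∧ v m ≤ b := by
        intro m hm h1 h2
        by_cases hmi : m = i
        · subst hmi; omega
        · have h3 := hrow m hm (by omega) (by omega) hmi
          have h4 := hle m hm (by omega) (by omega)
          omega
      have hcl' := h.src.closed_symm h.tgt (fun y => -1 - (b : ℤ) ≤ y ∧ y ≤ b)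
        (fun y hy => by omega) (fun m hm hy => hcl m hm hy.1 hy.2)
      have hui : -1 - (b : ℤ) ≤ u i ∧ u i ≤ b := hcl' i hin (by omega)
      have hcross : ∀ m < n, -(g : ℤ) ≤ u m → u m < -1 - (b : ℤ) → v m < 0 := by
        intro m hm h1 h2
        by_contra h3
        have h4 := hcl' m hm
        by_cases hmi : m = i
        · subst hmi; omega
        · have := hrow m hm h1 (by omega) hmi
          omega
      -- Now no other row passes over `b`, so the letters of absolute value at most `b` are closed.
      -- If this is a smaller set, the descent continues with it. Otherwise `g = b + 1`; if row `i`
      -- is constant, its letter `b` is removed, and in the remaining case row `i` violates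
      -- Condition 3.
      by_cases hbg : b + 1 < g
      · refine ih (b + 1) hbg (fun m hm h1 h2 => ?_) ?_
        · have h3 := hg m hm (by omega) (by omega)
          have h4 := hcl m hm (by omega) (by omega)
          omega
        · convert hodd using 2
          ext m
          simp only [Finset.mem_filter, Finset.mem_range]
          refine ⟨fun h1 => ⟨h1.1, by omega, h1.2.2⟩, fun h1 => ⟨h1.1, ?_, h1.2.2⟩⟩
          have := hcross m (by omega) h1.2.1.1
          omega
      · have hbg' : (g : ℤ) = b + 1 := by omega
        by_cases hub : u i = b
        · refine ih b (by omega) (fun m hm h1 h2 => ?_) ?_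
          · have h3 := hg m hm (by omega) (by omega)
            have h4 : m ≠ i := fun h' => by subst h'; omega
            have h5 := h.tgt.inj m hm i hin h4
            have h6 := h.tgt.inj_bar m hm i hin h4
            omega
          · convert hodd using 2
            ext m
            simp only [Finset.mem_filter, Finset.mem_range]
            refine ⟨fun h1 => ⟨h1.1, by omega, h1.2.2⟩, fun h1 => ⟨h1.1, ?_, h1.2.2⟩⟩
            by_cases hmi : m = i
            · subst hmi; omega
            · have h5 := h.src.inj m (by omega) i hin hmi
              have h6 := h.src.inj_bar m (by omega) i hin hmi
              omega
        -- All rows of the closed set come no later than `i`, they use up the letters up to `b`, and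
        -- an odd number of them crosses zero: this is blocking at `i` by its own end. Condition 3
        -- applies since row `i` is not the last active row.
        · refine h.cond3 i hik.1 ?_
          rw [hb]
          refine ⟨by omega, ?_, hui.1, by omega, ?_, ?_, ?_⟩
          · have h1 := h.src.lower k hkn
            have h2 := h.src.upper k hkn
            by_contra h3
            have := (hg k hkn (by omega) (by omega)).1
            omega
          · intro x hx0 hxb
            have := h.tgt.upper i hin
            obtain ⟨j, hj, h1⟩ := h.src.exists_eq hx0 (by omega)
            exact ⟨j, himax' j hj (by omega) (by omega), h1⟩
          · intro x hx0 hxb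
            have := h.tgt.upper i hin
            obtain ⟨j, hj, h1⟩ := h.tgt.exists_eq hx0 (by omega)
            have h2 := hcl' j hj (by omega)
            have h3 := himax' j hj (by omega) (by omega)
            exact ⟨j, lt_of_le_of_ne h3 (fun h' => by subst h'; omega), h1⟩
          · have h2 := crossings_succ u v i
            have h3 : 0 ≤ v i := by omega
            simp only [h3, and_true] at h2
            rw [← h2]
            convert hodd using 1
            unfold crossings
            congr 1
            ext j
            simp only [Finset.mem_filter, Finset.mem_range]
            constructor
            · rintro ⟨h4, h5⟩
              refine ⟨by omega, ?_, h5⟩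
              by_contra h6
              have h7 := hg' j (by omega)
              have h8 : j ≠ i := fun h' => by subst h'; omega
              have h9 := (h.cond2 j i (by omega) (by omega) (by unfold Sbt; omega)).lower
              omega
            · rintro ⟨h4, h5, h6⟩
              exact ⟨by have := himax' j (by omega) h5.1 h5.2; omega, h6⟩

end Good

end TypeB.Coded

/-! ### The last active row and the rows that interact with it. -/

namespace TypeB.Coded

/-- `y` lies in the half-open interval `(x, c]` of the circle. -/
def InIoc (x y c : ℤ) : Prop := (x < y ∧ y ≤ c) ∨ (y ≤ c ∧ c < x) ∨ (c < x ∧ x < y)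

namespace Blocked

variable {n i : ℕ} {u v : ℕ → ℤ} {b : ℤ}

/-- The rows up to `i` already use every absolute value at most `b`, and no absolute value occurs
twice in a window. -/
theorem le_of_mag_le (h : Blocked n u v i b) (hu : IsWindow n u) {j : ℕ} (hj : j < n)
    (h1 : -1 - b ≤ u j) (h2 : u j ≤ b) : j ≤ i := by
  obtain ⟨j', hj', h3⟩ := h.source (if 0 ≤ u j then u j else -1 - u j)
    (by split_ifs <;> omega) (by split_ifs <;> omega)
  by_contra hcon
  have h4 := hu.inj j hj j' (by omega) (by omega)
  have h5 := hu.inj_bar j hj j' (by omega) (by omega)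
  split_ifs at h3 <;> omega

theorem lt_of_mag_lt (h : Blocked n u v i b) (hv : IsWindow n v) {j : ℕ} (hj : j < n)
    (h1 : -1 - b < v j) (h2 : v j < b) : j < i := by
  obtain ⟨j', hj', h3⟩ := h.target (if 0 ≤ v j then v j else -1 - v j)
    (by split_ifs <;> omega) (by split_ifs <;> omega)
  by_contra hcon
  have h4 := hv.inj j hj j' (by omega) (by omega)
  have h5 := hv.inj_bar j hj j' (by omega) (by omega)
  split_ifs at h3 <;> omega

end Blocked

namespace Good

variable {n q : ℕ} {u v : ℕ → ℤ}

/-- The configuration in which the row `i` passes over the last entry `v q`. -/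
structure Passed (n q i : ℕ) (u v : ℕ → ℤ) : Prop where
  blocked : Blocked n u v i (v q)
  outside : u q < -1 - v q ∨ v q < u q
  le : ∀ m < n, -1 - v q ≤ u m → u m ≤ v q → m ≤ i
  exit : v q < v i
  closed : ∀ m < n, m ≠ i → -1 - v q ≤ u m → u m ≤ v q → u m ≤ v m ∧ v m < v q
  closed_symm : ∀ m < n, m ≠ q → -1 - v q ≤ v m → v m ≤ v q →
    m ≠ i ∧ -1 - v q ≤ u m ∧ u m ≤ v q

/-- Condition 2 blocks row `i` off by `v q`, so all absolute values up to `v q` start in rows up to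
`i`. In particular the unused letter is larger in absolute value, which forces row `i` to leave
upwards. Another row passing over `v q` would be blocked in the same way, and then each of the two
rows would come no later than the other. Thus row `i` alone leaves the interval and row `q` alone
enters it. -/
theorem passed (h : Good n (q + 1) u v) {i : ℕ} (hi : i < q) (hs : Sbt (u i) (v q) (v i)) :
    Passed n q i u v := by
  have hq := h.lt
  have hB := h.cond2 i q hi (by omega) hs
  have hle : ∀ m < n, -1 - v q ≤ u m → u m ≤ v q → m ≤ i := fun m hm h1 h2 =>
    hB.le_of_mag_le h.src hm h1 h2
  have hun : ¬ (-1 - v q ≤ u (q + 1) ∧ u (q + 1) ≤ v q) := fun h1 => by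
    have := hle (q + 1) hq h1.1 h1.2
    omega
  have hb := hB.nonneg
  have hout : u q < -1 - v q ∨ v q < u q := by
    by_contra h1
    have := hle q (by omega) (by omega) (by omega)
    omega
  have hexit : v q < v i := by
    have h1 := h.avoid i (by omega) (q + 1) le_rfl hq
    have h2 := h.avoid_bar i (by omega) (q + 1) le_rfl hq
    have h3 := hB.lower
    have h4 := hB.upper
    unfold Sbt at h1 h2 hs
    omega
  have hcl : ∀ m < n, m ≠ i → -1 - v q ≤ u m → u m ≤ v q → u m ≤ v m ∧ v m < v q := by
    intro m hm hmi h1 h2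
    have h3 := hle m hm h1 h2
    have h4 := h.cond1 m q (by omega) (by omega)
    have h5 := h.tgt.inj m hm q (by omega) (by omega)
    have h6 : ¬ Sbt (u m) (v q) (v m) := fun h6 => by
      have := (h.cond2 m q (by omega) (by omega) h6).le_of_mag_le h.src (j := i) (by omega)
        hB.lower hB.upper.le
      omega
    have h7 := h.avoid m (by omega) (q + 1) le_rfl hq
    have h8 := h.avoid_bar m (by omega) (q + 1) le_rfl hq
    unfold Sbt at h6 h7 h8
    omega
  refine ⟨hB, hout, hle, hexit, hcl, ?_⟩
  intro m hm hmq h1 h2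
  have hmi : m ≠ i := fun h' => by subst h'; omega
  -- Exchanging the ends of rows `i` and `q` makes the interval closed, so that the counting
  -- principle applies.
  have hsym := h.src.closed_symm (h.tgt.swap (i := i) (j := q) (by omega) (by omega))
    (fun z => -1 - v q ≤ z ∧ z ≤ v q) (fun z hz => by omega) (by
      intro m hm hz
      have h3 := hcl m hm
      simp only [Function.comp, Equiv.swap_apply_def]
      split_ifs with h4 h5
      · omega
      · subst h5; omega
      · have := h3 h4 hz.1 hz.2
        omega) m hm
  simp only [Function.comp, Equiv.swap_apply_def, hmi, hmq, if_false] at hsym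
  exact ⟨hmi, hsym ⟨h1, h2⟩⟩

/-- If the last entry `c` of `v` is positive, and the letters `1, …, c` are used, then the rows
crossing zero start in letters of absolute value at most `c`. -/
theorem crosser_lower (h : Good n (q + 1) u v) (hc : 0 ≤ v q)
    (hun : ∀ m, q < m → m < n → u m < -1 - v q ∨ v q < u m) {m : ℕ} (hm : m < q) (h1 : u m < 0)
    (h2 : 0 ≤ v m) : -1 - v q ≤ u m := by
  have hq := h.lt
  -- A row from below `-1 - v q` to a nonnegative letter either passes over `v q`, against the lower
  -- bound contained in blocking or the absence of such rows, or it ends in `[-1 - v q, v q]`, which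
  -- no such row enters.
  by_contra hcon
  by_cases hex : ∃ i < q, Sbt (u i) (v q) (v i)
  · obtain ⟨i, hi, hs⟩ := hex
    have hP := h.passed hi hs
    have h3 := hP.closed_symm m (by omega) (by omega)
    have h4 := (h.passed hm (by unfold Sbt; omega)).blocked.lower
    omega
  · push Not at hex
    have hcl := h.src.closed_symm h.tgt (fun z => -1 - v q ≤ z ∧ z ≤ v q)
      (fun z hz => by omega) (by
        intro m hm hz
        rcases lt_trichotomy m q with hmq | rfl | hmq
        · have h3 := hex m hmq
          have h4 := h.cond1 m q hmq (by omega)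
          have h5 := h.tgt.inj m hm q (by omega) (by omega)
          have h6 := hun (q + 1) (by omega) hq
          have h7 := h.avoid m (by omega) (q + 1) le_rfl hq
          have h8 := h.avoid_bar m (by omega) (q + 1) le_rfl hq
          unfold Sbt at h3 h7 h8
          omega
        · omega
        · have := hun m hmq hm
          omega)
    have h3 := hcl m (by omega)
    have h4 := hex m hm
    unfold Sbt at h4
    omega

/-- If the last row crosses zero, then the letters up to its end are used. -/
theorem unused_of_crosses (h : Good n (q + 1) u v) (hx : u q < 0) (hc : 0 ≤ v q) :
    ∀ m, q < m → m < n → u m < -1 - v q ∧ u m < u q ∨ v q < u m ∧ -1 - u q < u m := by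
  intro m hm hmn
  have h1 := h.avoid q (by omega) m hm hmn
  have h2 := h.avoid_bar q (by omega) m hm hmn
  have h3 := h.tgt.inj m hmn q (by omega) (by omega)
  have h4 := h.tgt.inj_bar m hmn q (by omega) (by omega)
  have h5 := h.src.inj m hmn q (by omega) (by omega)
  have h6 := h.src.inj_bar m hmn q (by omega) (by omega)
  have h7 := h.agree m hm hmn
  unfold Sbt at h1 h2
  omega

/-- A row that does not wrap around: an active row with a positive start and end increases. -/
theorem pos_le (h : Good n (q + 1) u v) {m : ℕ} (hm : m ≤ q) (h2 : 0 ≤ v m) :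
    u m ≤ v m := by
  have hq := h.lt
  have h3 := h.avoid m (by omega) (q + 1) le_rfl hq
  have h4 := h.avoid_bar m (by omega) (q + 1) le_rfl hq
  have h5 := h.src.lower (q + 1) hq
  have h6 := h.src.upper (q + 1) hq
  have h5 := h.src.lower m (by omega)
  have h6 := h.src.upper m (by omega)
  have h5 := h.tgt.lower m (by omega)
  have h6 := h.tgt.upper m (by omega)
  have h8 := h.src.inj m (by omega) (q + 1) hq (by omega)
  have h9 := h.src.inj_bar m (by omega) (q + 1) hq (by omega)
  have h10 := h.tgt.inj m (by omega) (q + 1) hq (by omega)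
  have h11 := h.tgt.inj_bar m (by omega) (q + 1) hq (by omega)
  have h7 := h.agree (q + 1) le_rfl hq
  unfold Sbt at h3 h4
  omega

theorem neg_le (h : Good n (q + 1) u v) {m : ℕ} (hm : m ≤ q) (h1 : u m < 0) :
    u m ≤ v m := by
  have hq := h.lt
  have h3 := h.avoid m (by omega) (q + 1) le_rfl hq
  have h4 := h.avoid_bar m (by omega) (q + 1) le_rfl hq
  have h5 := h.src.lower (q + 1) hq
  have h6 := h.src.upper (q + 1) hq
  have h5 := h.src.lower m (by omega)
  have h6 := h.src.upper m (by omega)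
  have h5 := h.tgt.lower m (by omega)
  have h6 := h.tgt.upper m (by omega)
  have h8 := h.src.inj m (by omega) (q + 1) hq (by omega)
  have h9 := h.src.inj_bar m (by omega) (q + 1) hq (by omega)
  have h10 := h.tgt.inj m (by omega) (q + 1) hq (by omega)
  have h11 := h.tgt.inj_bar m (by omega) (q + 1) hq (by omega)
  have h7 := h.agree (q + 1) le_rfl hq
  unfold Sbt at h3 h4
  omega

end Good

end TypeB.Coded

namespace TypeB.Coded.Good

variable {n q : ℕ} {u v : ℕ → ℤ}

/-- The row `l` may not be blocked off by its end at an earlier row. -/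
theorem not_sbt_of_target_bar (h : Good n (q + 1) u v) (hS : u q < 0 ∨ 0 ≤ v q) {l : ℕ}
    (hl : l < q) (hE : ∀ m, l < m → m < q → ¬ InIoc (u q) (-1 - u m) (v q))
    (hd : -1 - v l = u q ∨ InIoc (u q) (-1 - v l) (v q)) {m : ℕ} (hm : m < l) :
    ¬ Sbt (u m) (v l) (v m) := by
  intro hs
  have hq := h.lt
  have hB := h.cond2 m l hm (by omega) hs
  have he := hB.nonneg
  have h1 : u q < -1 - v l ∨ v l < u q := by
    by_contra h1
    have := hB.le_of_mag_le h.src (j := q) (by omega) (by omega) (by omega)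
    omega
  have h2 : u l < -1 - v l ∨ v l < u l := by
    by_contra h1
    have := hB.le_of_mag_le h.src (j := l) (by omega) (by omega) (by omega)
    omega
  have h3 : u l < -1 - v l := by
    have := h.pos_le hl.le
    omega
  have h4 : v q < -1 - v l ∨ v l < v q := by
    by_contra h1
    have h5 := h.tgt.inj q (by omega) l (by omega) (by omega)
    have h6 := h.tgt.inj_bar q (by omega) l (by omega) (by omega)
    have := hB.lt_of_mag_lt h.tgt (j := q) (by omega) (by omega) (by omega)
    omega
  have h5 : u q < -1 - v l ∧ v l < v q := by
    have h6 := h.neg_le (le_refl q)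
    have h7 := h.pos_le (le_refl q)
    unfold InIoc at hd
    omega
  have hcr := fun j (hj : j < q) => h.crosser_lower (m := j) (by omega)
    (fun m hm hmn => by have := h.unused_of_crosses (by omega) (by omega) m hm hmn; omega) hj
  have hvm : v l < v m := by
    have h6 := h.neg_le (m := m) (by omega)
    have h7 := h.pos_le (m := m) (by omega)
    have h8 := h.avoid m (by omega) (q + 1) le_rfl hq
    have h9 := h.avoid_bar m (by omega) (q + 1) le_rfl hq
    have h10 := h.unused_of_crosses (by omega) (by omega) (q + 1) (by omega) hq
    have h11 := hB.lower
    have h12 := hB.upper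
    unfold Sbt at hs h8 h9
    omega
  -- The rows crossing zero are `q`, `l` and those up to `m`; `hE` excludes the rows between `l` and
  -- `q`. Blocking makes the number of those up to `m` odd, so the total is odd, against the
  -- invariant.
  have heq : ((Finset.range (q + 1)).filter fun j => u j < 0 ∧ 0 ≤ v j) =
      insert q (insert l ((Finset.range (m + 1)).filter fun j => u j < 0 ∧ 0 ≤ v j)) := by
    ext j
    simp only [Finset.mem_filter, Finset.mem_range, Finset.mem_insert]
    constructor
    · rintro ⟨h6, h7, h8⟩
      by_contra hcon
      have hjq : j < q := by omega
      have h9 := hcr j hjq h7 h8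
      have h10 := hE j
      rcases lt_trichotomy j l with hjl | rfl | hjl
      · have h11 := hB.le_of_mag_le h.src (j := j) (by omega)
        have h12 := hB.lt_of_mag_lt h.tgt (j := j) (by omega)
        have h13 := h.tgt.inj j (by omega) l (by omega) (by omega)
        have h14 := (h.cond2 j l hjl (by omega) (by unfold Sbt; omega)).lower
        omega
      · omega
      · unfold InIoc at h10
        omega
    · rintro (rfl | rfl | h6)
      · omega
      · omega
      · omega
  have h6 := h.even
  have h7 := hB.odd
  have h8 := crossings_succ u v m
  have h9 : 0 ≤ v m := by omega
  simp only [h9, and_true] at h8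
  rw [← h8] at h7
  unfold crossings at h6 h7
  rw [heq, Finset.card_insert_of_notMem (by simp; omega),
    Finset.card_insert_of_notMem (by simp; omega)] at h6
  grind

set_option maxHeartbeats 1000000 in
/-- The bar of the end of a row `l` cannot lie in the last row, if the bars of the starts of the
later rows do not. -/
theorem not_target_bar (h : Good n (q + 1) u v) (hS : u q < 0 ∨ 0 ≤ v q) {l : ℕ}
    (hl : l < q) (hE : ∀ m, l < m → m < q → ¬ InIoc (u q) (-1 - u m) (v q))
    (hd : (-1 - v l = u q ∧ u q ≠ v q ∧ ¬ InIoc (u q) (-1 - u l) (v q)) ∨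
      InIoc (u q) (-1 - v l) (v q)) : False := by
  have hq := h.lt
  have hX2 := fun m (hm : m < l) => h.not_sbt_of_target_bar hS hl hE (by tauto) hm
  have hun := h.avoid q (by omega) (q + 1) le_rfl hq
  have hun' := h.avoid_bar q (by omega) (q + 1) le_rfl hq
  have hag := h.agree (q + 1) le_rfl hq
  have hc1 : ∀ m < l, u m ≠ v l := fun m hm => h.cond1 m l hm (by omega)
  have hxl := h.src.inj q (by omega) l (by omega) (by omega)
  have hvl := h.tgt.inj q (by omega) l (by omega) (by omega)
  have hvl' := h.tgt.inj_bar q (by omega) l (by omega) (by omega)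
  have hE' : ∀ m < q, InIoc (u q) (-1 - u m) (v q) → m ≤ l := fun m hm hi => by
    by_contra hcon
    exact hE m (by omega) hm hi
  by_cases hex : ∃ i < q, Sbt (u i) (v q) (v i)
  · obtain ⟨i, hi, hs⟩ := hex
    have hP := h.passed hi hs
    have hb := hP.blocked.nonneg
    have hx : u q < -1 - v q := by
      have := hP.outside
      have := h.pos_le (le_refl q)
      omega
    have hil : i ≤ l := hE' i hi (by
      have := hP.blocked.lower
      have := hP.blocked.upper
      unfold InIoc
      omega)
    have he : v q < v l := by
      have h1 := hP.closed_symm l (by omega) (by omega)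
      have h2 := hP.le l (by omega)
      unfold InIoc at hd
      omega
    have hex' := hP.exit
    -- the letters up to `v l` (exclusive, if it is the bar of the last start) are closed
    have hcl := h.src.closed_symm h.tgt
      (fun z => (-1 - v l ≤ z ∧ z ≤ v l) ∧ z ≠ u q ∧ -1 - z ≠ u q)
      (fun z hz => by omega) (by
        intro m hm hz
        have hvq := h.tgt.inj m hm q (by omega)
        rcases lt_trichotomy m q with hmq | rfl | hmq
        · have h1 := hP.closed m hm
          have h2 := hE' m hmq
          have h3 := hc1 m
          have h4 := hX2 m
          have h5 := h.tgt.inj m hm l (by omega)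
          have h6 := h.neg_le (m := m) (by omega)
          have h7 := h.pos_le (m := m) (by omega)
          by_cases hmid : -1 - v q ≤ u m ∧ u m ≤ v q
          · by_cases hmi : m = i
            · subst hmi
              rcases eq_or_lt_of_le hil with rfl | hil'
              · refine ⟨by omega, ?_, ?_⟩ <;>
                · unfold InIoc at hd h2
                  omega
              · have h8 := h.avoid m (by omega) (q + 1) le_rfl hq
                have h9 := h3 hil'
                have h10 := h4 hil'
                have h12 := hP.blocked.upper
                unfold InIoc at hd
                unfold Sbt at h10
                omega
            · have := h1 hmi
              unfold InIoc at hd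
              omega
          · rcases lt_or_ge (u m) 0 with hneg | hneg
            · have h8 : ¬ Sbt (u m) (v q) (v m) := fun h8 => by
                have := (h.passed hmq h8).blocked.lower
                omega
              have h9 := h6 hneg
              have h10 := hvq (by omega)
              have h11 := h.cond1 m q (by omega) (by omega)
              unfold InIoc at hd
              unfold Sbt at h8
              omega
            · have h8 : m ≤ l := h2 (by unfold InIoc at hd ⊢; omega)
              rcases eq_or_lt_of_le h8 with rfl | h8'
              · unfold InIoc at hd h2
                omega
              · have h9 := h3 h8'
                have h10 := h4 h8'
                have h11 := h.avoid m (by omega) (q + 1) le_rfl hq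
                have h12 := h.avoid_bar m (by omega) (q + 1) le_rfl hq
                have h13 := h.unused_of_crosses (by omega) hb (q + 1) (by omega) hq
                have h14 := h5 (by omega)
                unfold Sbt at h10 h11 h12
                unfold InIoc at hd
                omega
        · omega
        · have := h.agree m hmq hm
          omega)
    -- The end `v q` lies in the set of letters just shown to be closed, but the start `u q` was
    -- removed from it.
    have := hcl q (by omega)
    unfold InIoc at hd
    omega
  · push Not at hex
    have hx0 := h.neg_le (le_refl q)
    have hx1 := h.pos_le (le_refl q)
    have havoid : ∀ m < q, u m ≠ v q ∧ v m ≠ v q ∧ ¬ Sbt (u m) (v q) (v m) := fun m hm =>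
      ⟨h.cond1 m q hm (by omega), h.tgt.inj m (by omega) q (by omega) (by omega), hex m hm⟩
    have hbar : ∀ m < q, InIoc (u q) (-1 - u m) (v q) →
        (m = l ∨ m < l ∧ u m ≠ v l ∧ v m ≠ v l ∧ ¬ Sbt (u m) (v l) (v m)) := fun m hm hi => by
      rcases eq_or_lt_of_le (hE' m hm hi) with h1 | h1
      · exact Or.inl h1
      · exact Or.inr ⟨h1, hc1 m h1, h.tgt.inj m (by omega) l (by omega) (by omega), hX2 m h1⟩
    -- `W` is the part of the last row from the bar of `v l` to `v q`. No row above passes over `v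
    -- q`, and no row before `l` passes over `v l`, so up to barring the rows that start in `W` also
    -- end in it. As `v q` is in `W`, so is `u q` up to barring; since `u q` itself is not, its bar
    -- is, and the last row crosses zero.
    let W : ℤ → Prop := fun z => InIoc (u q) z (v q) ∧ (z = -1 - v l ∨ InIoc (-1 - v l) z (v q))
    have hWc : W (v q) := by
      simp only [W]
      unfold InIoc at hd ⊢
      omega
    have hcl : ∀ m < n, (W (u m) ∨ W (-1 - u m)) → (W (v m) ∨ W (-1 - v m)) := by
      intro m hm hz
      rcases lt_trichotomy m q with hmq | rfl | hmq
      · rcases hz with hz | hz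
        · left
          have h1 := havoid m hmq
          simp only [W] at hz ⊢
          unfold InIoc at hz ⊢ hd
          unfold Sbt at h1
          omega
        · right
          rcases hbar m hmq hz.1 with rfl | h1
          · refine ⟨?_, Or.inl rfl⟩
            simp only [W] at hz
            unfold InIoc at hz ⊢ hd
            omega
          · simp only [W] at hz ⊢
            unfold InIoc at hz ⊢ hd
            unfold Sbt at h1
            omega
      · exact Or.inl hWc
      · rwa [← h.agree m hmq hm]
    have hcl' := h.src.closed_symm h.tgt (fun z => W z ∨ W (-1 - z))
      (fun z hz => by simpa [or_comm] using hz) hcl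
    have hxW := hcl' q (by omega) (Or.inl hWc)
    have hx : u q < 0 ∧ -1 - u q ≤ v q ∧ u q ≤ -1 - v l ∧ -1 - v l ≤ -1 - u q := by
      simp only [W] at hxW
      unfold InIoc at hd hxW
      omega
    have hunused := h.unused_of_crosses hx.1 (by omega)
    have hcr := fun j (hj : j < q) => h.crosser_lower (m := j) (by omega)
      (fun m hm hmn => by have := hunused m hm hmn; omega) hj
    have hin : ∀ m < q, -1 - v q ≤ u m → u m < -1 - u q → InIoc (u q) (-1 - u m) (v q) := by
      intro m hm h1 h2
      unfold InIoc
      omega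
    -- The bound `g` takes in the absolute values below that of `v l`, and also that of `v l` itself
    -- if `v l` is nonnegative and not the bar of `u q`. These letters are closed and contain every
    -- row crossing zero except `q`, hence an odd number of them.
    obtain ⟨g, hg⟩ : ∃ g : ℕ, (0 ≤ -1 - v l ∧ (g : ℤ) = -1 - v l) ∨
        (-1 - v l < 0 ∧ u q < -1 - v l ∧ (g : ℤ) = v l + 1) ∨
        (-1 - v l < 0 ∧ u q = -1 - v l ∧ (g : ℤ) = v l) := by
      by_cases h1 : 0 ≤ -1 - v l
      · exact ⟨(-1 - v l).toNat, by omega⟩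
      · by_cases h2 : u q = -1 - v l
        · exact ⟨(v l).toNat, by omega⟩
        · exact ⟨(v l + 1).toNat, by omega⟩
    have hclosed : ∀ m < n, -(g : ℤ) ≤ u m → u m < g →
        m + 1 < q + 1 ∧ -(g : ℤ) ≤ v m ∧ v m < g := by
      intro m hm h1 h2
      have hmq : m < q := by
        by_contra hcon
        rcases eq_or_lt_of_le (not_lt.1 hcon) with rfl | h3
        · omega
        · have := hunused m h3 hm
          omega
      refine ⟨by omega, ?_⟩
      have h3 := h.neg_le (m := m) (by omega)
      have h4 := h.pos_le (m := m) (by omega)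
      have h5 := h.avoid m (by omega) (q + 1) le_rfl hq
      have h6 := h.avoid_bar m (by omega) (q + 1) le_rfl hq
      have h7 := hunused (q + 1) (by omega) hq
      have h8 : u m ≤ v m := by
        unfold Sbt at h5 h6
        omega
      rcases hg with hg | hg | hg
      · have h9 := havoid m hmq
        have h10 := hcl' m hm
        by_contra h11
        have : W (u m) ∨ W (-1 - u m) := by
          apply h10
          left
          simp only [W]
          unfold Sbt at h9
          unfold InIoc
          omega
        simp only [W] at this
        unfold InIoc at this
        omega
      · have h9 := hbar m hmq (hin m hmq (by omega) (by omega))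
        unfold Sbt at h9
        rcases h9 with rfl | h9 <;> omega
      · have h9 := hbar m hmq (hin m hmq (by omega) (by omega))
        have h10 := hin m hmq (by omega) (by omega)
        unfold Sbt at h9
        rcases h9 with rfl | h9
        · unfold InIoc at h10 hd
          omega
        · omega
    have hclosed' := h.src.closed_symm h.tgt (fun z => -(g : ℤ) ≤ z ∧ z < g)
      (fun z hz => by omega) (fun m hm hz => (hclosed m hm hz.1 hz.2).2)
    refine h.false_of_odd g hclosed ?_
    have heven := h.even
    have heq : ((Finset.range (q + 1)).filter fun j => u j < 0 ∧ 0 ≤ v j) =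
        insert q ((Finset.range (q + 1)).filter
          fun m => (-(g : ℤ) ≤ u m ∧ u m < g) ∧ u m < 0 ∧ 0 ≤ v m) := by
      ext j
      simp only [Finset.mem_filter, Finset.mem_range, Finset.mem_insert]
      constructor
      · rintro ⟨h1, h2, h3⟩
        by_contra hcon
        have hjq : j < q := by omega
        have h4 := hcr j hjq h2 h3
        have h5 := hbar j hjq (hin j hjq h4 (by omega))
        have h6 := hin j hjq h4 (by omega)
        have h7 := hclosed' j (by omega)
        unfold Sbt at h5
        rcases h5 with rfl | h5
        · unfold InIoc at h6 hd
          omega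
        · omega
      · rintro (rfl | h6)
        · omega
        · omega
    unfold crossings at heven
    rw [heq, Finset.card_insert_of_notMem (by simp; omega)] at heven
    grind

end TypeB.Coded.Good

/-! ### One hop of the last row, read forwards. -/

namespace TypeB.Coded

variable {n p q : ℕ} {u u' v : ℕ → ℤ}

/-- `u'` arises from `u` by the reflection in `ε_p + ε_q`. -/
structure IsHop (p q : ℕ) (u u' : ℕ → ℤ) : Prop where
  lt : p < q
  left : u' p = -1 - u q
  right : u' q = -1 - u p
  other : ∀ m, m ≠ p → m ≠ q → u' m = u m

theorem IsHop.symm (h : IsHop p q u u') : IsHop p q u' u :=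
  ⟨h.lt, by have := h.right; omega, by have := h.left; omega, fun m h1 h2 => (h.other m h1 h2).symm⟩

theorem IsHop.isWindow (h : IsHop p q u u') (hq : q < n) (hu : IsWindow n u) : IsWindow n u' := by
  have hpq := h.lt
  have hl := h.left
  have hr := h.right
  constructor
  · intro i hi
    have := hu.upper p (by omega)
    have := hu.upper q (by omega)
    have := hu.lower i hi
    have := h.other i
    rcases eq_or_ne i p with rfl | h1
    · omega
    · rcases eq_or_ne i q with rfl | h2 <;> omega
  · intro i hi
    have := hu.lower p (by omega)
    have := hu.lower q (by omega)
    have := hu.upper i hi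
    have := h.other i
    rcases eq_or_ne i p with rfl | h1
    · omega
    · rcases eq_or_ne i q with rfl | h2 <;> omega
  · intro i hi j hj hij
    have h1 := hu.inj i hi j hj hij
    have h2 := hu.inj_bar p (by omega) i hi
    have h3 := hu.inj_bar p (by omega) j hj
    have h4 := hu.inj_bar q (by omega) i hi
    have h5 := hu.inj_bar q (by omega) j hj
    have h6 := h.other i
    have h7 := h.other j
    by_cases i = p <;> by_cases i = q <;> by_cases j = p <;> by_cases j = q <;> subst_vars <;> omega
  · intro i hi j hj hij
    have h1 := hu.inj_bar i hi j hj hij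
    have h2 := hu.inj p (by omega) i hi
    have h3 := hu.inj p (by omega) j hj
    have h4 := hu.inj q (by omega) i hi
    have h5 := hu.inj q (by omega) j hj
    have h6 := h.other i
    have h7 := h.other j
    by_cases i = p <;> by_cases i = q <;> by_cases j = p <;> by_cases j = q <;> subst_vars <;> omega

theorem crossings_congr {s : ℕ} (h : ∀ m < s, u' m = u m) : crossings u' v s = crossings u v s := by
  unfold crossings
  congr 1
  apply Finset.filter_congr
  intro m hm
  rw [h m (Finset.mem_range.1 hm)]

theorem crossings_eq_of_le {s t : ℕ} (hst : s ≤ t) (h : ∀ m, s ≤ m → m < t → ¬ (u m < 0 ∧ 0 ≤ v m)) :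
    crossings u v t = crossings u v s := by
  induction t, hst using Nat.le_induction with
  | base => rfl
  | succ t ht ih =>
    rw [crossings_succ, if_neg (h t ht (by omega)), add_zero,
      ih fun m h1 h2 => h m h1 (by omega)]

/-- Among the first `s ≤ q` rows the hop changes row `p` only. -/
theorem IsHop.crossings (h : IsHop p q u u') {s : ℕ} (hs : s ≤ q) (hps : p < s) :
    crossings u' v s + (if u p < 0 ∧ 0 ≤ v p then 1 else 0) =
      crossings u v s + (if u' p < 0 ∧ 0 ≤ v p then 1 else 0) := by
  induction s, hps using Nat.le_induction with
  | base =>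
    rw [crossings_succ, crossings_succ, crossings_congr fun m hm => h.other m (by omega) (by omega)]
    omega
  | succ s hs' ih =>
    have h1 := ih (by omega)
    rw [crossings_succ, crossings_succ, h.other s (by omega) (by omega)]
    omega

theorem Blocked.congr {i : ℕ} {b : ℤ} (hB : Blocked n u v i b) (h : ∀ m ≤ i, u' m = u m) :
    Blocked n u' v i b := by
  refine ⟨hB.nonneg, hB.lt_last, ?_, ?_, ?_, hB.target, ?_⟩
  · rw [h i le_rfl]; exact hB.lower
  · rw [h i le_rfl]; exact hB.upper
  · intro x h0 h1
    obtain ⟨j, hj, h2⟩ := hB.source x h0 h1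
    exact ⟨j, hj, by rwa [h j hj]⟩
  · rw [h i le_rfl, crossings_congr fun m hm => h m (by omega)]
    exact hB.odd

/-- Row `p` starts in an absolute value above `b`, so it is not needed for covering the letters up
to `b`; its sign is kept, so the parity does not change; and row `q` comes after `i`. -/
theorem Blocked.hop (h : IsHop p q u u') {i : ℕ} {b : ℤ} (hB : Blocked n u v i b)
    (hpi : p < i) (hiq : i < q) (h1 : u p < -1 - b ∨ b < u p)
    (h2 : u p < 0 ∧ u' p < 0 ∨ 0 ≤ u p ∧ 0 ≤ u' p) : Blocked n u' v i b := by
  have hb := hB.nonneg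
  have hi := h.other i (by omega) (by omega)
  refine ⟨hB.nonneg, hB.lt_last, ?_, ?_, ?_, hB.target, ?_⟩
  · rw [hi]; exact hB.lower
  · rw [hi]; exact hB.upper
  · intro x hx0 hx1
    obtain ⟨j, hj, h3⟩ := hB.source x hx0 hx1
    refine ⟨j, hj, ?_⟩
    rwa [h.other j (fun hjp => by subst hjp; omega) (by omega)]
  · have h4 := h.crossings (v := v) (s := i) (by omega) hpi
    have h5 := hB.odd
    rw [hi]
    have h6 : (u p < 0 ∧ 0 ≤ v p) ↔ (u' p < 0 ∧ 0 ≤ v p) := by omega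
    simp only [h6] at h4
    rwa [show TypeB.Coded.crossings u' v i = TypeB.Coded.crossings u v i by omega]

/-- The length-theoretic condition for the edge labelled `ε_p + ε_q`. -/
structure AddEdge (n p q : ℕ) (u : ℕ → ℤ) : Prop where
  lt : u q < -1 - u p
  between : ∀ m, p < m → m < q → ¬ (u q < -1 - u m ∧ -1 - u m < -1 - u p)
  after : ∀ m, q < m → m < n → ¬ (u q < u m ∧ u m < -1 - u p)
  after_bar : ∀ m, q < m → m < n → ¬ (u q < -1 - u m ∧ -1 - u m < -1 - u p)

namespace Good

theorem last_le (h : Good n (q + 1) u v) (hS : u q < 0 ∨ 0 ≤ v q) : u q ≤ v q := by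
  have := h.neg_le (le_refl q)
  have := h.pos_le (le_refl q)
  omega

theorem not_target_bar' (h : Good n (q + 1) u v) (hS : u q < 0 ∨ 0 ≤ v q) {l : ℕ}
    (hl : l < q) (hE : ∀ m, l < m → m < q → ¬ (u q < -1 - u m ∧ -1 - u m ≤ v q))
    (hd : (-1 - v l = u q ∧ u q ≠ v q ∧ ¬ (u q < -1 - u l ∧ -1 - u l ≤ v q)) ∨
      (u q < -1 - v l ∧ -1 - v l ≤ v q)) : False := by
  have h1 := h.last_le hS
  refine h.not_target_bar hS hl (fun m hm hm' => ?_) ?_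
  · have := hE m hm hm'
    unfold InIoc
    omega
  · unfold InIoc
    omega

/-- If the next possible step of the last row does not pass over its end, then it is an edge, and
it leads to a good state again. -/
theorem hop (h : Good n (q + 1) u v) (hS : u q < 0 ∨ 0 ≤ v q) (hh : IsHop p q u u')
    (hE : ∀ m, p < m → m < q → ¬ (u q < -1 - u m ∧ -1 - u m ≤ v q))
    (h1 : u q < -1 - u p) (h2 : -1 - u p ≤ v q) :
    AddEdge n p q u ∧ Good n (q + 1) u' v ∧ (u' q < 0 ∨ 0 ≤ v q) ∧
      ∀ m, p ≤ m → m < q → ¬ (u' q < -1 - u' m ∧ -1 - u' m ≤ v q) := by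
  have hq := h.lt
  have hpq := hh.lt
  have hl := hh.left
  have hr := hh.right
  have hc := h.last_le hS
  have hav := h.avoid q (by omega)
  have hav' := h.avoid_bar q (by omega)
  -- The hop moves row `p` forward from `u p` to the bar of `u q`. This says that row `p` does not
  -- overshoot its end.
  have hK : ¬ (u q < -1 - v p ∧ -1 - v p ≤ v q) := fun hK =>
    h.not_target_bar' hS hpq hE (Or.inr hK)
  have hother : ∀ m, m ≠ p → m ≠ q → u' m = u m := hh.other
  have hp0 := h.neg_le (m := p) (by omega)
  have hp1 := h.pos_le (m := p) (by omega)
  have heven : Even (crossings u' v (q + 1)) := by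
    have h3 := h.even
    have h4 := hh.crossings (v := v) le_rfl hpq
    rw [crossings_succ] at h3 ⊢
    -- If the hop of row `q` crosses zero, then so does the simultaneous move of row `p`, and both
    -- rows lose their crossing; otherwise neither row changes its contribution.
    rcases lt_or_ge (u q) 0 with hx | hx <;> rcases lt_or_ge (-1 - u p) 0 with hy | hy
    · rw [if_neg (by omega)] at h4
      have h5 : (u q < 0 ∧ 0 ≤ v q) ↔ (u' q < 0 ∧ 0 ≤ v q) := by omega
      simp only [h5] at h3
      rw [if_neg (by omega)] at h4
      rwa [show crossings u' v q = crossings u v q by omega]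
    · rw [if_pos (by omega), if_neg (by omega)] at h4
      rw [if_pos (by omega)] at h3
      rw [if_neg (by omega)]
      rw [show crossings u v q + 1 = crossings u' v q + 2 by omega] at h3
      grind
    · omega
    · have h5 : (u p < 0 ∧ 0 ≤ v p) ↔ (u' p < 0 ∧ 0 ≤ v p) := by omega
      simp only [h5] at h4
      rw [if_neg (by omega)] at h3 ⊢
      rwa [show crossings u' v q = crossings u v q by omega]
  have hbounds : ∀ m < n, -(n : ℤ) ≤ u m ∧ u m < n := fun m hm =>
    ⟨h.src.lower m hm, h.src.upper m hm⟩
  refine ⟨⟨h1, fun m hm hm' => ?_, fun m hm hmn => ?_, fun m hm hmn => ?_⟩,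
    ⟨hq, hh.isWindow (by omega) h.src, h.tgt, ?_, ?_, ?_, heven, ?_, ?_, ?_⟩, by omega, ?_⟩
  · have := hE m hm hm'
    omega
  · have := hav m hm hmn
    unfold Sbt at this
    omega
  · have := hav' m hm hmn
    unfold Sbt at this
    omega
  · intro m hm hmn
    rw [hother m (by omega) (by omega)]
    exact h.agree m hm hmn
  · intro i hi m hm hmn
    rw [hother m (by omega) (by omega)]
    have h3 := h.avoid i hi m hm hmn
    rcases eq_or_ne i p with rfl | hip
    · unfold Sbt at h3 ⊢
      omega
    · rcases eq_or_ne i q with rfl | hiq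
      · unfold Sbt at h3 ⊢
        omega
      · rwa [hother i hip hiq]
  · intro i hi m hm hmn
    rw [hother m (by omega) (by omega)]
    have h3 := h.avoid_bar i hi m hm hmn
    rcases eq_or_ne i p with rfl | hip
    · unfold Sbt at h3 ⊢
      omega
    · rcases eq_or_ne i q with rfl | hiq
      · unfold Sbt at h3 ⊢
        omega
      · rwa [hother i hip hiq]
  · intro i l hil hl3 heq
    have h3 := h.cond1 i l hil hl3
    rcases eq_or_ne i p with rfl | hip
    · have h4 := h.tgt.inj i (by omega) l (by omega) (by omega)
      have hB := h.cond2 i l hil hl3 (by unfold Sbt; omega)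
      have := hB.nonneg
      have := hB.le_of_mag_le h.src (j := q) (by omega) (by omega) (by omega)
      omega
    · rw [hother i hip (by omega)] at heq
      exact h3 heq
  · intro i l hil hl3 hs
    rcases eq_or_ne i p with rfl | hip
    · exfalso
      have hB := h.cond2 i l hil hl3 (by unfold Sbt at hs ⊢; omega)
      have h4 := hB.lower
      have h5 := hB.upper
      have h6 := hB.le_of_mag_le h.src (j := q) (by omega)
      unfold Sbt at hs
      omega
    · rw [hother i hip (by omega)] at hs
      have hB := h.cond2 i l hil hl3 hs
      rcases lt_or_gt_of_ne hip with hip' | hip'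
      · exact hB.congr fun m hm => hother m (by omega) (by omega)
      · have hb := hB.nonneg
        have h4 := hB.lower
        have h5 := hB.upper
        have h6 := hB.le_of_mag_le h.src (j := q) (by omega)
        have h7 := hE i hip' (by omega)
        have h8 := hB.lt_of_mag_lt h.tgt (j := q) (by omega)
        have h9 := h.tgt.inj q (by omega) l (by omega)
        have h10 := h.tgt.inj_bar q (by omega) l (by omega)
        refine hB.hop hh hip' (by omega) ?_ ?_
        · rcases eq_or_ne q l with rfl | hql <;> omega
        · rcases eq_or_ne q l with rfl | hql <;> omega
  · intro i hi hB
    rcases lt_or_ge i p with hip | hip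
    · exact h.cond3 i hi (hB.congr fun m hm => (hother m (by omega) (by omega)).symm)
    · have hb := hB.nonneg
      have h4 := hB.lower
      have h5 := hB.upper
      have hw' := hh.isWindow (n := n) (by omega) h.src
      have h6 := hB.le_of_mag_le hw' (j := q) (by omega)
      have h7 := hB.lt_of_mag_lt h.tgt (j := q) (by omega)
      have h8 := h.tgt.inj q (by omega) i (by omega) (by omega)
      have h9 := h.tgt.inj_bar q (by omega) i (by omega) (by omega)
      -- If the absolute value of `u q` is at most `v i`, then no row after `i` crosses zero in the
      -- new state, so the parity contained in blocking contradicts the evenness of the total.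
      -- Otherwise the blocking was present before the hop.
      by_cases hx : -1 - v i ≤ u q ∧ u q ≤ v i
      · have hun : ∀ m, q < m → m < n → u m < -1 - v q ∨ v q < u m := by
          intro m hm hmn
          have h10 := hav m hm hmn
          have h11 := hav' m hm hmn
          have h12 := hB.le_of_mag_le hw' (j := m) (by omega)
          have h13 := h.agree m hm hmn
          have h14 := h.tgt.inj m hmn q (by omega) (by omega)
          have h15 := h.tgt.inj_bar m hmn q (by omega) (by omega)
          rw [hother m (by omega) (by omega)] at h12
          unfold Sbt at h10 h11
          omega
        have hodd := hB.odd
        have h10 := crossings_succ u' v i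
        simp only [hb, and_true] at h10
        rw [← h10] at hodd
        rw [crossings_eq_of_le (s := i + 1) (by omega)] at heven
        · grind
        · intro m hm hm' hcr
          rcases eq_or_ne m q with rfl | hmq
          · omega
          · have h11 := hother m (by omega) hmq
            have h12 := hB.le_of_mag_le hw' (j := m) (by omega)
            have h13 := hE m (by omega) (by omega)
            have h14 := h.crosser_lower (by omega) hun (m := m) (by omega) (by omega) (by omega)
            omega
      · have hip' : p < i := lt_of_le_of_ne hip (by rintro rfl; omega)
        have h10 := hother i (by omega) (by omega)
        have h11 := hE i hip' (by omega)
        exact h.cond3 i hi (hB.hop hh.symm hip' (by omega) (by omega) (by omega))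
  · intro m hm hmq
    rcases eq_or_ne m p with rfl | hmp
    · omega
    · rw [hother m hmp (by omega)]
      have := hE m (by omega) hmq
      omega

end Good

end TypeB.Coded

/-! ### One hop of the last row, read backwards. -/

namespace TypeB.Coded.Good

variable {n p q : ℕ} {u u' v : ℕ → ℤ}

/-- The last row does not change its sign from negative to positive only. -/
theorem last_ne_bar (h : Good n (q + 1) u v) (hx : u q < 0) : v q ≠ -1 - u q := by
  intro hc
  have hq := h.lt
  have hun := h.unused_of_crosses hx (by omega)
  have hcr := fun j (hj : j < q) => h.crosser_lower (m := j) (by omega)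
    (fun m hm hmn => by have := hun m hm hmn; omega) hj
  have hex : ∀ i < q, ¬ Sbt (u i) (v q) (v i) := fun i hi hs => by
    have := (h.passed hi hs).outside
    omega
  -- The letters of absolute value below that of `v q` are closed and contain every row crossing
  -- zero except `q`. Their number is odd, which `false_of_odd` excludes.
  obtain ⟨g, hg⟩ : ∃ g : ℕ, (g : ℤ) = v q := ⟨(v q).toNat, by omega⟩
  refine h.false_of_odd g (fun m hm h1 h2 => ?_) ?_
  · have hmq : m < q := by
      by_contra hcon
      rcases eq_or_lt_of_le (not_lt.1 hcon) with rfl | h3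
      · omega
      · have := hun m h3 hm
        omega
    have h3 := h.neg_le (m := m) (by omega)
    have h4 := h.pos_le (m := m) (by omega)
    have h5 := h.avoid m (by omega) (q + 1) le_rfl hq
    have h6 := h.avoid_bar m (by omega) (q + 1) le_rfl hq
    have h7 := hun (q + 1) (by omega) hq
    have h8 := hex m hmq
    have h9 := h.tgt.inj m hm q (by omega) (by omega)
    unfold Sbt at h5 h6 h8
    omega
  · have heven := h.even
    have heq : ((Finset.range (q + 1)).filter fun j => u j < 0 ∧ 0 ≤ v j) =
        insert q ((Finset.range (q + 1)).filter
          fun m => (-(g : ℤ) ≤ u m ∧ u m < g) ∧ u m < 0 ∧ 0 ≤ v m) := by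
      ext j
      simp only [Finset.mem_filter, Finset.mem_range, Finset.mem_insert]
      constructor
      · rintro ⟨h1, h2, h3⟩
        by_contra hcon
        have h4 := hcr j (by omega) h2 h3
        have h5 := h.src.inj j (by omega) q (by omega) (by omega)
        omega
      · rintro (rfl | h6) <;> omega
    unfold crossings at heven
    rw [heq, Finset.card_insert_of_notMem (by simp; omega)] at heven
    grind

/-- The situation before a step of the last row: it is an edge that leads to a good state whose
further steps do not pass over the end. -/
structure HopBack (n p q : ℕ) (u u' v : ℕ → ℤ) : Prop where
  good : Good n (q + 1) u' v
  hop : IsHop p q u u'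
  edge : AddEdge n p q u
  last : u' q ≤ v q
  before : ∀ m, p < m → m < q → ¬ (u q < -1 - u m ∧ -1 - u m ≤ v q)

namespace HopBack

/-- The length condition of the edge covers the way from `u q` to `u' q`, and goodness after the hop
covers the way from `u' q` to `v q`; the end points are excluded by injectivity. -/
theorem unused (H : HopBack n p q u u' v) : ∀ m, q < m → m < n →
    u' m = u m ∧ ¬ (u q ≤ u m ∧ u m ≤ v q) ∧ ¬ (u q ≤ -1 - u m ∧ -1 - u m ≤ v q) := by
  intro m hm hmn
  have h := H.good
  have hpq := H.hop.lt
  have hl := H.hop.left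
  have hr := H.hop.right
  have hlast := H.last
  have h0 := H.hop.other m (by omega) (by omega)
  have h1 := h.avoid q (by omega) m hm hmn
  have h2 := h.avoid_bar q (by omega) m hm hmn
  have h3 := H.edge.after m hm hmn
  have h4 := H.edge.after_bar m hm hmn
  have h5 := h.agree m hm hmn
  have h6 := h.tgt.inj m hmn q (by omega) (by omega)
  have h7 := h.tgt.inj_bar m hmn q (by omega) (by omega)
  have h8 := h.src.inj m hmn q (by omega) (by omega)
  have h9 := h.src.inj_bar m hmn q (by omega) (by omega)
  have h10 := h.src.inj m hmn p (by omega) (by omega)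
  have h11 := h.src.inj_bar m hmn p (by omega) (by omega)
  unfold Sbt at h1 h2
  omega

/-- The row `p` does not end in the part that is added to it. -/
theorem end_left (H : HopBack n p q u u' v) :
    -1 - u q ≤ v p ∨ v p < -1 - (-1 - u p) ∧ ¬ (u q < 0 ∧ 0 ≤ -1 - u p) := by
  have h := H.good
  have hq := h.lt
  have hpq := H.hop.lt
  have hl := H.hop.left
  have hr := H.hop.right
  have h0 := h.pos_le (m := p) (by omega)
  have h1 := h.neg_le (m := p) (by omega)
  have h2 := H.unused (q + 1) (by omega) hq
  have h3 := h.avoid p (by omega) (q + 1) (by omega) hq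
  have h4 := h.avoid_bar p (by omega) (q + 1) (by omega) hq
  have h5 := H.edge.lt
  have h6 := H.last
  unfold Sbt at h3 h4
  omega

/-- No row after the row `p` is blocked off by its end `e` in an earlier row, if the letter `e`
separates the two last entries. -/
theorem not_blocked (H : HopBack n p q u u' v) {i l : ℕ} (hil : i < l) (hpl : p < l) (hlq : l < q)
    (hB : Blocked n u' v i (v l)) (hx : u q ≤ v l) (hy : v l < u' q) : False := by
  have h := H.good
  have hq := h.lt
  have hl := H.hop.left
  have hr := H.hop.right
  have h0 := hB.nonneg
  have h1 := hB.le_of_mag_le h.src (j := l) (by omega)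
  have h2 := h.pos_le (m := l) (by omega)
  have h3 := H.hop.other l (by omega) (by omega)
  have h4 := H.before l hpl hlq
  have h5 := H.last
  have h6 := h.crosser_lower (m := l) (by omega) (fun m hm hmn => by
    have h7 := H.unused m hm hmn
    have h8 := hB.le_of_mag_le h.src (j := m) hmn
    omega) hlq
  omega

/-- The bar of the end of a row after the row `p` does not lie in the step of the last row. -/
theorem not_target_bar (H : HopBack n p q u u' v) {l : ℕ} (hpl : p < l) (hlq : l < q)
    (hx : u q < -1 - v l) (hy : -1 - v l < u' q) : False := by
  have h := H.good
  have hq := h.lt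
  have hl := H.hop.left
  have hr := H.hop.right
  have hlast := H.last
  have hlt := H.edge.lt
  have hX2 : ∀ m < l, u' m ≠ v l ∧ v m ≠ v l ∧ (Sbt (u' m) (v l) (v m) → False) := by
    intro m hm
    refine ⟨h.cond1 m l hm (by omega), h.tgt.inj m (by omega) l (by omega) (by omega), fun hs => ?_⟩
    have hB := h.cond2 m l hm (by omega) hs
    have h0 := hB.nonneg
    have h1 := hB.le_of_mag_le h.src (j := q) (by omega)
    exact H.not_blocked hm hpl hlq hB (by omega) (by omega)
  have hbar : ∀ m < q, -1 - v l ≤ -1 - u' m → -1 - u' m ≤ v q →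
      m < p ∧ u' m ≠ v l ∧ v m ≠ v l ∧ ¬ Sbt (u' m) (v l) (v m) := by
    intro m hm h1 h2
    have h3 := H.before m
    have h4 := H.hop.other m
    rcases lt_trichotomy m p with hmp | rfl | hmp
    · exact ⟨hmp, hX2 m (by omega)⟩
    · omega
    · omega
  -- Up to barring, the letters from `-1 - v l` to `v q` are closed. As row `l` ends in the bar of
  -- such a letter, it must start in this set as well; but the bar of its start is excluded by
  -- `before`, and its start itself would make row `l` pass over `v q`.
  have hcl : ∀ m < n, (-1 - v l ≤ u' m ∧ u' m ≤ v q ∨ -1 - v l ≤ -1 - u' m ∧ -1 - u' m ≤ v q) →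
      (-1 - v l ≤ v m ∧ v m ≤ v q ∨ -1 - v l ≤ -1 - v m ∧ -1 - v m ≤ v q) := by
    intro m hm hz
    rcases lt_trichotomy m q with hmq | rfl | hmq
    · have h2 := hbar m hmq
      have h3 := h.cond1 m q hmq (by omega)
      have h4 := h.tgt.inj m hm q (by omega) (by omega)
      by_cases hs : Sbt (u' m) (v q) (v m)
      · have hP := h.passed hmq hs
        have h5 := hP.exit
        have h6 := hP.outside
        have h7 := hP.blocked.lower
        have h8 := hP.blocked.upper
        have h9 := hP.blocked.nonneg
        have h10 := H.before m
        have h11 := H.hop.other m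
        have hmp : m < p := by
          rcases lt_trichotomy m p with h | h | h
          · exact h
          · subst h; omega
          · omega
        have h12 := hX2 m (by omega)
        have h13 := h.avoid m (by omega) (q + 1) le_rfl hq
        have h14 := h.avoid_bar m (by omega) (q + 1) le_rfl hq
        have h15 := H.unused (q + 1) (by omega) hq
        have h16 : v m < v l := by
          by_contra hcon
          exact h12.2.2 (by unfold Sbt; omega)
        omega
      · rcases hz with hz | hz
        · unfold Sbt at hs
          omega
        · have h5 := h2 hz.1 hz.2
          unfold Sbt at h5
          omega
    · omega
    · rwa [← h.agree m hmq hm]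
  have h1 := h.src.closed_symm h.tgt
    (fun z => -1 - v l ≤ z ∧ z ≤ v q ∨ -1 - v l ≤ -1 - z ∧ -1 - z ≤ v q)
    (fun z hz => by omega) hcl l (by omega) (by omega)
  have h2 := H.before l hpl hlq
  have h3 := H.hop.other l (by omega) (by omega)
  have h4 : ¬ Sbt (u' l) (v q) (v l) := fun hs => by
    have hP := h.passed hlq hs
    have h5 := hP.blocked.lower
    have h6 := hP.blocked.upper
    have h7 := hP.outside
    omega
  have h5 := h.cond1 l q hlq (by omega)
  have h6 := h.tgt.inj l (by omega) q (by omega) (by omega)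
  unfold Sbt at h4
  omega

/-- When the hop crosses zero, `end_left` shows that row `p` ends beyond the bar of `u q`, so before
the hop both rows `p` and `q` cross zero, and after it neither does. Otherwise nothing changes. -/
theorem even (H : HopBack n p q u u' v) : Even (crossings u v (q + 1)) := by
  have h3 := H.good.even
  have hpq := H.hop.lt
  have hl := H.hop.left
  have hr := H.hop.right
  have hlt := H.edge.lt
  have hlast := H.last
  have hend := H.end_left
  have h4 := H.hop.crossings (v := v) le_rfl hpq
  rw [crossings_succ] at h3 ⊢
  rcases lt_or_ge (u q) 0 with hx | hx <;> rcases lt_or_ge (-1 - u p) 0 with hy | hy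
  · rw [if_neg (by omega), if_neg (by omega)] at h4
    have h5 : (u' q < 0 ∧ 0 ≤ v q) ↔ (u q < 0 ∧ 0 ≤ v q) := by omega
    simp only [h5] at h3
    rwa [show crossings u v q = crossings u' v q by omega]
  · rw [if_pos (by omega), if_neg (by omega)] at h4
    rw [if_neg (by omega)] at h3
    rw [if_pos (by omega), show crossings u v q = crossings u' v q + 1 by omega]
    grind
  · omega
  · have h5 : (u p < 0 ∧ 0 ≤ v p) ↔ (u' p < 0 ∧ 0 ≤ v p) := by omega
    simp only [h5] at h4
    rw [if_neg (by omega)] at h3 ⊢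
    rwa [show crossings u v q = crossings u' v q by omega]

theorem lt_bound (H : HopBack n p q u u' v) : ∀ m < n, -(n : ℤ) ≤ u m ∧ u m < n := by
  have h := H.hop.symm.isWindow (n := n) (by have := H.good.lt; omega) H.good.src
  exact fun m hm => ⟨h.lower m hm, h.upper m hm⟩

/-- The row `p` may be blocked off by the end of the last row. -/
theorem blocked_last (H : HopBack n p q u u' v) (hx : u q < -1 - v q) (hy : -1 - v q < u' q) :
    Blocked n u v p (v q) := by
  have h := H.good
  have hq := h.lt
  have hpq := H.hop.lt
  have hl := H.hop.left
  have hr := H.hop.right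
  have hlt := H.edge.lt
  have hlast := H.last
  have hend := H.end_left
  have hbd := H.lt_bound q (by omega)
  have hu : IsWindow n u := H.hop.symm.isWindow (by omega) h.src
  have hE : ∀ m < n, -1 - v q ≤ u m → u m ≤ v q → m ≤ p := by
    intro m hm h1 h2
    by_contra hcon
    rcases lt_trichotomy m q with hmq | rfl | hmq
    · have := H.before m (by omega) hmq
      omega
    · omega
    · have := H.unused m hmq hm
      omega
  have hex : ∀ i < q, ¬ Sbt (u' i) (v q) (v i) := fun i hi hs => by
    have := (h.passed hi hs).outside
    omega
  -- After the hop no row passes over `v q`, so this interval is closed. The rows that end in it are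
  -- thus rows that start in it, which locates the letters below `v q` in the target.
  have hcl := h.src.closed_symm h.tgt (fun z => -1 - v q ≤ z ∧ z ≤ v q)
    (fun z hz => by omega) (by
      intro m hm hz
      rcases lt_trichotomy m q with hmq | rfl | hmq
      · have h3 := hex m hmq
        have h4 := h.cond1 m q hmq (by omega)
        have h5 := h.tgt.inj m hm q (by omega) (by omega)
        have h6 := H.unused (q + 1) (by omega) hq
        have h7 := h.avoid m (by omega) (q + 1) le_rfl hq
        have h8 := h.avoid_bar m (by omega) (q + 1) le_rfl hq
        unfold Sbt at h3 h7 h8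
        omega
      · omega
      · rwa [← h.agree m hmq hm])
  refine ⟨by omega, by omega, by omega, by omega, ?_, ?_, ?_⟩
  · intro z hz0 hz1
    obtain ⟨j, hj, h1⟩ := hu.exists_eq hz0 (by omega)
    exact ⟨j, hE j hj (by omega) (by omega), h1⟩
  · intro z hz0 hz1
    obtain ⟨j, hj, h1⟩ := h.tgt.exists_eq hz0 (by omega)
    have h2 := hcl j hj (by omega)
    refine ⟨j, ?_, h1⟩
    by_contra hcon
    have h3 := H.hop.other j
    have h4 := hE j hj
    rcases eq_or_ne j p with rfl | hjp
    · omega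
    · rcases eq_or_ne j q with rfl | hjq <;> omega
  · have hvp : 0 ≤ v p := by
      have h0 := h.pos_le (m := p) (by omega)
      have h1 := h.avoid p (by omega) (q + 1) le_rfl hq
      have h2 := h.avoid_bar p (by omega) (q + 1) le_rfl hq
      have h3 := H.unused (q + 1) (by omega) hq
      have h4 := H.lt_bound (q + 1) hq
      unfold Sbt at h1 h2
      omega
    have h1 := crossings_succ u v p
    simp only [hvp, and_true] at h1
    rw [← h1]
    -- Before the hop, the rows crossing zero are row `q` and some rows up to `p`. The total is
    -- even, so the number up to `p` is odd.
    have h2 := H.even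
    rw [crossings_succ, if_pos (by omega), crossings_eq_of_le (s := p + 1) (by omega)] at h2
    · grind
    · intro m hm hmq hcr
      have h3 := H.hop.other m (by omega) (by omega)
      have h4 := h.crosser_lower (m := m) (by omega) (fun m hm hmn => by
        have h7 := H.unused m hm hmn
        omega) hmq (by omega) (by omega)
      have := hE m (by omega)
      omega

end HopBack

end TypeB.Coded.Good

/-! ### Going back along a hop, flips, and finishing the last row. -/

namespace TypeB.Coded.Good

variable {n p q : ℕ} {u u' v : ℕ → ℤ}

/-- Going back lengthens row `p` by the letters from `u p` to the bar of `u q`, so new instances of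
Conditions 1 and 2 arise only from an end `v l` in this part, that is, with its bar in the step of
the last row. Such an end is impossible for `l < q` by the two lemmas called `not_target_bar`. For
`l = q` Condition 1 is saved by `last_ne_bar`, and Condition 2 by the blocking found in
`blocked_last`. -/
theorem HopBack.good_source (H : HopBack n p q u u' v) : Good n (q + 1) u v := by
  have h := H.good
  have hq := h.lt
  have hpq := H.hop.lt
  have hl := H.hop.left
  have hr := H.hop.right
  have hlt := H.edge.lt
  have hlast := H.last
  have hend := H.end_left
  have hother := H.hop.other
  have hu : IsWindow n u := H.hop.symm.isWindow (by omega) h.src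
  refine ⟨hq, hu, h.tgt, ?_, ?_, ?_, H.even, ?_, ?_, ?_⟩
  · intro m hm hmn
    rw [← hother m (by omega) (by omega)]
    exact h.agree m hm hmn
  · intro i hi m hm hmn
    have h1 := H.unused m (by omega) hmn
    have h3 := h.avoid i hi m hm hmn
    rw [h1.1] at h3
    rcases eq_or_ne i p with rfl | hip
    · unfold Sbt at h3 ⊢
      omega
    · rcases eq_or_ne i q with rfl | hiq
      · unfold Sbt at h3 ⊢
        omega
      · rwa [← hother i hip hiq]
  · intro i hi m hm hmn
    have h1 := H.unused m (by omega) hmn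
    have h3 := h.avoid_bar i hi m hm hmn
    rw [h1.1] at h3
    rcases eq_or_ne i p with rfl | hip
    · unfold Sbt at h3 ⊢
      omega
    · rcases eq_or_ne i q with rfl | hiq
      · unfold Sbt at h3 ⊢
        omega
      · rwa [← hother i hip hiq]
  · intro i l hil hlq heq
    rcases eq_or_ne i p with rfl | hip
    · rcases eq_or_ne l q with rfl | hne
      · have := h.last_ne_bar (by omega)
        omega
      · have h4 := H.before l (by omega) (by omega)
        have h5 := hother l (by omega) (by omega)
        have h6 := h.tgt.inj_bar q (by omega) l (by omega) (by omega)
        -- Here `v l = u p` is the bar of `u' q`: this is the boundary case admitted by the first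
        -- alternative.
        refine h.not_target_bar' (l := l) (by have := h.pos_le (le_refl q); omega) (by omega)
          (fun m hm hmq => ?_) (Or.inl ⟨by omega, by omega, by omega⟩)
        have h7 := H.before m (by omega) hmq
        have h8 := hother m (by omega) (by omega)
        omega
    · refine h.cond1 i l hil hlq ?_
      rwa [hother i hip (by omega)]
  · intro i l hil hlq hs
    rcases eq_or_ne i p with rfl | hip
    · have h1 := h.cond1 i l hil hlq
      by_cases h2 : Sbt (u' i) (v l) (v i)
      · exfalso
        have hB := h.cond2 i l hil hlq h2
        have h4 := hB.lower
        have h5 := hB.upper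
        have h6 := hB.le_of_mag_le h.src (j := q) (by omega)
        rcases eq_or_ne l q with rfl | hne
        · omega
        · exact H.not_blocked hil hil (by omega) hB (by omega) (by omega)
      · have h3 : u q < -1 - v l ∧ -1 - v l < u' q := by
          unfold Sbt at hs h2
          omega
        rcases eq_or_ne l q with rfl | hne
        · exact H.blocked_last h3.1 h3.2
        · exact (H.not_target_bar hil (by omega) h3.1 h3.2).elim
    · have hs' := hs
      rw [← hother i hip (by omega)] at hs'
      have hB := h.cond2 i l hil hlq hs'
      rcases lt_or_gt_of_ne hip with hip' | hip'
      · exact hB.congr fun m hm => (hother m (by omega) (by omega)).symm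
      · have hb := hB.nonneg
        have h4 := hB.lower
        have h5 := hB.upper
        have h6 := hB.le_of_mag_le h.src (j := q) (by omega)
        have h7 := H.before i hip' (by omega)
        have h8 := hother i (by omega) (by omega)
        have h9 : ¬ (-1 - v l ≤ u q ∧ u q ≤ v l) := fun h9 => by
          rcases eq_or_ne l q with rfl | hne
          · omega
          · exact H.not_blocked hil (by omega) (by omega) hB (by omega) (by omega)
        refine hB.hop H.hop.symm hip' (by omega) (by omega) ?_
        omega
  · intro i hi hB
    have hb := hB.nonneg
    have h4 := hB.lower
    have h5 := hB.upper
    have h6 := hB.le_of_mag_le hu (j := q) (by omega)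
    have h7 := hB.lt_of_mag_lt h.tgt (j := q) (by omega)
    have h8 := h.tgt.inj q (by omega) i (by omega) (by omega)
    have h9 := h.tgt.inj_bar q (by omega) i (by omega) (by omega)
    rcases lt_trichotomy i p with hip | rfl | hip
    · exact h.cond3 i hi (hB.congr fun m hm => hother m (by omega) (by omega))
    · omega
    · have h10 := H.before i hip (by omega)
      exact h.cond3 i hi (hB.hop H.hop hip (by omega) (by omega) (by omega))

/-- A good state stays good if one goes back along a step of the last row. -/
theorem hop_back (h : Good n (q + 1) u' v) (hS : u' q < 0 ∨ 0 ≤ v q) (hh : IsHop p q u u')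
    (hE : ∀ m, p ≤ m → m < q → ¬ (u' q < -1 - u' m ∧ -1 - u' m ≤ v q)) (he : AddEdge n p q u) :
    Good n (q + 1) u v ∧ (u q < 0 ∨ 0 ≤ v q) ∧
      (∀ m, p < m → m < q → ¬ (u q < -1 - u m ∧ -1 - u m ≤ v q)) ∧ -1 - u p ≤ v q := by
  have hq := h.lt
  have hpq := hh.lt
  have hl := hh.left
  have hr := hh.right
  have hlt := he.lt
  have hlast := h.last_le hS
  have hbefore : ∀ m, p < m → m < q → ¬ (u q < -1 - u m ∧ -1 - u m ≤ v q) := by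
    intro m hm hmq
    have h1 := hE m hm.le hmq
    have h2 := he.between m hm hmq
    have h3 := hh.other m (by omega) (by omega)
    have h4 := h.src.inj m (by omega) p (by omega) (by omega)
    have h5 := h.src.inj_bar m (by omega) q (by omega) (by omega)
    omega
  exact ⟨HopBack.good_source ⟨h, hh, he, hlast, hbefore⟩, by omega, hbefore, by omega⟩

/-- `u'` arises from `u` by the reflection in `ε_q`. -/
structure IsFlip (q : ℕ) (u u' : ℕ → ℤ) : Prop where
  self : u' q = -1 - u q
  other : ∀ m, m ≠ q → u' m = u m

theorem IsFlip.symm (h : IsFlip q u u') : IsFlip q u' u :=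
  ⟨by have := h.self; omega, fun m hm => (h.other m hm).symm⟩

theorem IsFlip.isWindow (h : IsFlip q u u') (hq : q < n) (hu : IsWindow n u) : IsWindow n u' := by
  have hs := h.self
  have hb := hu.lower q hq
  have hb' := hu.upper q hq
  constructor
  · intro i hi
    have := hu.lower i hi
    have := h.other i
    rcases eq_or_ne i q with rfl | h1 <;> omega
  · intro i hi
    have := hu.upper i hi
    have := h.other i
    rcases eq_or_ne i q with rfl | h1 <;> omega
  · intro i hi j hj hij
    have h1 := hu.inj i hi j hj hij
    have h2 := hu.inj_bar i hi j hj hij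
    have h3 := h.other i
    have h4 := h.other j
    by_cases i = q <;> by_cases j = q <;> subst_vars <;> omega
  · intro i hi j hj hij
    have h1 := hu.inj i hi j hj hij
    have h2 := hu.inj_bar i hi j hj hij
    have h3 := h.other i
    have h4 := h.other j
    by_cases i = q <;> by_cases j = q <;> subst_vars <;> omega

/-- The length-theoretic condition for the edge labelled `ε_q`. -/
structure SingleEdge (n q : ℕ) (u : ℕ → ℤ) : Prop where
  nonneg : 0 ≤ u q
  after : ∀ m, q < m → m < n → -1 - u q < u m ∧ u m < u q

/-- Goodness of a state and of a state which differs in the last row only. -/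
theorem of_last (h : Good n (q + 1) u v) (hu : IsWindow n u') (hother : ∀ m, m ≠ q → u' m = u m)
    (hav : ∀ m, q < m → m < n → ¬ Sbt (u' q) (u m) (v q) ∧ ¬ Sbt (u' q) (-1 - u m) (v q))
    (hcr : u q < 0 ∧ 0 ≤ v q ↔ u' q < 0 ∧ 0 ≤ v q) : Good n (q + 1) u' v := by
  refine ⟨h.lt, hu, h.tgt, ?_, ?_, ?_, ?_, ?_, ?_, ?_⟩
  · intro m hm hmn
    rw [hother m (by omega)]
    exact h.agree m hm hmn
  · intro i hi m hm hmn
    rw [hother m (by omega)]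
    rcases eq_or_ne i q with rfl | hiq
    · exact (hav m hm hmn).1
    · rw [hother i hiq]
      exact h.avoid i hi m hm hmn
  · intro i hi m hm hmn
    rw [hother m (by omega)]
    rcases eq_or_ne i q with rfl | hiq
    · exact (hav m hm hmn).2
    · rw [hother i hiq]
      exact h.avoid_bar i hi m hm hmn
  · have h1 := h.even
    rw [crossings_succ] at h1 ⊢
    simp only [← hcr]
    rwa [crossings_congr fun m hm => hother m (by omega)]
  · intro i l hil hlq
    rw [hother i (by omega)]
    exact h.cond1 i l hil hlq
  · intro i l hil hlq hs
    rw [hother i (by omega)] at hs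
    exact (h.cond2 i l hil hlq hs).congr fun m hm => hother m (by omega)
  · intro i hi hB
    exact h.cond3 i hi (hB.congr fun m hm => (hother m (by omega)).symm)

/-- If the last row has to pass from a positive to a negative letter, then it has to be flipped. -/
theorem flip (h : Good n (q + 1) u v) (hS : ¬ (u q < 0 ∨ 0 ≤ v q)) (hf : IsFlip q u u') :
    SingleEdge n q u ∧ Good n (q + 1) u' v ∧ (u' q < 0 ∨ 0 ≤ v q) := by
  have hq := h.lt
  have hs := hf.self
  have hafter : ∀ m, q < m → m < n → -1 - u q < u m ∧ u m < u q ∧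
      v q ≠ u m ∧ v q ≠ -1 - u m := by
    intro m hm hmn
    have h1 := h.avoid q (by omega) m hm hmn
    have h2 := h.avoid_bar q (by omega) m hm hmn
    have h3 := h.agree m hm hmn
    have h4 := h.tgt.inj m hmn q (by omega) (by omega)
    have h5 := h.tgt.inj_bar m hmn q (by omega) (by omega)
    have h6 := h.src.inj m hmn q (by omega) (by omega)
    have h7 := h.src.inj_bar m hmn q (by omega) (by omega)
    unfold Sbt at h1 h2
    omega
  have hvu : u' q ≤ v q := by
    -- otherwise the letters of absolute value at least that of `v q` are closed
    by_contra hcon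
    have hcl := h.src.closed_symm h.tgt (fun z => z ≤ v q ∨ -1 - v q ≤ z) (fun z hz => by omega) (by
      intro m hm hz
      rcases lt_trichotomy m q with hmq | rfl | hmq
      · have h1 := h.cond1 m q hmq (by omega)
        have h2 : ¬ Sbt (u m) (v q) (v m) := fun h2 => by
          have := (h.cond2 m q hmq (by omega) h2).nonneg
          omega
        have h3 := h.tgt.inj m hm q (by omega) (by omega)
        have h4 := h.avoid m (by omega) (q + 1) le_rfl hq
        have h5 := h.avoid_bar m (by omega) (q + 1) le_rfl hq
        have h6 := hafter (q + 1) (by omega) hq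
        unfold Sbt at h2 h4 h5
        omega
      · omega
      · rwa [← h.agree m hmq hm]) q (by omega)
    omega
  refine ⟨⟨by omega, fun m hm hmn => ?_⟩, ?_, by omega⟩
  · have := hafter m hm hmn
    omega
  · refine h.of_last (hf.isWindow (by omega) h.src) hf.other (fun m hm hmn => ?_) (by omega)
    have h1 := h.avoid q (by omega) m hm hmn
    have h2 := h.avoid_bar q (by omega) m hm hmn
    have h3 := hafter m hm hmn
    unfold Sbt at h1 h2 ⊢
    omega

/-- The later entries lie strictly between `-1 - u q` and `u q`, so from the negative letter `u' q`
the row cannot reach a nonnegative one without passing over an unused letter. Hence `v q` is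
negative and the flip was forced. -/
theorem flip_back (h : Good n (q + 1) u' v) (hf : IsFlip q u u') (he : SingleEdge n q u) :
    Good n (q + 1) u v ∧ ¬ (u q < 0 ∨ 0 ≤ v q) := by
  have hq := h.lt
  have hs := hf.self
  have h0 := he.nonneg
  have hav : ∀ m, q < m → m < n → u' m = u m ∧ -1 - u q < u m ∧ u m < u q ∧
      ¬ Sbt (u' q) (u m) (v q) ∧ ¬ Sbt (u' q) (-1 - u m) (v q) ∧ v q ≠ u m ∧ v q ≠ -1 - u m := by
    intro m hm hmn
    have h1 := he.after m hm hmn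
    have h2 := h.avoid q (by omega) m hm hmn
    have h3 := h.avoid_bar q (by omega) m hm hmn
    have h4 := h.agree m hm hmn
    have h5 := h.tgt.inj m hmn q (by omega) (by omega)
    have h6 := h.tgt.inj_bar m hmn q (by omega) (by omega)
    have h7 := hf.other m (by omega)
    rw [h7] at h2 h3
    exact ⟨h7, h1.1, h1.2, h2, h3, by omega, by omega⟩
  have hv : v q < 0 := by
    have h1 := hav (q + 1) (by omega) hq
    unfold Sbt at h1
    omega
  refine ⟨h.of_last (hf.symm.isWindow (by omega) h.src) hf.symm.other (fun m hm hmn => ?_)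
    (by omega), by omega⟩
  have h1 := hav m hm hmn
  rw [h1.1]
  unfold Sbt at h1 ⊢
  omega

/-- If the last row admits no steps, then it has reached its end. -/
theorem last_eq (h : Good n (q + 1) u v) (hS : u q < 0 ∨ 0 ≤ v q)
    (hE : ∀ m < q, ¬ (u q < -1 - u m ∧ -1 - u m ≤ v q)) : u q = v q := by
  have hq := h.lt
  have hle := h.last_le hS
  have h0 := h.tgt.lower q (by omega)
  have h1 := h.tgt.upper q (by omega)
  -- Let row `j` start in the absolute value of `v q`. For `j < q` Condition 1 excludes `v q`
  -- itself, and its bar would allow a step unless the row has reached its end; `j > q` contradicts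
  -- injectivity of the target; for `j = q`, `last_ne_bar` excludes the bar.
  obtain ⟨j, hj, h2⟩ := h.src.exists_eq (x := if 0 ≤ v q then v q else -1 - v q)
    (by split_ifs <;> omega) (by split_ifs <;> omega)
  have h3 : u j = v q ∨ u j = -1 - v q := by split_ifs at h2 <;> omega
  rcases lt_trichotomy j q with hjq | rfl | hjq
  · have h4 := hE j hjq
    have h5 := h.cond1 j q hjq (by omega)
    omega
  · have := h.last_ne_bar
    omega
  · have h4 := h.agree j hjq hj
    have h5 := h.tgt.inj j hj q (by omega) (by omega)
    have h6 := h.tgt.inj_bar j hj q (by omega) (by omega)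
    omega

/-- Once the last row has reached its end, it may be dropped. -/
theorem pred (h : Good n (q + 1) u v) (hc : u q = v q) : Good n q u v := by
  have hq := h.lt
  have hex : ∀ i < q, ¬ Sbt (u i) (v q) (v i) := fun i hi hs => by
    have := (h.passed hi hs).outside
    have := (h.passed hi hs).blocked.nonneg
    omega
  have hside : ∀ m < q, u m ≠ v q ∧ v m ≠ v q ∧ v m ≠ -1 - v q ∧ u m ≠ -1 - v q := fun m hm =>
    ⟨h.cond1 m q hm (by omega), h.tgt.inj m (by omega) q (by omega) (by omega),
      h.tgt.inj_bar m (by omega) q (by omega) (by omega),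
      by have := h.src.inj_bar m (by omega) q (by omega) (by omega); omega⟩
  -- the letters strictly between the last end and its bar are closed
  have hcl' := h.src.closed_symm h.tgt (fun z => Sbt (-1 - v q) z (v q))
    (fun z hz => by unfold Sbt at hz ⊢; omega) (by
      intro m hm hz
      rcases lt_trichotomy m q with hmq | rfl | hmq
      · have h1 := hex m hmq
        have h2 := hside m hmq
        unfold Sbt at hz h1 ⊢
        omega
      · unfold Sbt at hz
        omega
      · rwa [← h.agree m hmq hm])
  refine ⟨by omega, h.src, h.tgt, ?_, ?_, ?_, ?_, ?_, ?_, ?_⟩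
  · intro m hm hmn
    rcases eq_or_lt_of_le hm with rfl | hm
    · exact hc
    · exact h.agree m hm hmn
  · intro i hi m hm hmn
    rcases eq_or_lt_of_le hm with rfl | hm
    · rw [hc]
      exact hex i hi
    · exact h.avoid i (by omega) m hm hmn
  · intro i hi m hm hmn
    rcases eq_or_lt_of_le hm with rfl | hm
    · rw [hc]
      have h1 := hex i hi
      have h2 := hside i hi
      have h3 := hcl' i (by omega)
      unfold Sbt at h1 h3 ⊢
      omega
    · exact h.avoid_bar i (by omega) m hm hmn
  · have h1 := h.even
    rwa [crossings_succ, if_neg (by omega), add_zero] at h1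
  · exact fun i l hil hl => h.cond1 i l hil (by omega)
  · exact fun i l hil hl => h.cond2 i l hil (by omega)
  · exact fun i hi => h.cond3 i (by omega)

/-- A row which has reached its end may be added. -/
theorem succ (h : Good n q u v) (hq : q + 1 < n) (hc : u q = v q) : Good n (q + 1) u v := by
  refine ⟨hq, h.src, h.tgt, fun m hm hmn => h.agree m (by omega) hmn, ?_, ?_, ?_, ?_, ?_, ?_⟩
  · intro i hi m hm hmn
    rcases eq_or_lt_of_le (Nat.lt_succ_iff.1 hi) with rfl | hi
    · rw [hc]
      unfold Sbt
      omega
    · exact h.avoid i hi m (by omega) hmn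
  · intro i hi m hm hmn
    rcases eq_or_lt_of_le (Nat.lt_succ_iff.1 hi) with rfl | hi
    · rw [hc]
      unfold Sbt
      omega
    · exact h.avoid_bar i hi m (by omega) hmn
  · rw [crossings_succ, if_neg (by omega), add_zero]
    exact h.even
  · intro i l hil hl
    rcases eq_or_lt_of_le (Nat.lt_succ_iff.1 hl) with rfl | hl
    · rw [← hc]
      exact h.src.inj i (by omega) l (by omega) (by omega)
    · exact h.cond1 i l hil hl
  · intro i l hil hl hs
    rcases eq_or_lt_of_le (Nat.lt_succ_iff.1 hl) with rfl | hl
    · rw [← hc] at hs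
      exact (h.avoid i hil l le_rfl (by omega) hs).elim
    · exact h.cond2 i l hil hl hs
  · intro i hi hB
    -- Condition 3 is new only for the row before the added one. Blocking there would make the
    -- number of crossings in the first `q` rows odd.
    rcases eq_or_lt_of_le (Nat.succ_le_of_lt hi) with hi' | hi'
    · have h1 := hB.odd
      have h2 := h.even
      have h3 := crossings_succ u v i
      simp only [hB.nonneg, and_true] at h3
      rw [← h3, show i + 1 = q by omega] at h1
      grind
    · exact h.cond3 i (by omega) hB

end TypeB.Coded.Good

/-! ### Signed permutations as coded windows. -/

namespace TypeB

namespace Letter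

variable {n : ℕ}

/-- The integer coding a letter: `pos i` is coded by `i` and `neg i` by `-1 - i`. -/
def code : Letter n → ℤ
  | pos i => i
  | neg i => -1 - i

theorem code_injective : Function.Injective (code : Letter n → ℤ) := by
  intro a b h
  cases a <;> cases b <;> simp only [code] at h <;> (congr 1; omega)

theorem code_bar (a : Letter n) : a.bar.code = -1 - a.code := by
  cases a <;> simp [bar, code]

theorem neg_le_code (a : Letter n) : -(n : ℤ) ≤ a.code := by
  cases a <;> simp only [code] <;> omega

theorem code_lt (a : Letter n) : a.code < n := by
  cases a <;> simp only [code] <;> omega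

@[simp] theorem bar_bar (a : Letter n) : a.bar.bar = a := by cases a <;> rfl

theorem isPos_iff (a : Letter n) : a.IsPos ↔ 0 ≤ a.code := by
  cases a with
  | pos i => simp [IsPos, code]
  | neg i => simp only [IsPos, code, reduceCtorEq, exists_false, false_iff]; omega

theorem isNeg_iff (a : Letter n) : a.IsNeg ↔ a.code < 0 := by
  cases a with
  | pos i => simp [IsNeg, code]
  | neg i => simp only [IsNeg, code, neg.injEq, exists_eq', true_iff]; omega

theorem abs_eq_iff (a : Letter n) (x : Fin n) : a.abs = x ↔ a.code = x ∨ a.code = -1 - (x : ℤ) := by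
  cases a <;> simp only [abs, code, Fin.ext_iff] <;> omega

end Letter

namespace SignedPerm

variable {n : ℕ}

theorem apply_bar (w : SignedPerm n) (a : Letter n) : w.1 a.bar = (w.1 a).bar := w.2 a

/-- The coded window of a signed permutation. -/
def window (w : SignedPerm n) (i : ℕ) : ℤ :=
  if h : i < n then (w.1 (.pos ⟨i, h⟩)).code else 0

theorem window_coe (w : SignedPerm n) (i : Fin n) : window w i = (w.1 (.pos i)).code := by
  simp [window]

theorem window_of_lt (w : SignedPerm n) {i : ℕ} (h : i < n) :
    window w i = (w.1 (.pos ⟨i, h⟩)).code := by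
  simp [window, h]

theorem isWindow (w : SignedPerm n) : Coded.IsWindow n (window w) := by
  constructor
  · intro i hi
    rw [window_of_lt w hi]
    exact Letter.neg_le_code _
  · intro i hi
    rw [window_of_lt w hi]
    exact Letter.code_lt _
  · intro i hi j hj hij h
    rw [window_of_lt w hi, window_of_lt w hj] at h
    simpa [hij] using w.1.injective (Letter.code_injective h)
  · intro i hi j hj hij h
    rw [window_of_lt w hi, window_of_lt w hj, ← Letter.code_bar, ← apply_bar w] at h
    simpa [Letter.bar] using w.1.injective (Letter.code_injective h)

theorem ext_window {w v : SignedPerm n} (h : ∀ i < n, window w i = window v i) : w = v := by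
  apply Subtype.ext
  have key : ∀ i : Fin n, w.1 (.pos i) = v.1 (.pos i) := fun i => by
    have := h i i.2
    rw [window_coe w, window_coe v] at this
    exact Letter.code_injective this
  ext a
  cases a with
  | pos i => exact key i
  | neg i =>
    have h1 := apply_bar w (.pos i)
    have h2 := apply_bar v (.pos i)
    simp only [Letter.bar] at h1 h2
    rw [h1, h2, key i]

theorem window_mul_refl_add (w : SignedPerm n) (p q : Fin n) (h : p < q) :
    Coded.IsHop p q (window w) (window (w * (PosRoot.add p q h).refl)) := by
  have hne := h.ne
  refine ⟨h, ?_, ?_, ?_⟩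
  · rw [window_coe, window_coe, ← Letter.code_bar, ← apply_bar]
    simp [PosRoot.refl, PosRoot.reflPerm, Letter.bar, Equiv.swap_apply_def, hne]
  · rw [window_coe, window_coe, ← Letter.code_bar, ← apply_bar]
    simp [PosRoot.refl, PosRoot.reflPerm, Letter.bar, Equiv.swap_apply_def, hne]
  · intro m h1 h2
    by_cases hm : m < n
    · rw [window_of_lt _ hm, window_of_lt _ hm]
      have h1' : (⟨m, hm⟩ : Fin n) ≠ p := fun h => h1 (by rw [← h])
      have h2' : (⟨m, hm⟩ : Fin n) ≠ q := fun h => h2 (by rw [← h])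
      simp [PosRoot.refl, PosRoot.reflPerm, Equiv.swap_apply_def, h1', h2']
    · simp [window, hm]

theorem window_mul_refl_single (w : SignedPerm n) (q : Fin n) :
    Coded.Good.IsFlip q (window w) (window (w * (PosRoot.single q).refl)) := by
  refine ⟨?_, ?_⟩
  · rw [window_coe, window_coe, ← Letter.code_bar, ← apply_bar]
    simp [PosRoot.refl, PosRoot.reflPerm, Letter.bar]
  · intro m h1
    by_cases hm : m < n
    · rw [window_of_lt _ hm, window_of_lt _ hm]
      have h1' : (⟨m, hm⟩ : Fin n) ≠ q := fun h => h1 (by rw [← h])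
      simp [PosRoot.refl, PosRoot.reflPerm, Equiv.swap_apply_def, h1']
    · simp [window, hm]

end SignedPerm

/-! ### Lengths -/

variable {n : ℕ}

theorem act_sub (w : SignedPerm n) (x y : Fin n → ℚ) : act w (x - y) = act w x - act w y := by
  simp [act, sub_smul, Finset.sum_sub_distrib]

theorem act_add (w : SignedPerm n) (x y : Fin n → ℚ) : act w (x + y) = act w x + act w y := by
  simp [act, add_smul, Finset.sum_add_distrib]

theorem act_eps_pos (w : SignedPerm n) (i : Fin n) : act w (eps (.pos i)) = eps (w.1 (.pos i)) := by
  simp [act, eps, Pi.single_apply]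

theorem eps_bar (a : Letter n) : eps a.bar = -eps a := by
  cases a <;> simp [eps, Letter.bar]

/-- A linear functional which is positive on the positive roots. -/
def heightFunctional (x : Fin n → ℚ) : ℚ := ∑ i, x i * (n - (i : ℕ))

theorem heightFunctional_add (x y : Fin n → ℚ) :
    heightFunctional (x + y) = heightFunctional x + heightFunctional y := by
  simp [heightFunctional, add_mul, Finset.sum_add_distrib]

theorem heightFunctional_neg (x : Fin n → ℚ) : heightFunctional (-x) = -heightFunctional x := by
  simp [heightFunctional]

theorem heightFunctional_eps (i : Fin n) : heightFunctional (eps (.pos i)) = n - (i : ℕ) := by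
  simp [heightFunctional, eps, Pi.single_apply]

theorem PosRoot.heightFunctional_pos (β : PosRoot n) : 0 < heightFunctional β.vec := by
  rcases β with ⟨i, j, h⟩ | ⟨i, j, h⟩ | i <;>
    simp only [PosRoot.vec, sub_eq_add_neg, heightFunctional_add, heightFunctional_neg,
      heightFunctional_eps]
  · have : ((i : ℕ) : ℚ) < (j : ℕ) := by exact_mod_cast h
    linarith
  · have h1 : ((i : ℕ) : ℚ) < n := by exact_mod_cast i.2
    have h2 : ((j : ℕ) : ℚ) < n := by exact_mod_cast j.2
    linarith
  · have h1 : ((i : ℕ) : ℚ) < n := by exact_mod_cast i.2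
    linarith

theorem PosRoot.vec_ne_neg_vec (α β : PosRoot n) : α.vec ≠ -β.vec := by
  intro h
  have h1 := congrArg heightFunctional h
  rw [heightFunctional_neg] at h1
  have h2 := α.heightFunctional_pos
  have h3 := β.heightFunctional_pos
  linarith

namespace Coded

/-- The coded letters `a` and `b` are such that `ε_a + ε_b` is a negative root. -/
def NegPair (a b : ℤ) : Prop :=
  (a < 0 ∧ (-1 - a < b ∨ b < a)) ∨ (b < 0 ∧ (-1 - b < a ∨ a < b))

instance (a b : ℤ) : Decidable (NegPair a b) := by unfold NegPair; infer_instance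

end Coded

/-- With `ε_i - ε_j` written as `ε_i + ε_{j̄}`, one statement covers both kinds of roots: the sign
is that of the letter of smaller absolute value. -/
theorem exists_eps_add_eps {a b : Letter n} (h : a.abs ≠ b.abs) :
    (∃ β : PosRoot n, eps a + eps b = -β.vec) ↔ Coded.NegPair a.code b.code := by
  have main : ∀ {a b : Letter n}, a.abs < b.abs →
      ((∃ β : PosRoot n, eps a + eps b = -β.vec) ↔ Coded.NegPair a.code b.code) := by
    intro a b hab
    rcases a with i | i <;> rcases b with j | j <;> simp only [Letter.abs] at hab
    · refine iff_of_false ?_ ?_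
      · rintro ⟨β, hβ⟩
        exact (PosRoot.add i j hab).vec_ne_neg_vec β hβ
      · simp only [Letter.code, Coded.NegPair]
        omega
    · refine iff_of_false ?_ ?_
      · rintro ⟨β, hβ⟩
        refine (PosRoot.sub i j hab).vec_ne_neg_vec β (Eq.trans ?_ hβ)
        simp [PosRoot.vec, eps, sub_eq_add_neg]
      · simp only [Letter.code, Coded.NegPair]
        omega
    · refine iff_of_true ⟨.sub i j hab, ?_⟩ ?_
      · simp only [PosRoot.vec, eps]
        abel
      · simp only [Letter.code, Coded.NegPair]
        omega
    · refine iff_of_true ⟨.add i j hab, ?_⟩ ?_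
      · simp only [PosRoot.vec, eps]
        abel
      · simp only [Letter.code, Coded.NegPair]
        omega
  rcases lt_or_gt_of_ne h with h' | h'
  · exact main h'
  · rw [add_comm, main h']
    unfold Coded.NegPair
    omega

theorem exists_eps_eq (a : Letter n) : (∃ β : PosRoot n, eps a = -β.vec) ↔ a.code < 0 := by
  rcases a with i | i
  · refine iff_of_false ?_ ?_
    · rintro ⟨β, hβ⟩
      exact (PosRoot.single i).vec_ne_neg_vec β hβ
    · simp only [Letter.code]; omega
  · refine iff_of_true ⟨.single i, rfl⟩ ?_
    simp only [Letter.code]; omega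

/-- Positive roots as pairs and single indices. -/
def PosRoot.equivSum :
    PosRoot n ≃ ({x : Fin n × Fin n // x.1 < x.2} ⊕ {x : Fin n × Fin n // x.1 < x.2}) ⊕ Fin n where
  toFun
    | .sub i j h => .inl (.inl ⟨(i, j), h⟩)
    | .add i j h => .inl (.inr ⟨(i, j), h⟩)
    | .single i => .inr i
  invFun
    | .inl (.inl x) => .sub x.1.1 x.1.2 x.2
    | .inl (.inr x) => .add x.1.1 x.1.2 x.2
    | .inr i => .single i
  left_inv := by rintro (_ | _ | _) <;> rfl
  right_inv := by rintro ((_ | _) | _) <;> rfl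

theorem PosRoot.sum_eq {M : Type*} [AddCommMonoid M] (f : PosRoot n → M) :
    ∑ α, f α = (∑ i : Fin n, ∑ j : Fin n,
      if h : i < j then f (.sub i j h) + f (.add i j h) else 0) + ∑ i, f (.single i) := by
  rw [← PosRoot.equivSum.symm.sum_comp, Fintype.sum_sum_type, Fintype.sum_sum_type,
    ← Finset.sum_add_distrib, ← Fintype.sum_prod_type', Finset.sum_dite]
  simp only [Finset.sum_const_zero, add_zero]
  congr 1
  refine Finset.sum_bij (fun x _ => ⟨x.1, by simpa using x.2⟩) ?_ ?_ ?_ ?_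
  · simp
  · rintro ⟨a, _⟩ _ ⟨b, _⟩ _ h
    simpa using h
  · rintro ⟨x, hx⟩ _
    exact ⟨⟨x, by simpa using hx⟩, by simp, rfl⟩
  · intro x _
    rfl

end TypeB

/-! ### The change of length under a reflection of a window. -/

namespace TypeB

namespace Coded

/-- The number of roots among `ε_i - ε_j` and `ε_i + ε_j`, for positions `i < j` with entries `a`
and `b`, that are sent to negative roots. -/
def pairInv (a b : ℤ) : ℤ :=
  (if NegPair a (-1 - b) then 1 else 0) + if NegPair a b then 1 else 0

/-- The contribution of the positions `i` and `j` to the length. -/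
def lengthTerm (u : ℕ → ℤ) (i j : ℕ) : ℤ := if i < j then pairInv (u i) (u j) else 0

/-- The length of a signed permutation in terms of its window. -/
def windowLength (n : ℕ) (u : ℕ → ℤ) : ℤ :=
  (∑ i ∈ Finset.range n, ∑ j ∈ Finset.range n, lengthTerm u i j) +
    ∑ i ∈ Finset.range n, if u i < 0 then 1 else 0

/-- The letter of smaller absolute value decides the signs of both roots. If it comes first, the two
signs agree; if it comes second, they are opposite. -/
theorem pairInv_cases (a b : ℤ) (h : a ≠ b) (h' : a ≠ -1 - b) :
    (mag a < mag b ∧ a < 0 ∧ pairInv a b = 2) ∨ (mag a < mag b ∧ 0 ≤ a ∧ pairInv a b = 0) ∨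
      (mag b < mag a ∧ pairInv a b = 1) := by
  have h1 := mag_cases a
  have h2 := mag_cases b
  unfold pairInv NegPair
  split_ifs <;> omega

/-- A double sum whose terms vanish off two rows and columns. -/
theorem sum_sum_eq_of_pair {s : Finset ℕ} {p q : ℕ} (hp : p ∈ s) (hq : q ∈ s) (hpq : p ≠ q)
    (F : ℕ → ℕ → ℤ) (hF : ∀ i j, i ≠ p → i ≠ q → j ≠ p → j ≠ q → F i j = 0) :
    ∑ i ∈ s, ∑ j ∈ s, F i j = (∑ m ∈ (s.erase p).erase q, (F m p + F p m + (F m q + F q m))) +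
      (F p p + F p q + F q p + F q q) := by
  have hq' : q ∈ s.erase p := Finset.mem_erase.2 ⟨hpq.symm, hq⟩
  have hsplit : ∀ f : ℕ → ℤ, ∑ i ∈ s, f i = f p + (f q + ∑ i ∈ (s.erase p).erase q, f i) := by
    intro f
    rw [Finset.add_sum_erase _ _ hq', Finset.add_sum_erase _ _ hp]
  have hzero : ∑ i ∈ (s.erase p).erase q, ∑ j ∈ (s.erase p).erase q, F i j = 0 := by
    refine Finset.sum_eq_zero fun i hi => Finset.sum_eq_zero fun j hj => ?_
    simp only [Finset.mem_erase] at hi hj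
    exact hF i j hi.2.1 hi.1 hj.2.1 hj.1
  rw [hsplit]
  simp only [hsplit (F _), Finset.sum_add_distrib, hzero]
  ring

/-- A double sum whose terms vanish off one row and column. -/
theorem sum_sum_eq_of_single {s : Finset ℕ} {q : ℕ} (hq : q ∈ s)
    (F : ℕ → ℕ → ℤ) (hF : ∀ i j, i ≠ q → j ≠ q → F i j = 0) :
    ∑ i ∈ s, ∑ j ∈ s, F i j = (∑ m ∈ s.erase q, (F m q + F q m)) + F q q := by
  have hsplit : ∀ f : ℕ → ℤ, ∑ i ∈ s, f i = f q + ∑ i ∈ s.erase q, f i := by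
    intro f
    rw [Finset.add_sum_erase _ _ hq]
  have hzero : ∑ i ∈ s.erase q, ∑ j ∈ s.erase q, F i j = 0 := by
    refine Finset.sum_eq_zero fun i hi => Finset.sum_eq_zero fun j hj => ?_
    simp only [Finset.mem_erase] at hi hj
    exact hF i j hi.1 hj.1
  rw [hsplit]
  simp only [hsplit (F _), Finset.sum_add_distrib, hzero]
  ring

variable {n p q : ℕ} {u u' : ℕ → ℤ}

theorem windowLength_sub (u u' : ℕ → ℤ) : windowLength n u' - windowLength n u =
    (∑ i ∈ Finset.range n, ∑ j ∈ Finset.range n, (lengthTerm u' i j - lengthTerm u i j)) +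
      ∑ i ∈ Finset.range n, ((if u' i < 0 then 1 else 0) - if u i < 0 then 1 else 0) := by
  unfold windowLength
  simp only [Finset.sum_sub_distrib]
  ring

/-- The change of length under a flip. -/
theorem windowLength_flip (hu : IsWindow n u) (hq : q < n) (h : Good.IsFlip q u u') :
    windowLength n u' - windowLength n u =
      (∑ m ∈ (Finset.range n).erase q, if q < m then pairInv (u' q) (u m) - pairInv (u q) (u m)
        else 0) + ((if u' q < 0 then 1 else 0) - if u q < 0 then 1 else 0) := by
  have hs := h.self
  rw [windowLength_sub, sum_sum_eq_of_single (Finset.mem_range.2 hq)]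
  · congr 1
    · rw [show lengthTerm u' q q - lengthTerm u q q = 0 by simp [lengthTerm], add_zero]
      refine Finset.sum_congr rfl fun m hm => ?_
      simp only [Finset.mem_erase, Finset.mem_range] at hm
      have h1 := h.other m hm.1
      have h2 := hu.inj m hm.2 q hq hm.1
      have h3 := hu.inj_bar m hm.2 q hq hm.1
      have h4 := pairInv_cases (u m) (u q) h2 h3
      have h5 := pairInv_cases (u m) (u' q) (by omega) (by omega)
      have h6 := mag_cases (u q)
      have h7 := mag_cases (u' q)
      unfold lengthTerm
      rw [h1]
      split_ifs <;> omega
    · rw [← Finset.add_sum_erase _ _ (Finset.mem_range.2 hq), add_eq_left]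
      refine Finset.sum_eq_zero fun m hm => ?_
      rw [h.other m (Finset.mem_erase.1 hm).1, sub_self]
  · intro i j hi hj
    unfold lengthTerm
    rw [h.other i hi, h.other j hj, sub_self]

/-- The change of length under a hop. -/
theorem windowLength_hop (hu : IsWindow n u) (hq : q < n) (h : IsHop p q u u') :
    windowLength n u' - windowLength n u =
      (∑ m ∈ ((Finset.range n).erase p).erase q,
        if m < p then 0 else if m < q then
          pairInv (u' p) (u m) - pairInv (u p) (u m) + (pairInv (u m) (u' q) - pairInv (u m) (u q))
        else
          pairInv (u' p) (u m) - pairInv (u p) (u m) +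
            (pairInv (u' q) (u m) - pairInv (u q) (u m))) +
      (pairInv (u' p) (u' q) - pairInv (u p) (u q) +
        ((if u' p < 0 then 1 else 0) - (if u p < 0 then 1 else 0) +
          ((if u' q < 0 then 1 else 0) - if u q < 0 then 1 else 0))) := by
  have hl := h.left
  have hr := h.right
  have hpq := h.lt
  rw [windowLength_sub, sum_sum_eq_of_pair (p := p) (q := q) (Finset.mem_range.2 (by omega))
    (Finset.mem_range.2 hq) (by omega), add_assoc]
  · congr 1
    · refine Finset.sum_congr rfl fun m hm => ?_
      simp only [Finset.mem_erase, Finset.mem_range] at hm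
      have h1 := h.other m hm.2.1 hm.1
      have h2 := hu.inj m hm.2.2 q hq hm.1
      have h3 := hu.inj_bar m hm.2.2 q hq hm.1
      have h2' := hu.inj m hm.2.2 p (by omega) hm.2.1
      have h3' := hu.inj_bar m hm.2.2 p (by omega) hm.2.1
      have h4 := pairInv_cases (u m) (u q) h2 h3
      have h5 := pairInv_cases (u m) (u' q) (by omega) (by omega)
      have h4' := pairInv_cases (u m) (u p) h2' h3'
      have h5' := pairInv_cases (u m) (u' p) (by omega) (by omega)
      have h6 := mag_cases (u q)
      have h7 := mag_cases (u' q)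
      have h6' := mag_cases (u p)
      have h7' := mag_cases (u' p)
      unfold lengthTerm
      rw [h1]
      split_ifs <;> omega
    · congr 1
      · simp [lengthTerm, hpq, hpq.le.not_gt]
      · have hq' : q ∈ (Finset.range n).erase p := by simp; omega
        rw [← Finset.add_sum_erase _ _ (Finset.mem_range.2 (show p < n by omega)),
          ← Finset.add_sum_erase _ _ hq', add_right_inj, add_eq_left]
        refine Finset.sum_eq_zero fun m hm => ?_
        simp only [Finset.mem_erase] at hm
        rw [h.other m hm.2.1 hm.1, sub_self]
  · intro i j hi hi' hj hj'
    unfold lengthTerm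
    rw [h.other i hi hi', h.other j hj hj', sub_self]

/-- The length condition for edges labelled `ε_q`; the quantum case does not occur unless `q` is
the last position. -/
theorem singleEdge_iff (hu : IsWindow n u) (hq : q + 1 < n) (h : Good.IsFlip q u u') :
    (windowLength n u' = windowLength n u + 1 ∨
      windowLength n u' = windowLength n u - (4 * (n - q) - 2) + 1) ↔ Good.SingleEdge n q u := by
  have hs := h.self
  have hd := windowLength_flip hu (by omega) h
  have hterm : ∀ m ∈ (Finset.range n).erase q, q < m →
      (mag (u q) < mag (u m) ∧ 0 ≤ u q ∧ pairInv (u' q) (u m) - pairInv (u q) (u m) = 2) ∨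
      (mag (u q) < mag (u m) ∧ u q < 0 ∧ pairInv (u' q) (u m) - pairInv (u q) (u m) = -2) ∨
      (mag (u m) < mag (u q) ∧ pairInv (u' q) (u m) - pairInv (u q) (u m) = 0) := by
    intro m hm hqm
    simp only [Finset.mem_erase, Finset.mem_range] at hm
    have h2 := hu.inj m hm.2 q (by omega) hm.1
    have h3 := hu.inj_bar m hm.2 q (by omega) hm.1
    have h4 := pairInv_cases (u q) (u m) (by omega) (by omega)
    have h5 := pairInv_cases (u' q) (u m) (by omega) (by omega)
    have h6 := mag_cases (u q)
    have h7 := mag_cases (u' q)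
    omega
  rcases lt_or_ge (u q) 0 with hneg | hpos
  · refine iff_of_false ?_ (fun he => by have := he.nonneg; omega)
    -- Each of the `n - q - 1` later positions lowers the length by at most 2 and the sign lowers it
    -- by 1. The drop is at most `2 (n - q) - 1`, which is less than the quantum drop `4 (n - q) -
    -- 3` because `q + 1 < n`.
    have hlow : -(2 * ((n : ℤ) - q - 1)) ≤ ∑ m ∈ (Finset.range n).erase q,
        if q < m then pairInv (u' q) (u m) - pairInv (u q) (u m) else 0 := by
      rw [← Finset.sum_filter]
      have h1 := Finset.card_nsmul_le_sum (((Finset.range n).erase q).filter fun m => q < m)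
        (fun m => pairInv (u' q) (u m) - pairInv (u q) (u m)) (-2) (fun m hm => by
          have := hterm m (Finset.mem_filter.1 hm).1 (Finset.mem_filter.1 hm).2
          omega)
      have h2 : (((Finset.range n).erase q).filter fun m => q < m) = Finset.Ioo q n := by
        ext m
        simp only [Finset.mem_filter, Finset.mem_erase, Finset.mem_range, Finset.mem_Ioo]
        omega
      rw [h2] at h1 ⊢
      rw [Nat.card_Ioo, nsmul_eq_mul] at h1
      push_cast [show q + 1 ≤ n by omega, Nat.sub_sub] at h1
      linarith
    have hup : (∑ m ∈ (Finset.range n).erase q,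
        if q < m then pairInv (u' q) (u m) - pairInv (u q) (u m) else 0) ≤ 0 :=
      Finset.sum_nonpos fun m hm => by
        split_ifs with hqm
        · have := hterm m hm hqm
          omega
        · exact le_rfl
    rw [if_neg (by omega), if_pos hneg] at hd
    omega
  · have hnn : ∀ m ∈ (Finset.range n).erase q,
        0 ≤ if q < m then pairInv (u' q) (u m) - pairInv (u q) (u m) else 0 := fun m hm => by
      split_ifs with hqm
      · have := hterm m hm hqm
        omega
      · exact le_rfl
    have hsum := Finset.sum_nonneg hnn
    have hzero := Finset.sum_eq_zero_iff_of_nonneg hnn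
    rw [if_pos (by omega), if_neg (by omega)] at hd
    have h1 : (windowLength n u' = windowLength n u + 1 ∨
        windowLength n u' = windowLength n u - (4 * (n - q) - 2) + 1) ↔
        (∑ m ∈ (Finset.range n).erase q,
          if q < m then pairInv (u' q) (u m) - pairInv (u q) (u m) else 0) = 0 := by
      omega
    rw [h1, hzero]
    constructor
    · intro h2
      refine ⟨hpos, fun m hm hmn => ?_⟩
      have hmem : m ∈ (Finset.range n).erase q := by simp; omega
      have h3 := h2 m hmem
      rw [if_pos hm] at h3
      have h4 := hterm m hmem hm
      have h5 := mag_cases (u q)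
      have h6 := mag_cases (u m)
      omega
    · intro he m hmem
      split_ifs with hm
      · have h3 := he.after m hm (by simpa using (Finset.mem_erase.1 hmem).2)
        have h4 := hterm m hmem hm
        have h5 := mag_cases (u q)
        have h6 := mag_cases (u m)
        omega
      · rfl

/-- The largest possible change of length coming from a third position `m`. -/
def hopBound (p q m : ℕ) : ℤ := if m < p then 0 else if m < q then 2 else 4

theorem sum_hopBound (hpq : p < q) (hq : q < n) :
    ∑ m ∈ ((Finset.range n).erase p).erase q, hopBound p q m =
      2 * ((q : ℤ) - p - 1) + 4 * ((n : ℤ) - 1 - q) := by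
  have h1 : ∀ s, s ≤ p → ∑ m ∈ Finset.range s, hopBound p q m = 0 := fun s hs =>
    Finset.sum_eq_zero fun m hm => by
      rw [Finset.mem_range] at hm
      rw [hopBound, if_pos (by omega)]
  have h2 : ∀ s, p ≤ s → s ≤ q → ∑ m ∈ Finset.range s, hopBound p q m = 2 * ((s : ℤ) - p) := by
    intro s hs
    induction s, hs using Nat.le_induction with
    | base => intro _; rw [h1 p le_rfl]; ring
    | succ s hs ih =>
      intro hsq
      rw [Finset.sum_range_succ, ih (by omega), hopBound, if_neg (by omega), if_pos (by omega)]
      push_cast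
      ring
  have h3 : ∀ s, q ≤ s → ∑ m ∈ Finset.range s, hopBound p q m =
      2 * ((q : ℤ) - p) + 4 * ((s : ℤ) - q) := by
    intro s hs
    induction s, hs using Nat.le_induction with
    | base => rw [h2 q hpq.le le_rfl]; ring
    | succ s hs ih =>
      rw [Finset.sum_range_succ, ih, hopBound, if_neg (by omega), if_neg (by omega)]
      push_cast
      ring
  have hq' : q ∈ (Finset.range n).erase p := by simp; omega
  have h4 := h3 n hq.le
  rw [← Finset.add_sum_erase _ _ (Finset.mem_range.2 (show p < n by omega)),
    ← Finset.add_sum_erase _ _ hq', hopBound, hopBound, if_neg (by omega), if_pos (by omega),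
    if_neg (by omega), if_neg (by omega)] at h4
  linarith

/-- The change of length under a hop coming from a position between the two. -/
theorem pairInv_between {a b c : ℤ} (h1 : c ≠ a) (h2 : c ≠ -1 - a) (h3 : c ≠ b)
    (h4 : c ≠ -1 - b) {d : ℤ} (hd : d = pairInv (-1 - b) c - pairInv a c +
      (pairInv c (-1 - a) - pairInv c b)) :
    (b < -1 - a → ¬ (b < 0 ∧ 0 ≤ -1 - a) →
      0 ≤ d ∧ (d = 0 ↔ ¬ (b < -1 - c ∧ -1 - c < -1 - a))) ∧
    (b < -1 - a → (b < 0 ∧ 0 ≤ -1 - a) →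
      d ≤ 0 ∧ 0 ≤ d + 2 ∧ (d + 2 = 0 ↔ ¬ (b < -1 - c ∧ -1 - c < -1 - a))) ∧
    (-1 - a < b → ¬ (-1 - a < 0 ∧ 0 ≤ b) → d ≤ 0 ∧ 0 ≤ d + 2) ∧
    (-1 - a < b → (-1 - a < 0 ∧ 0 ≤ b) → 0 ≤ d) := by
  have h5 := pairInv_cases (-1 - b) c (by omega) (by omega)
  have h6 := pairInv_cases a c (by omega) (by omega)
  have h7 := pairInv_cases c (-1 - a) (by omega) (by omega)
  have h8 := pairInv_cases c b (by omega) (by omega)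
  have hA := mag_cases a
  have hB := mag_cases b
  have hC := mag_cases c
  have hA' := mag_cases (-1 - a)
  have hB' := mag_cases (-1 - b)
  generalize pairInv (-1 - b) c = a1 at *
  generalize pairInv a c = a2 at *
  generalize pairInv c (-1 - a) = a3 at *
  generalize pairInv c b = a4 at *
  refine ⟨fun _ _ => ?_, fun _ _ => ?_, fun _ _ => ?_, fun _ _ => ?_⟩ <;>
    rcases h5 with h5 | h5 | h5 <;> rcases h6 with h6 | h6 | h6 <;> omega

/-- The change of length under a hop coming from a position after the two. -/
theorem pairInv_after {a b c : ℤ} (h1 : c ≠ a) (h2 : c ≠ -1 - a) (h3 : c ≠ b)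
    (h4 : c ≠ -1 - b) {d : ℤ} (hd : d = pairInv (-1 - b) c - pairInv a c +
      (pairInv (-1 - a) c - pairInv b c)) :
    (b < -1 - a → ¬ (b < 0 ∧ 0 ≤ -1 - a) →
      0 ≤ d ∧ (d = 0 ↔ ¬ (b < c ∧ c < -1 - a) ∧ ¬ (b < -1 - c ∧ -1 - c < -1 - a))) ∧
    (b < -1 - a → (b < 0 ∧ 0 ≤ -1 - a) →
      d ≤ 0 ∧ 0 ≤ d + 4 ∧
        (d + 4 = 0 ↔ ¬ (b < c ∧ c < -1 - a) ∧ ¬ (b < -1 - c ∧ -1 - c < -1 - a))) ∧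
    (-1 - a < b → ¬ (-1 - a < 0 ∧ 0 ≤ b) → d ≤ 0 ∧ 0 ≤ d + 4) ∧
    (-1 - a < b → (-1 - a < 0 ∧ 0 ≤ b) → 0 ≤ d) := by
  have h5 := pairInv_cases (-1 - b) c (by omega) (by omega)
  have h6 := pairInv_cases a c (by omega) (by omega)
  have h7 := pairInv_cases (-1 - a) c (by omega) (by omega)
  have h8 := pairInv_cases b c (by omega) (by omega)
  have hA := mag_cases a
  have hB := mag_cases b
  have hC := mag_cases c
  have hA' := mag_cases (-1 - a)
  have hB' := mag_cases (-1 - b)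
  generalize pairInv (-1 - b) c = a1 at *
  generalize pairInv a c = a2 at *
  generalize pairInv (-1 - a) c = a3 at *
  generalize pairInv b c = a4 at *
  refine ⟨fun _ _ => ?_, fun _ _ => ?_, fun _ _ => ?_, fun _ _ => ?_⟩ <;>
    rcases h5 with h5 | h5 | h5 <;> rcases h6 with h6 | h6 | h6 <;> omega

/-- The length condition for edges labelled `ε_p + ε_q`. -/
theorem addEdge_iff (hu : IsWindow n u) (hq : q < n) (h : IsHop p q u u') :
    (windowLength n u' = windowLength n u + 1 ∨
      windowLength n u' = windowLength n u - (4 * n - 2 * p - 2 * q - 2) + 1) ↔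
      AddEdge n p q u := by
  have hpq := h.lt
  have hl := h.left
  have hr := h.right
  have hd := windowLength_hop hu hq h
  have hb := sum_hopBound hpq hq
  set S := ((Finset.range n).erase p).erase q with hS
  have hmem : ∀ m, m ∈ S ↔ m ≠ q ∧ m ≠ p ∧ m < n := by
    intro m
    simp [hS]
  set D : ℕ → ℤ := fun m => if m < p then 0 else if m < q then
      pairInv (u' p) (u m) - pairInv (u p) (u m) + (pairInv (u m) (u' q) - pairInv (u m) (u q))
    else
      pairInv (u' p) (u m) - pairInv (u p) (u m) +
        (pairInv (u' q) (u m) - pairInv (u q) (u m)) with hD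
  have hpair := pairInv_cases (u p) (u q) (hu.inj p (by omega) q hq (by omega))
    (hu.inj_bar p (by omega) q hq (by omega))
  have hpair' := pairInv_cases (u' p) (u' q)
    (by have := hu.inj p (by omega) q hq (by omega); omega)
    (by have := hu.inj_bar p (by omega) q hq (by omega); omega)
  have hmp := mag_cases (u p)
  have hmq := mag_cases (u q)
  have hmp' := mag_cases (u' p)
  have hmq' := mag_cases (u' q)
  have hne := hu.inj_bar p (by omega) q hq (by omega)
  -- the condition on a third position
  let C : ℕ → Prop := fun m => (p < m → m < q → ¬ (u q < -1 - u m ∧ -1 - u m < -1 - u p)) ∧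
    (q < m → ¬ (u q < u m ∧ u m < -1 - u p)) ∧ (q < m → ¬ (u q < -1 - u m ∧ -1 - u m < -1 - u p))
  have hC : u q < -1 - u p → (AddEdge n p q u ↔ ∀ m ∈ S, C m) := by
    intro hlt
    constructor
    · intro he m hm
      have hm' := (hmem m).1 hm
      exact ⟨fun h1 h2 => he.between m h1 h2, fun h1 => he.after m h1 hm'.2.2,
        fun h1 => he.after_bar m h1 hm'.2.2⟩
    · intro hall
      exact ⟨hlt, fun m h1 h2 => (hall m ((hmem m).2 (by omega))).1 h1 h2,
        fun m h1 h2 => (hall m ((hmem m).2 (by omega))).2.1 h1,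
        fun m h1 h2 => (hall m ((hmem m).2 (by omega))).2.2 h1⟩
  -- The cases are: row `q` moves up or down in the integer order, and does or does not cross zero.
  -- Moving up without crossing, a third position never lowers the length and is neutral exactly
  -- under `C m`; moving up across zero, it lowers the length by at most `hopBound`, with equality
  -- exactly under `C m`.
  have hterm : ∀ m ∈ S,
      (u q < -1 - u p → ¬ (u q < 0 ∧ 0 ≤ -1 - u p) → 0 ≤ D m ∧ (D m = 0 ↔ C m)) ∧
      (u q < -1 - u p → (u q < 0 ∧ 0 ≤ -1 - u p) →
        D m ≤ 0 ∧ 0 ≤ D m + hopBound p q m ∧ (D m + hopBound p q m = 0 ↔ C m)) ∧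
      (-1 - u p < u q → ¬ (-1 - u p < 0 ∧ 0 ≤ u q) → D m ≤ 0 ∧ 0 ≤ D m + hopBound p q m) ∧
      (-1 - u p < u q → (-1 - u p < 0 ∧ 0 ≤ u q) → 0 ≤ D m) := by
    intro m hm
    have hm' := (hmem m).1 hm
    have h2 := hu.inj m hm'.2.2 q hq hm'.1
    have h3 := hu.inj_bar m hm'.2.2 q hq hm'.1
    have h2' := hu.inj m hm'.2.2 p (by omega) hm'.2.1
    have h3' := hu.inj_bar m hm'.2.2 p (by omega) hm'.2.1
    rcases lt_trichotomy m p with hmp1 | hmp1 | hmp1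
    · have hD0 : D m = 0 := if_pos hmp1
      have hb0 : hopBound p q m = 0 := if_pos hmp1
      have hCm : C m := ⟨fun _ _ => by omega, fun _ => by omega, fun _ => by omega⟩
      simp [hD0, hb0, hCm]
    · omega
    · rcases lt_trichotomy m q with hmq1 | hmq1 | hmq1
      · have hD0 : D m = pairInv (u' p) (u m) - pairInv (u p) (u m) +
            (pairInv (u m) (u' q) - pairInv (u m) (u q)) := by
          simp only [hD, if_neg (show ¬ m < p by omega), if_pos hmq1]
        rw [hl, hr] at hD0
        have hb0 : hopBound p q m = 2 := by
          rw [hopBound, if_neg (by omega), if_pos hmq1]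
        have hCm : C m ↔ ¬ (u q < -1 - u m ∧ -1 - u m < -1 - u p) :=
          ⟨fun hc => hc.1 hmp1 hmq1, fun hc => ⟨fun _ _ => hc, by omega, by omega⟩⟩
        rw [hb0, hCm]
        exact pairInv_between h2' h3' h2 h3 hD0
      · omega
      · have hD0 : D m = pairInv (u' p) (u m) - pairInv (u p) (u m) +
            (pairInv (u' q) (u m) - pairInv (u q) (u m)) := by
          simp only [hD, if_neg (show ¬ m < p by omega), if_neg (show ¬ m < q by omega)]
        rw [hl, hr] at hD0
        have hb0 : hopBound p q m = 4 := by
          rw [hopBound, if_neg (by omega), if_neg (by omega)]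
        have hCm : C m ↔ ¬ (u q < u m ∧ u m < -1 - u p) ∧
            ¬ (u q < -1 - u m ∧ -1 - u m < -1 - u p) :=
          ⟨fun hc => ⟨hc.2.1 hmq1, hc.2.2 hmq1⟩,
            fun hc => ⟨fun _ _ => by omega, fun _ => hc.1, fun _ => hc.2⟩⟩
        rw [hb0, hCm]
        exact pairInv_after h2' h3' h2 h3 hD0
  have hbound : ∑ m ∈ S, (D m + hopBound p q m) = ∑ m ∈ S, D m + ∑ m ∈ S, hopBound p q m :=
    Finset.sum_add_distrib
  change _ = ∑ m ∈ S, D m + _ at hd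
  -- An upward move without crossing can only be a Bruhat edge, one across zero only a quantum edge,
  -- where positions `p` and `q` account for the missing drop of 3. For a downward move the bounds
  -- leave neither possibility.
  rcases lt_or_gt_of_ne (show u q ≠ -1 - u p by omega) with hlt | hgt
  · rw [hC hlt]
    by_cases hz : u q < 0 ∧ 0 ≤ -1 - u p
    · have hnn : ∀ m ∈ S, 0 ≤ D m + hopBound p q m := fun m hm => ((hterm m hm).2.1 hlt hz).2.1
      have hsum := Finset.sum_nonneg hnn
      have hzero := Finset.sum_eq_zero_iff_of_nonneg hnn
      have hsum' := Finset.sum_nonpos fun m hm => ((hterm m hm).2.1 hlt hz).1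
      rw [← forall₂_congr fun m hm => ((hterm m hm).2.1 hlt hz).2.2, ← hzero]
      split_ifs at hd <;> omega
    · have hnn : ∀ m ∈ S, 0 ≤ D m := fun m hm => ((hterm m hm).1 hlt hz).1
      have hsum := Finset.sum_nonneg hnn
      have hzero := Finset.sum_eq_zero_iff_of_nonneg hnn
      rw [← forall₂_congr fun m hm => ((hterm m hm).1 hlt hz).2, ← hzero]
      split_ifs at hd <;> omega
  · refine iff_of_false ?_ (fun he => by have := he.lt; omega)
    by_cases hz : -1 - u p < 0 ∧ 0 ≤ u q
    · have hsum := Finset.sum_nonneg fun m hm => (hterm m hm).2.2.2 hgt hz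
      split_ifs at hd <;> omega
    · have hsum := Finset.sum_nonpos fun m hm => ((hterm m hm).2.2.1 hgt hz).1
      have hsum' := Finset.sum_nonneg fun m hm => ((hterm m hm).2.2.1 hgt hz).2
      split_ifs at hd <;> omega

end Coded

end TypeB

/-! ### Edges of the quantum Bruhat graph in terms of windows. -/

namespace TypeB

variable {n : ℕ}

open SignedPerm

theorem SignedPerm.abs_apply_ne (w : SignedPerm n) {i j : Fin n} (h : i ≠ j) :
    (w.1 (.pos i)).abs ≠ (w.1 (.pos j)).abs := by
  intro heq
  have h1 := (isWindow w).inj i i.2 j j.2 (fun h' => h (Fin.ext h'))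
  have h2 := (isWindow w).inj_bar i i.2 j j.2 (fun h' => h (Fin.ext h'))
  rw [window_coe, window_coe] at h1 h2
  have h3 := (Letter.abs_eq_iff _ _).1 heq
  have h4 := (Letter.abs_eq_iff (w.1 (.pos j)) _).1 rfl
  omega

theorem length_eq_windowLength (w : SignedPerm n) :
    (length w : ℤ) = Coded.windowLength n (window w) := by
  unfold length Coded.windowLength
  rw [Finset.card_filter]
  push_cast
  rw [PosRoot.sum_eq, Finset.sum_range, Finset.sum_range]
  congr 1
  · refine Finset.sum_congr rfl fun i _ => ?_
    rw [Finset.sum_range]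
    refine Finset.sum_congr rfl fun j _ => ?_
    unfold Coded.lengthTerm
    by_cases hij : i < j
    · rw [dif_pos hij, if_pos (c := (i : ℕ) < j) hij]
      unfold Coded.pairInv
      have hne := abs_apply_ne w hij.ne
      have h1 : act w (PosRoot.sub i j hij).vec = eps (w.1 (.pos i)) + eps (w.1 (.pos j)).bar := by
        rw [PosRoot.vec, act_sub, act_eps_pos, act_eps_pos, eps_bar, sub_eq_add_neg]
      have h2 : act w (PosRoot.add i j hij).vec = eps (w.1 (.pos i)) + eps (w.1 (.pos j)) := by
        rw [PosRoot.vec, act_add, act_eps_pos, act_eps_pos]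
      have hne' : (w.1 (.pos i)).abs ≠ (w.1 (.pos j)).bar.abs := by
        cases h : w.1 (.pos j) <;> simpa [h, Letter.bar, Letter.abs] using hne
      rw [h1, h2, window_coe, window_coe, ← Letter.code_bar]
      simp only [exists_eps_add_eps hne, exists_eps_add_eps hne']
    · rw [dif_neg hij, if_neg (c := (i : ℕ) < j) hij]
  · refine Finset.sum_congr rfl fun i _ => ?_
    rw [window_coe]
    have h1 : act w (PosRoot.single i).vec = eps (w.1 (.pos i)) := act_eps_pos w i
    simp only [h1, exists_eps_eq]

/-- In coordinate `i`, the roots `ε_b ∓ ε_i` with `b < i` cancel, each `j > i` contributes 2 through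
`ε_i ∓ ε_j`, and `ε_i` contributes 1. Indices start from zero. -/
theorem rho_apply (i : Fin n) : rho n i = n - (i : ℕ) - 1 / 2 := by
  have hcard : (∑ j : Fin n, if i < j then (2 : ℚ) else 0) = 2 * (n - (i : ℕ) - 1) := by
    rw [← Finset.sum_filter, Finset.sum_const, nsmul_eq_mul]
    have : (Finset.univ.filter fun j => i < j) = Finset.Ioi i := by ext; simp
    rw [this, Fin.card_Ioi]
    have := i.2
    rw [Nat.sub_sub, Nat.cast_sub (by omega)]
    push_cast
    ring
  have hsum : (∑ α : PosRoot n, α.vec) i = 2 * (n - (i : ℕ) - 1) + 1 := by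
    rw [Finset.sum_apply, PosRoot.sum_eq, ← hcard]
    congr 1
    · rw [Finset.sum_eq_single i]
      · refine Finset.sum_congr rfl fun j _ => ?_
        by_cases h : i < j
        · simp only [h, dif_pos, if_true, PosRoot.vec, eps, Pi.add_apply, Pi.sub_apply,
            Pi.single_eq_same]
          ring
        · simp [h]
      · intro b _ hb
        refine Finset.sum_eq_zero fun j _ => ?_
        by_cases h : b < j
        · simp only [h, dif_pos, PosRoot.vec, eps, Pi.add_apply, Pi.sub_apply,
            Pi.single_eq_of_ne hb.symm]
          ring
        · simp [h]
      · simp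
    · simp [PosRoot.vec, eps, Pi.single_apply]
  rw [rho, Pi.smul_apply, hsum, smul_eq_mul]
  ring

theorem rho_dotProduct_coroot_single (q : Fin n) :
    rho n ⬝ᵥ (PosRoot.single q).coroot = 2 * n - 2 * (q : ℕ) - 1 := by
  simp only [PosRoot.coroot, PosRoot.vec, eps, dotProduct_smul, dotProduct_single, rho_apply,
    Pi.single_eq_same, smul_eq_mul]
  ring

theorem rho_dotProduct_coroot_add (p q : Fin n) (h : p < q) :
    rho n ⬝ᵥ (PosRoot.add p q h).coroot = 2 * n - (p : ℕ) - (q : ℕ) - 1 := by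
  simp only [PosRoot.coroot, PosRoot.vec, eps, dotProduct_smul, dotProduct_add, dotProduct_single,
    rho_apply, Pi.single_eq_same, smul_eq_mul, Pi.add_apply, Pi.single_eq_of_ne h.ne,
    Pi.single_eq_of_ne h.ne']
  ring

theorem qEdge_single_iff (w v : SignedPerm n) (q : Fin n) (hq : (q : ℕ) + 1 < n) :
    QEdge w (.single q) v ↔ v = w * (PosRoot.single q).refl ∧
      Coded.Good.SingleEdge n q (window w) := by
  unfold QEdge
  refine and_congr_right fun hv => ?_
  rw [← Coded.singleEdge_iff (isWindow w) hq (window_mul_refl_single w q), ← hv,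
    ← length_eq_windowLength, ← length_eq_windowLength, rho_dotProduct_coroot_single]
  refine or_congr (by norm_cast) ?_
  rw [← @Int.cast_inj ℚ]
  push_cast
  constructor <;> intro h <;> linarith

theorem qEdge_add_iff (w v : SignedPerm n) (p q : Fin n) (hpq : p < q) :
    QEdge w (.add p q hpq) v ↔ v = w * (PosRoot.add p q hpq).refl ∧
      Coded.AddEdge n p q (window w) := by
  unfold QEdge
  refine and_congr_right fun hv => ?_
  rw [← Coded.addEdge_iff (isWindow w) q.2 (window_mul_refl_add w p q hpq), ← hv,
    ← length_eq_windowLength, ← length_eq_windowLength, rho_dotProduct_coroot_add]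
  refine or_congr (by norm_cast) ?_
  rw [← @Int.cast_inj ℚ]
  push_cast
  constructor <;> intro h <;> linarith

end TypeB

/-! ### Paths along the chain of roots. -/

namespace TypeB

variable {n : ℕ}

open SignedPerm

/-- `P` is a path from `u` to `v` with labels forming a subsequence of `l`. -/
structure IsPathTo (l : List (PosRoot n)) (u v : SignedPerm n)
    (P : List (PosRoot n × SignedPerm n)) : Prop where
  path : IsQPath u P
  labels : (P.map Prod.fst).Sublist l
  target : endpoint u P = v

theorem endpoint_cons (u w : SignedPerm n) (α : PosRoot n) (P : List (PosRoot n × SignedPerm n)) :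
    endpoint u ((α, w) :: P) = endpoint w P := by
  simp [endpoint, vertices]

/-- `G u v` holds if and only if there is a path from `u` to `v` with labels in `l`, and such paths
are unique. -/
def Characterizes (l : List (PosRoot n)) (G : SignedPerm n → SignedPerm n → Prop) : Prop :=
  (∀ u v, G u v ↔ ∃ P, IsPathTo l u v P) ∧
    ∀ u v P Q, IsPathTo l u v P → IsPathTo l u v Q → P = Q

theorem isPathTo_cons_iff {l : List (PosRoot n)} {α : PosRoot n} {u v : SignedPerm n}
    {P : List (PosRoot n × SignedPerm n)} :
    IsPathTo (α :: l) u v P ↔ IsPathTo l u v P ∨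
      ∃ w P', P = (α, w) :: P' ∧ QEdge u α w ∧ IsPathTo l w v P' := by
  constructor
  · rintro ⟨h1, h2, h3⟩
    rcases List.sublist_cons_iff.1 h2 with h | ⟨r, hr, hr'⟩
    · exact Or.inl ⟨h1, h, h3⟩
    · right
      rcases P with _ | ⟨⟨β, w⟩, P'⟩
      · simp at hr
      · simp only [List.map_cons, List.cons.injEq] at hr
        obtain ⟨rfl, rfl⟩ := hr
        exact ⟨w, P', rfl, h1.1, h1.2, hr', by rwa [endpoint_cons] at h3⟩
  · rintro (⟨h1, h2, h3⟩ | ⟨w, P', rfl, h1, h2, h3, h4⟩)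
    · exact ⟨h1, h2.cons _, h3⟩
    · exact ⟨⟨h1, h2⟩, h3.cons_cons _, by rw [endpoint_cons]; exact h4⟩

/-- A path along `α :: l` either skips `α` or begins with it. By `hex` at most one of the two is
possible for given ends, so uniqueness passes from `l` to `α :: l`. -/
theorem Characterizes.cons {l : List (PosRoot n)} {α : PosRoot n}
    {G G' : SignedPerm n → SignedPerm n → Prop} (h : Characterizes l G')
    (hG : ∀ u v, G u v ↔ G' u v ∨ (QEdge u α (u * α.refl) ∧ G' (u * α.refl) v))
    (hex : ∀ u v, G' u v → QEdge u α (u * α.refl) → ¬ G' (u * α.refl) v) :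
    Characterizes (α :: l) G := by
  have hedge : ∀ {u w : SignedPerm n}, QEdge u α w → w = u * α.refl := fun he => he.1
  constructor
  · intro u v
    rw [hG, h.1, h.1]
    constructor
    · rintro (⟨P, hP⟩ | ⟨he, P, hP⟩)
      · exact ⟨P, isPathTo_cons_iff.2 (Or.inl hP)⟩
      · exact ⟨_, isPathTo_cons_iff.2 (Or.inr ⟨_, P, rfl, he, hP⟩)⟩
    · rintro ⟨P, hP⟩
      rcases isPathTo_cons_iff.1 hP with hP | ⟨w, P', rfl, he, hP'⟩
      · exact Or.inl ⟨P, hP⟩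
      · obtain rfl := hedge he
        exact Or.inr ⟨he, P', hP'⟩
  · intro u v P Q hP hQ
    rcases isPathTo_cons_iff.1 hP with hP | ⟨w, P', rfl, he, hP'⟩ <;>
      rcases isPathTo_cons_iff.1 hQ with hQ | ⟨w', Q', rfl, he', hQ'⟩
    · exact h.2 u v P Q hP hQ
    · obtain rfl := hedge he'
      exact (hex u v ((h.1 u v).2 ⟨P, hP⟩) he' ((h.1 _ _).2 ⟨Q', hQ'⟩)).elim
    · obtain rfl := hedge he
      exact (hex u v ((h.1 u v).2 ⟨Q, hQ⟩) he ((h.1 _ _).2 ⟨P', hP'⟩)).elim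
    · obtain rfl := hedge he
      obtain rfl := hedge he'
      rw [h.2 _ _ P' Q' hP' hQ']

theorem Characterizes.congr {l : List (PosRoot n)} {G G' : SignedPerm n → SignedPerm n → Prop}
    (h : Characterizes l G') (hG : ∀ u v, G u v ↔ G' u v) : Characterizes l G :=
  ⟨fun u v => (hG u v).trans (h.1 u v), h.2⟩

/-! ### The chain of roots -/

/-- The elements `s - 1, …, 0` of `Fin n`. -/
def downFrom (n : ℕ) : ℕ → List (Fin n)
  | 0 => []
  | s + 1 => if h : s < n then ⟨s, h⟩ :: downFrom n s else downFrom n s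

theorem downFrom_map_val {s : ℕ} (hs : s ≤ n) :
    (downFrom n s).map Fin.val = (List.range s).reverse := by
  induction s with
  | zero => rfl
  | succ s ih =>
    rw [downFrom, dif_pos (show s < n from hs), List.map_cons, ih (by omega), List.range_succ, List.reverse_append]
    rfl

theorem finRange_reverse : (List.finRange n).reverse = downFrom n n := by
  apply List.map_injective_iff.2 Fin.val_injective
  rw [downFrom_map_val le_rfl, List.map_reverse, List.map_coe_finRange_eq_range]

theorem mem_downFrom {s : ℕ} {i : Fin n} : i ∈ downFrom n s ↔ (i : ℕ) < s := by
  induction s with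
  | zero => simp [downFrom]
  | succ s ih =>
    rw [downFrom]
    split_ifs with h
    · rw [List.mem_cons, ih, Fin.ext_iff]
      simp only
      omega
    · rw [ih]
      omega

theorem filterMap_downFrom {β : Type*} (f : Fin n → Option β) {t : ℕ}
    (hf : ∀ i : Fin n, t ≤ i → f i = none) {s : ℕ} (hs : t ≤ s) :
    (downFrom n s).filterMap f = (downFrom n t).filterMap f := by
  induction s, hs using Nat.le_induction with
  | base => rfl
  | succ s hs ih =>
    rw [downFrom]
    split_ifs with h
    · rw [List.filterMap_cons_none (hf _ hs), ih]
    · exact ih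

/-- The root `ε_j + ε_i` for `j < i`. -/
def addRoot? (i j : Fin n) : Option (PosRoot n) := if h : j < i then some (.add j i h) else none

theorem gammaRow_eq (i : Fin n) :
    gammaRow i = .single i :: (downFrom n i).filterMap (addRoot? i) := by
  unfold gammaRow
  rw [finRange_reverse]
  congr 1
  exact filterMap_downFrom (addRoot? i) (fun j hj => dif_neg (by rw [Fin.lt_def]; omega)) i.2.le

theorem gammaR_eq {k : ℕ} (hk : k ≤ n) : gammaR n k = (downFrom n k).flatMap gammaRow := by
  unfold gammaR
  rw [finRange_reverse]
  congr 1
  have h1 : ∀ (s : ℕ), (downFrom n s).filter (fun i : Fin n => i.val < k) =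
      (downFrom n s).filterMap (fun i : Fin n => if i.val < k then some i else none) := by
    intro s
    rw [← List.filterMap_eq_filter]
    congr 1
    ext i
    simp [Option.guard]
  rw [h1, filterMap_downFrom (t := k) _ (fun i hi => if_neg (by omega)) hk, ← h1,
    List.filter_eq_self]
  intro i hi
  simpa using mem_downFrom.1 hi

theorem gammaR_succ {q : ℕ} (hq : q < n) :
    gammaR n (q + 1) = .single ⟨q, hq⟩ ::
      ((downFrom n q).filterMap (addRoot? ⟨q, hq⟩) ++ gammaR n q) := by
  rw [gammaR_eq hq, gammaR_eq hq.le, downFrom, dif_pos hq, List.flatMap_cons, gammaRow_eq]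
  rfl

theorem mem_gammaR {k : ℕ} (hk : k ≤ n) {α : PosRoot n} (h : α ∈ gammaR n k) :
    (∃ q : Fin n, (q : ℕ) < k ∧ α = .single q) ∨
      ∃ (p q : Fin n) (hpq : p < q), (q : ℕ) < k ∧ α = .add p q hpq := by
  rw [gammaR_eq hk, List.mem_flatMap] at h
  obtain ⟨q, hq, hα⟩ := h
  rw [mem_downFrom] at hq
  rw [gammaRow_eq, List.mem_cons, List.mem_filterMap] at hα
  rcases hα with rfl | ⟨p, -, hp⟩
  · exact Or.inl ⟨q, hq, rfl⟩
  · unfold addRoot? at hp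
    split_ifs at hp with hpq
    exact Or.inr ⟨p, q, hpq, hq, (Option.some.inj hp).symm⟩

/-! ### The induction over the chain -/

theorem characterizes_nil (hn : 0 < n) : Characterizes (n := n) (gammaR n 0)
    fun u v => Coded.Good n 0 (window u) (window v) := by
  have hnil : gammaR n 0 = [] := by rw [gammaR_eq (Nat.zero_le n)]; rfl
  rw [hnil]
  have hP : ∀ {u v : SignedPerm n} {P}, IsPathTo [] u v P → P = [] := fun h => by
    simpa using h.labels
  constructor
  · intro u v
    constructor
    · intro h
      obtain rfl : u = v := ext_window fun i hi => h.agree i (Nat.zero_le i) hi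
      exact ⟨[], trivial, List.Sublist.slnil, rfl⟩
    · rintro ⟨P, h⟩
      obtain rfl := hP h
      obtain rfl : u = v := h.target
      exact ⟨hn, isWindow u, isWindow u, fun _ _ _ => rfl, by omega, by omega,
        by simp [Coded.crossings], by omega, by omega, by omega⟩
  · intro u v P Q h1 h2
    rw [hP h1, hP h2]

/-- The states of row `q` from which only steps with labels `ε_j + ε_q`, `j < p`, are made. -/
structure RowState (n p q : ℕ) (u v : ℕ → ℤ) : Prop where
  good : Coded.Good n (q + 1) u v
  sign : u q < 0 ∨ 0 ≤ v q
  done : ∀ m, p ≤ m → m < q → ¬ (u q < -1 - u m ∧ -1 - u m ≤ v q)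

/-- Induction on the number of labels left in row `q`. The label `ε_p + ε_q` is used exactly when
the bar of `u p` lies in `(u q, v q]`. When no label is left, the row has reached its end by
`last_eq` and is dropped by `pred`. -/
theorem characterizes_row {q : ℕ} (hq : q + 1 < n)
    (h : Characterizes (gammaR n q) fun u v => Coded.Good n q (window u) (window v)) {p : ℕ}
    (hp : p ≤ q) :
    Characterizes ((downFrom n p).filterMap (addRoot? ⟨q, by omega⟩) ++ gammaR n q)
      fun u v => RowState n p q (window u) (window v) := by
  induction p with
  | zero =>
    refine Characterizes.congr h fun u v => ⟨fun H => ?_, fun H => ?_⟩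
    · exact H.good.pred (H.good.last_eq H.sign fun m hm => H.done m (Nat.zero_le m) hm)
    · have hc := H.agree q le_rfl (by omega)
      exact ⟨H.succ hq hc, by omega, by omega⟩
  | succ p ih =>
    have hpq : (⟨p, by omega⟩ : Fin n) < ⟨q, by omega⟩ := by rw [Fin.mk_lt_mk]; omega
    have hlist : (downFrom n (p + 1)).filterMap (addRoot? ⟨q, by omega⟩) =
        .add ⟨p, by omega⟩ ⟨q, by omega⟩ hpq ::
          (downFrom n p).filterMap (addRoot? ⟨q, by omega⟩) := by
      rw [downFrom, dif_pos (by omega), List.filterMap_cons_some]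
      exact dif_pos hpq
    rw [hlist, List.cons_append]
    have hhop := fun u : SignedPerm n => window_mul_refl_add u _ _ hpq
    have hedge := fun u : SignedPerm n => qEdge_add_iff u (u * (PosRoot.add _ _ hpq).refl) _ _ hpq
    simp only [true_and] at hedge
    refine (ih (by omega)).cons (fun u v => ⟨fun H => ?_, ?_⟩) (fun u v H he H' => ?_)
    · by_cases hy : window u q < -1 - window u p ∧ -1 - window u p ≤ window v q
      · obtain ⟨h1, h2, h3, h4⟩ := H.good.hop H.sign (hhop u)
          (fun m hm hmq => H.done m (by simpa using hm) hmq) hy.1 hy.2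
        exact Or.inr ⟨(hedge u).2 h1, h2, h3, h4⟩
      · refine Or.inl ⟨H.good, H.sign, fun m hm hmq => ?_⟩
        rcases eq_or_lt_of_le hm with rfl | hm
        · exact hy
        · exact H.done m hm hmq
    · rintro (H | ⟨he, H⟩)
      · exact ⟨H.good, H.sign, fun m hm hmq => H.done m (by omega) hmq⟩
      · obtain ⟨h1, h2, h3, h4⟩ := H.good.hop_back H.sign (hhop u) H.done ((hedge u).1 he)
        exact ⟨h1, h2, fun m hm hmq => h3 m (by simpa using hm) hmq⟩
    -- If both choices were possible, `hop_back` would put the bar of `u p` into `(u q, v q]`, while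
    -- skipping the label requires the contrary.
    · have he' := (hedge u).1 he
      obtain ⟨h1, h2, h3, h4⟩ := H'.good.hop_back H'.sign (hhop u) H'.done he'
      exact H.done p le_rfl (by omega) ⟨he'.lt, h4⟩

/-- The row of `q` begins with `ε_q`, used exactly when `u q` is nonnegative and `v q` negative; the
rest is `characterizes_row` applied to the chain for `q`. -/
theorem characterizes_gammaR {k : ℕ} (hk : k < n) :
    Characterizes (gammaR n k) fun u v => Coded.Good n k (window u) (window v) := by
  induction k with
  | zero => exact characterizes_nil hk
  | succ q ih =>
    have hrow := characterizes_row hk (ih (by omega)) le_rfl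
    rw [gammaR_succ (by omega)]
    have hflip := fun u : SignedPerm n => window_mul_refl_single u ⟨q, by omega⟩
    have hedge := fun u : SignedPerm n =>
      qEdge_single_iff u (u * (PosRoot.single ⟨q, by omega⟩).refl) ⟨q, by omega⟩ hk
    simp only [true_and] at hedge
    refine hrow.cons (fun u v => ⟨fun H => ?_, ?_⟩) (fun u v H he H' => ?_)
    · by_cases hS : window u q < 0 ∨ 0 ≤ window v q
      · exact Or.inl ⟨H, hS, by omega⟩
      · obtain ⟨h1, h2, h3⟩ := H.flip hS (hflip u)
        exact Or.inr ⟨(hedge u).2 h1, h2, h3, by omega⟩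
    · rintro (H | ⟨he, H⟩)
      · exact H.good
      · exact (H.good.flip_back (hflip u) ((hedge u).1 he)).1
    · exact (H'.good.flip_back (hflip u) ((hedge u).1 he)).2 H.sign

/-! ### Monotonicity of the rows -/

theorem Letter.circRank_eq (a x : Letter n) : (circRank a x : ℤ) =
    if a.code ≤ x.code then x.code - a.code else x.code - a.code + 2 * n := by
  have hkey : ∀ z : Letter n, (z.key : ℤ) = if 0 ≤ z.code then z.code else z.code + 2 * n := by
    intro z
    rcases z with i | i <;> simp only [key, code] <;> split_ifs <;> omega
  have h1 := hkey a
  have h2 := hkey x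
  have h3 := a.neg_le_code
  have h4 := a.code_lt
  have h5 := x.neg_le_code
  have h6 := x.code_lt
  have h7 : circRank a x = if a.key ≤ x.key then x.key - a.key else x.key + 2 * n - a.key := by
    unfold circRank
    have h8 : a.key < 2 * n ∧ x.key < 2 * n := by split_ifs at h1 h2 <;> omega
    split_ifs with h
    · rw [show x.key + 2 * n - a.key = (x.key - a.key) + 2 * n by omega, Nat.add_mod_right,
        Nat.mod_eq_of_lt (by omega)]
    · rw [Nat.mod_eq_of_lt (by omega)]
  rw [h7]
  split_ifs at h1 h2 ⊢ <;> omega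

/-- For letters met after `a` when reading from `e`, the rank from `a` is the rank from `e` minus
that of `a`. A common cut point makes monotonicity transitive along a path. -/
theorem Letter.circLE_of_circRank_le {e a x y : Letter n} (h1 : circRank e a ≤ circRank e x)
    (h2 : circRank e x ≤ circRank e y) : CircLE a x y := by
  unfold CircLE
  have h3 := circRank_eq e a
  have h4 := circRank_eq e x
  have h5 := circRank_eq e y
  have h6 := circRank_eq a x
  have h7 := circRank_eq a y
  have he := e.neg_le_code
  have he' := e.code_lt
  have ha := a.neg_le_code
  have ha' := a.code_lt
  have hx := x.neg_le_code
  have hx' := x.code_lt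
  have hy := y.neg_le_code
  have hy' := y.code_lt
  split_ifs at * <;> omega

/-- All active rows move forward on the circle, if it is cut at the letter `e`. -/
def RowsLE (k : ℕ) (e : Letter n) (w w' : SignedPerm n) : Prop :=
  ∀ i : Fin n, (i : ℕ) < k → Letter.circRank e (w.1 (.pos i)) ≤ Letter.circRank e (w'.1 (.pos i))

instance (k : ℕ) (e : Letter n) : IsTrans (SignedPerm n) (RowsLE k e) :=
  ⟨fun _ _ _ h1 h2 i hi => (h1 i hi).trans (h2 i hi)⟩

/-- The entry in position `k` is fixed by every label of the chain, and the length conditions at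
this later position forbid the moved rows to pass over it. So the circle can be cut there. -/
theorem qEdge_gammaR {k : ℕ} (hk : k < n) {α : PosRoot n} (hα : α ∈ gammaR n k)
    {w w' : SignedPerm n} (h : QEdge w α w') :
    RowsLE k (w.1 (.pos ⟨k, hk⟩)) w w' ∧ ∀ m, k ≤ m → window w' m = window w m := by
  have hek : (w.1 (.pos ⟨k, hk⟩)).code = window w k := (window_of_lt w hk).symm
  rcases mem_gammaR hk.le hα with ⟨q, hq, rfl⟩ | ⟨p, q, hpq, hq, rfl⟩
  · obtain ⟨rfl, he⟩ := (qEdge_single_iff w _ q (by omega)).1 h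
    have hf := window_mul_refl_single w q
    refine ⟨fun i hi => ?_, fun m hm => hf.other m (by omega)⟩
    have h1 := Letter.circRank_eq (w.1 (.pos ⟨k, hk⟩)) (w.1 (.pos i))
    have h2 := Letter.circRank_eq (w.1 (.pos ⟨k, hk⟩))
      ((w * (PosRoot.single q).refl : SignedPerm n).1 (.pos i))
    rw [hek, ← window_coe] at h1 h2
    rcases eq_or_ne i q with rfl | hiq
    · have h3 := hf.self
      have h4 := he.after k hq hk
      have h5 := (isWindow w).upper i i.2
      split_ifs at h1 h2 <;> omega
    · rw [hf.other i (fun h => hiq (Fin.ext h))] at h2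
      omega
  · obtain ⟨rfl, he⟩ := (qEdge_add_iff w _ p q hpq).1 h
    have hh := window_mul_refl_add w p q hpq
    have hpq' : (p : ℕ) < q := hpq
    refine ⟨fun i hi => ?_, fun m hm => hh.other m (by omega) (by omega)⟩
    have h1 := Letter.circRank_eq (w.1 (.pos ⟨k, hk⟩)) (w.1 (.pos i))
    have h2 := Letter.circRank_eq (w.1 (.pos ⟨k, hk⟩))
      ((w * (PosRoot.add p q hpq).refl : SignedPerm n).1 (.pos i))
    rw [hek, ← window_coe] at h1 h2
    have h3 := he.lt
    have h4 := he.after k hq hk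
    have h5 := he.after_bar k hq hk
    have h6 := (isWindow w).inj k hk p p.2 (by omega)
    have h7 := (isWindow w).inj_bar k hk p p.2 (by omega)
    have h8 := (isWindow w).inj k hk q q.2 (by omega)
    have h9 := (isWindow w).inj_bar k hk q q.2 (by omega)
    rcases eq_or_ne i q with rfl | hiq
    · have h10 := hh.right
      split_ifs at h1 h2 <;> omega
    · rcases eq_or_ne i p with rfl | hip
      · have h10 := hh.left
        split_ifs at h1 h2 <;> omega
      · rw [hh.other i (fun h => hip (Fin.ext h)) (fun h => hiq (Fin.ext h))] at h2
        omega

theorem isQPath_gammaR {k : ℕ} (hk : k < n) {P : List (PosRoot n × SignedPerm n)} :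
    ∀ {w : SignedPerm n}, IsQPath w P → (∀ α ∈ P.map Prod.fst, α ∈ gammaR n k) →
      (vertices w P).IsChain (RowsLE k (w.1 (.pos ⟨k, hk⟩))) ∧
        ∀ m, k ≤ m → window (endpoint w P) m = window w m := by
  induction P with
  | nil =>
    intro w _ _
    exact ⟨List.isChain_singleton _, fun m _ => rfl⟩
  | cons x P ih =>
    obtain ⟨α, w'⟩ := x
    rintro w ⟨he, hP⟩ hα
    simp only [List.map_cons, List.mem_cons, forall_eq_or_imp] at hα
    obtain ⟨h1, h2⟩ := qEdge_gammaR hk hα.1 he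
    obtain ⟨h3, h4⟩ := ih hP hα.2
    have hk' : w'.1 (.pos ⟨k, hk⟩) = w.1 (.pos ⟨k, hk⟩) := by
      have := h2 k le_rfl
      rw [window_of_lt _ hk, window_of_lt _ hk] at this
      exact Letter.code_injective this
    refine ⟨?_, fun m hm => by rw [endpoint_cons, h4 m hm, h2 m hm]⟩
    rw [hk'] at h3
    exact List.IsChain.cons_cons h1 h3

/-- Each row is weakly increasing along a path. -/
theorem rows_pairwise {k : ℕ} (hk : k < n) {u : SignedPerm n}
    {P : List (PosRoot n × SignedPerm n)} (hP : IsQPath u P)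
    (hα : (P.map Prod.fst).Sublist (gammaR n k)) (i : Fin k) :
    ((vertices u P).map fun w => column hk.le w i).Pairwise
      (Letter.CircLE (column hk.le u i)) := by
  have hchain := (isQPath_gammaR hk hP fun α h => hα.subset h).1
  have hpw := List.isChain_iff_pairwise.1 hchain
  rw [vertices, List.pairwise_cons] at hpw
  rw [List.pairwise_map, vertices, List.pairwise_cons]
  constructor
  · intro w hw
    exact Letter.circLE_of_circRank_le le_rfl (hpw.1 w hw (Fin.castLE hk.le i) i.2)
  · refine List.Pairwise.imp_of_mem (fun {a b} ha hb hab => ?_) hpw.2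
    exact Letter.circLE_of_circRank_le (hpw.1 a ha (Fin.castLE hk.le i) i.2)
      (hab (Fin.castLE hk.le i) i.2)

end TypeB

/-! ### Counting the rows across each gap of the circle. -/

namespace TypeB.Coded

/-- The step from `y` to `y + 1` belongs to the path from `a` to `c` along the circle. -/
def CrossesGap (a y c : ℤ) : Prop := (a ≤ y ∧ y < c) ∨ (c < a ∧ (a ≤ y ∨ y < c))

instance (a y c : ℤ) : Decidable (CrossesGap a y c) := by
  unfold CrossesGap
  infer_instance

/-- The number of the first `k` rows which cross the gap after `y`. -/
def gapCount (k : ℕ) (u v : ℕ → ℤ) (y : ℤ) : ℕ :=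
  ((Finset.range k).filter fun i => CrossesGap (u i) y (v i)).card

/-- The number of positive letters up to `x` among the first `k` entries of `u`, minus the same
number for `v`. -/
def posDiff (k : ℕ) (u v : ℕ → ℤ) (x : ℤ) : ℤ :=
  ∑ i ∈ Finset.range k,
    ((if 0 ≤ u i ∧ u i ≤ x then 1 else 0) - (if 0 ≤ v i ∧ v i ≤ x then 1 else 0))

variable {n k : ℕ} {u v : ℕ → ℤ}

/-- For each row the indicator of crossing the gap is `[a ≤ y] - [c ≤ y] + [c < a]`. The last term
does not depend on `y`, so counts at different gaps can be compared. -/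
theorem gapCount_eq_sum (k : ℕ) (u v : ℕ → ℤ) (y : ℤ) :
    (gapCount k u v y : ℤ) = ∑ i ∈ Finset.range k,
      ((if u i ≤ y then 1 else 0) - (if v i ≤ y then 1 else 0) + if v i < u i then 1 else 0) := by
  classical
  unfold gapCount
  rw [Finset.card_filter]
  push_cast
  apply Finset.sum_congr rfl
  intro i _
  unfold CrossesGap
  split_ifs <;> omega

theorem gapCount_of_nonneg {x : ℤ} (hx : -1 ≤ x) :
    (gapCount k u v x : ℤ) = gapCount k u v (-1) + posDiff k u v x := by
  rw [gapCount_eq_sum, gapCount_eq_sum, posDiff, ← Finset.sum_add_distrib]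
  apply Finset.sum_congr rfl
  intro i _
  split_ifs <;> omega

theorem sum_mag_le (hu : IsWindow n u) (hv : IsWindow n v) (hk : k ≤ n)
    (hag : ∀ m, k ≤ m → m < n → u m = v m) (x : ℤ) :
    ∑ i ∈ Finset.range k, (if -1 - x ≤ u i ∧ u i ≤ x then (1 : ℤ) else 0) =
      ∑ i ∈ Finset.range k, (if -1 - x ≤ v i ∧ v i ≤ x then 1 else 0) := by
  have h1 : ∑ i ∈ Finset.range n, (if -1 - x ≤ u i ∧ u i ≤ x then (1 : ℤ) else 0) =
      ∑ i ∈ Finset.range n, (if -1 - x ≤ v i ∧ v i ≤ x then 1 else 0) := by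
    have h := (hu.card_filter (V := fun z => -1 - x ≤ z ∧ z ≤ x) (fun z hz => by omega)).trans
      (hv.card_filter (V := fun z => -1 - x ≤ z ∧ z ≤ x) (fun z hz => by omega)).symm
    rw [← Finset.natCast_card_filter, ← Finset.natCast_card_filter]
    rw [Nat.cast_inj]
    convert h
  have h2 : ∑ i ∈ Finset.Ico k n, (if -1 - x ≤ u i ∧ u i ≤ x then (1 : ℤ) else 0) =
      ∑ i ∈ Finset.Ico k n, (if -1 - x ≤ v i ∧ v i ≤ x then 1 else 0) := by
    apply Finset.sum_congr rfl
    intro m hm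
    rw [Finset.mem_Ico] at hm
    rw [hag m hm.1 hm.2]
  rw [← Finset.sum_range_add_sum_Ico _ hk, ← Finset.sum_range_add_sum_Ico _ hk] at h1
  linarith

/-- The gap after `-2 - x` is the mirror image of the gap after `x`. The two counts agree because
both columns contain equally many letters of absolute value up to `x`, by `sum_mag_le`. -/
theorem gapCount_bar (hu : IsWindow n u) (hv : IsWindow n v) (hk : k ≤ n)
    (hag : ∀ m, k ≤ m → m < n → u m = v m) {x : ℤ} (hx : -1 ≤ x) :
    (gapCount k u v (-2 - x) : ℤ) = gapCount k u v (-1) + posDiff k u v x := by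
  have h := sum_mag_le hu hv hk hag x
  have hz : ∀ z : ℤ, (if z ≤ -2 - x then (1 : ℤ) else 0) = (if z ≤ -1 then 1 else 0) -
      (if -1 - x ≤ z ∧ z ≤ x then 1 else 0) + if 0 ≤ z ∧ z ≤ x then 1 else 0 := by
    intro z
    split_ifs <;> omega
  simp only [gapCount_eq_sum, posDiff, Finset.sum_add_distrib, Finset.sum_sub_distrib, hz]
  linarith

theorem posDiff_neg {x : ℤ} (hx : x < 0) : posDiff k u v x = 0 := by
  apply Finset.sum_eq_zero
  intro i _
  rw [if_neg (by omega), if_neg (by omega), sub_zero]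

/-- The condition on the first `k` entries of `u` and `v` which characterizes split columns. -/
def SplitCondition (n k : ℕ) (u v : ℕ → ℤ) : Prop :=
  ∃ d : ℤ, Even d ∧ (∀ x : ℤ, -1 ≤ x → x < n → d ≤ posDiff k u v x) ∧
    ∀ m, k ≤ m → m < n → posDiff k u v (mag (u m)) = d

theorem not_crossesGap_of_gapCount {y : ℤ} (h : gapCount k u v y = 0) {i : ℕ} (hi : i < k) :
    ¬ CrossesGap (u i) y (v i) := by
  classical
  unfold gapCount at h
  rw [Finset.card_eq_zero, Finset.filter_eq_empty_iff] at h
  exact h (Finset.mem_range.2 hi)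

/-- A row neither starts in an unused letter nor in its bar, so to cross the gap just after such a
letter it would have to pass over the letter. -/
theorem Good.gapCount_eq_zero (h : Good n k u v) {m : ℕ} (hm : k ≤ m) (hmn : m < n) :
    gapCount k u v (mag (u m)) = 0 := by
  classical
  unfold gapCount
  rw [Finset.card_eq_zero, Finset.filter_eq_empty_iff]
  intro i hi
  have hi := Finset.mem_range.1 hi
  have h1 := h.avoid i hi m hm hmn
  have h2 := h.avoid_bar i hi m hm hmn
  have h3 := h.src.inj i (by omega) m hmn (by omega)
  have h4 := h.src.inj_bar i (by omega) m hmn (by omega)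
  have h5 := mag_cases (u m)
  unfold Sbt at h1 h2
  unfold CrossesGap
  omega

/-- A wrapping row with a negative start, or one with a nonnegative end, would cover all letters of
the other sign, among them an unused letter or its bar. So a row meets the gap at zero only by going
from negative to positive. -/
theorem Good.gapCount_zero (h : Good n k u v) : gapCount k u v (-1) = crossings u v k := by
  classical
  unfold gapCount crossings
  congr 1
  apply Finset.filter_congr
  intro i hi
  have hi := Finset.mem_range.1 hi
  have hk := h.lt
  have h1 := h.avoid i hi k le_rfl hk
  have h2 := h.avoid_bar i hi k le_rfl hk
  have h3 := h.src.inj i (by omega) k hk (by omega)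
  have h4 := h.src.inj_bar i (by omega) k hk (by omega)
  have h5 := h.src.upper k hk
  have h6 := h.src.lower k hk
  have h7 := h.tgt.inj i (by omega) k hk (by omega)
  have h8 := h.tgt.inj_bar i (by omega) k hk (by omega)
  rw [← h.agree k le_rfl hk] at h7 h8
  unfold Sbt at h1 h2
  unfold CrossesGap
  omega

theorem Good.splitCondition (h : Good n k u v) : SplitCondition n k u v := by
  refine ⟨-(crossings u v k : ℤ), ?_, fun x _ _ => ?_, fun m hm hmn => ?_⟩
  · exact (by exact_mod_cast h.even : Even (crossings u v k : ℤ)).neg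
  · rcases lt_or_ge x 0 with hx | hx
    · rw [posDiff_neg hx]
      omega
    · have := gapCount_of_nonneg (k := k) (u := u) (v := v) (x := x) (by omega)
      rw [h.gapCount_zero] at this
      omega
  · have := gapCount_of_nonneg (k := k) (u := u) (v := v) (x := (mag (u m) : ℤ)) (by omega)
    rw [h.gapCount_zero, h.gapCount_eq_zero hm hmn] at this
    omega

/-- If the row `i` passes over the last entry `b`, then an even number of rows crosses zero, and
only the row `i` crosses the gap after `b`. -/
theorem Blocked.gapCounts {q i : ℕ} (hk : q + 1 < n) (hu : IsWindow n u) (hv : IsWindow n v)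
    (hi : i < q) (hB : Blocked n u v i (v q))
    (cond1 : ∀ i < q, u i ≠ v q)
    (cond2 : ∀ i < q, Sbt (u i) (v q) (v i) → Blocked n u v i (v q))
    (hs : Sbt (u i) (v q) (v i)) (hag : ∀ m, q + 1 ≤ m → m < n → u m = v m) :
    gapCount (q + 1) u v (v q) = 1 ∧ Even (gapCount (q + 1) u v (-1)) := by
  classical
  have hb := hB.nonneg
  have hlo := hB.lower
  have hup := hB.upper
  have hle : ∀ m < n, -1 - v q ≤ u m → u m ≤ v q → m ≤ i := fun m hm h1 h2 =>
    hB.le_of_mag_le hu hm h1 h2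
  have hcr : ∀ m < q + 1, CrossesGap (u m) (v q) (v m) → m = i := by
    intro m hm hc
    have hmq : m ≠ q := fun h => by
      subst h
      unfold CrossesGap at hc
      omega
    have h1 := cond1 m (by omega)
    have h2 := hv.inj m (by omega) q (by omega) hmq
    have h3 := cond2 m (by omega) (by unfold CrossesGap at hc; unfold Sbt; omega)
    have h4 := h3.le_of_mag_le hu (j := i) (by omega) (by omega) (by omega)
    have h5 := hle m (by omega) h3.lower h3.upper.le
    omega
  have hci : CrossesGap (u i) (v q) (v i) := by
    unfold Sbt at hs
    unfold CrossesGap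
    omega
  have hclosed : ∀ m < n, m ≠ i → -1 - v q ≤ u m → u m ≤ v q → u m ≤ v m ∧ v m < v q := by
    intro m hm hmi h1 h2
    have h3 := hle m hm h1 h2
    have h4 := mt (hcr m (by omega)) hmi
    have h5 := hv.inj m (by omega) q (by omega) (by omega)
    unfold CrossesGap at h4
    omega
  have hvi : v i < -1 - v q ∨ v q < v i := by
    by_contra h1
    have h2 := hv.inj i (by omega) q (by omega) (by omega)
    have h3 := hv.inj_bar i (by omega) q (by omega) (by omega)
    have := hB.lt_of_mag_lt hv (j := i) (by omega) (by omega) (by omega)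
    omega
  have hout : u q < -1 - v q ∨ v q < u q := by
    by_contra h1
    have := hle q (by omega) (by omega) (by omega)
    omega
  have hsymm := hu.closed_symm (hv.swap (i := i) (j := q) (by omega) (by omega))
    (fun y => -1 - v q ≤ y ∧ y ≤ v q) (fun y hy => by omega) (fun m hm hy => by
      rcases eq_or_ne m i with rfl | hmi
      · simp only [Function.comp_apply, Equiv.swap_apply_left]
        omega
      · have hmq : m ≠ q := fun h => by subst h; omega
        have h1 := hclosed m hm hmi hy.1 hy.2
        simp only [Function.comp_apply, Equiv.swap_apply_of_ne_of_ne hmi hmq]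
        omega)
  have hzero : ∀ m < q, i < m ∨ (u m < -1 - v q ∨ v q < u m) →
      ¬ CrossesGap (u m) (-1) (v m) := by
    intro m hm hm' hc
    have hmi : m ≠ i := fun h => by subst h; omega
    have h1 : u m < -1 - v q ∨ v q < u m := by
      by_contra h
      have := hle m (by omega) (by omega) (by omega)
      omega
    have h2 := mt (hcr m (by omega)) hmi
    have h3 := hsymm m (by omega)
    simp only [Function.comp_apply, Equiv.swap_apply_of_ne_of_ne hmi hm.ne] at h3
    unfold CrossesGap at hc h2
    omega
  constructor
  · unfold gapCount
    rw [Finset.card_eq_one]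
    refine ⟨i, ?_⟩
    ext m
    simp only [Finset.mem_filter, Finset.mem_range, Finset.mem_singleton]
    exact ⟨fun h => hcr m h.1 h.2, fun h => by subst h; exact ⟨by omega, hci⟩⟩
  -- Row `q` crosses the gap at zero in any case, directly or by wrapping around; the other rows
  -- that do so are those counted in the blocking at `i`. Hence the total is one more than an odd
  -- number.
  · have hset : ((Finset.range (q + 1)).filter fun m => CrossesGap (u m) (-1) (v m)) =
        insert q ((Finset.range (i + 1)).filter fun m => u m < 0 ∧ (m < i → 0 ≤ v m)) := by
      ext m
      simp only [Finset.mem_filter, Finset.mem_range, Finset.mem_insert]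
      rcases eq_or_ne m q with rfl | hmq
      · simp only [true_or, iff_true]
        unfold CrossesGap
        omega
      rcases eq_or_ne m i with rfl | hmi
      · have := hv.lower m (by omega)
        have := hv.upper m (by omega)
        unfold CrossesGap at hci ⊢
        omega
      by_cases hin : u m < -1 - v q ∨ v q < u m
      · constructor
        · rintro ⟨h1, h2⟩
          exact absurd h2 (hzero m (by omega) (Or.inr hin))
        · rintro (h1 | ⟨h1, h2, h3⟩)
          · omega
          · have h4 := hzero m (by omega) (Or.inr hin)
            unfold CrossesGap at h4
            omega
      · have h1 := hclosed m
        have h2 := hle m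
        unfold CrossesGap
        omega
    unfold gapCount
    rw [hset, Finset.card_insert_of_notMem (by simp; omega)]
    have hodd := hB.odd
    have hcard : ((Finset.range (i + 1)).filter fun m => u m < 0 ∧ (m < i → 0 ≤ v m)).card =
        crossings u v i + if u i < 0 then 1 else 0 := by
      rw [Finset.range_add_one, Finset.filter_insert]
      have h1 : ((Finset.range i).filter fun m => u m < 0 ∧ (m < i → 0 ≤ v m)) =
          (Finset.range i).filter fun j => u j < 0 ∧ 0 ≤ v j :=
        Finset.filter_congr fun m hm => by
          have := Finset.mem_range.1 hm
          simp [this]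
      rw [h1]
      unfold crossings
      by_cases h2 : u i < 0
      · rw [if_pos (by simpa using h2), if_pos h2, Finset.card_insert_of_notMem (by simp)]
      · rw [if_neg (by simpa using h2), if_neg h2, add_zero]
    rw [hcard]
    grind

/-- The split condition says that the number of rows across a gap is smallest at the gaps of the
unused letters, and that this minimum has the parity of the count at zero. Goodness says in addition
that the minimum is zero, and this is what Condition 2 at the last row provides. -/
theorem good_iff_splitCondition (hk1 : 1 ≤ k) (hk : k < n) (hu : IsWindow n u) (hv : IsWindow n v)
    (hag : ∀ m, k ≤ m → m < n → u m = v m) :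
    Good n k u v ↔ SplitCondition n k u v ∧
      (∀ i l, i < l → l < k → u i ≠ v l) ∧
      (∀ i l, i < l → l < k → Sbt (u i) (v l) (v i) → Blocked n u v i (v l)) ∧
      (∀ i, i + 1 < k → ¬ Blocked n u v i (v i)) := by
  classical
  refine ⟨fun h => ⟨h.splitCondition, h.cond1, h.cond2, h.cond3⟩, ?_⟩
  rintro ⟨⟨d, hd, hmin, hun⟩, h1, h2, h3⟩
  obtain ⟨q, rfl⟩ : ∃ q, k = q + 1 := ⟨k - 1, by omega⟩
  have hpos : ∀ {x : ℤ}, -1 ≤ x → _ := fun {x} hx =>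
    gapCount_of_nonneg (k := q + 1) (u := u) (v := v) (x := x) hx
  have hbar : ∀ {x : ℤ}, -1 ≤ x → _ := fun {x} hx => gapCount_bar hu hv hk.le hag (x := x) hx
  have hlow : ∀ y : ℤ, -(n : ℤ) ≤ y → y < n →
      (gapCount (q + 1) u v (-1) : ℤ) + d ≤ gapCount (q + 1) u v y := by
    intro y hy1 hy2
    rcases le_or_gt (-1) y with hy | hy
    · have := hpos hy
      have := hmin y hy hy2
      omega
    · have h4 := hbar (x := -2 - y) (by omega)
      have := hmin (-2 - y) (by omega) (by omega)
      rw [show -2 - (-2 - y) = y by ring] at h4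
      omega
  -- Look at the gap after `v q`. If no row passes over `v q`, its count is zero. Otherwise the
  -- count is one and that at zero is even, so the minimum is even and at most one.
  have hd0 : (gapCount (q + 1) u v (-1) : ℤ) + d = 0 := by
    have hq0 : 0 ≤ (gapCount (q + 1) u v (-1) : ℤ) + d := by
      have h4 := hpos (x := (mag (u (q + 1)) : ℤ)) (by omega)
      have := hun (q + 1) le_rfl hk
      omega
    by_cases hex : ∃ i < q, Sbt (u i) (v q) (v i)
    · obtain ⟨i, hi, hs⟩ := hex
      have hB := h2 i q hi (by omega) hs
      obtain ⟨h4, h5⟩ := hB.gapCounts hk hu hv hi (fun i hi => h1 i q hi (by omega))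
        (fun i hi => h2 i q hi (by omega)) hs hag
      have h6 := hlow (v q) (hv.lower q (by omega)) (hv.upper q (by omega))
      rw [h4] at h6
      have h7 : Even ((gapCount (q + 1) u v (-1) : ℤ) + d) :=
        (by exact_mod_cast h5 : Even (gapCount (q + 1) u v (-1) : ℤ)).add hd
      have h8 : (gapCount (q + 1) u v (-1) : ℤ) + d ≠ 1 := fun h => by rw [h] at h7; simp at h7
      push_cast at h6
      omega
    · push Not at hex
      have h4 : gapCount (q + 1) u v (v q) = 0 := by
        unfold gapCount
        rw [Finset.card_eq_zero, Finset.filter_eq_empty_iff]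
        intro i hi
        have hi := Finset.mem_range.1 hi
        rcases eq_or_ne i q with rfl | hiq
        · unfold CrossesGap
          omega
        · have h5 := h1 i q (by omega) (by omega)
          have h6 := hex i (by omega)
          have h7 := hv.inj i (by omega) q (by omega) hiq
          unfold Sbt at h6
          unfold CrossesGap
          omega
      have := hlow (v q) (hv.lower q (by omega)) (hv.upper q (by omega))
      omega
  have hgap : ∀ m, q + 1 ≤ m → m < n → gapCount (q + 1) u v (mag (u m)) = 0 ∧
      gapCount (q + 1) u v (-2 - mag (u m)) = 0 := by
    intro m hm hmn
    have h4 := hpos (x := (mag (u m) : ℤ)) (by omega)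
    have h5 := hbar (x := (mag (u m) : ℤ)) (by omega)
    have := hun m hm hmn
    omega
  have havoid : ∀ i < q + 1, ∀ m, q + 1 ≤ m → m < n → ¬ Sbt (u i) (mag (u m)) (v i) ∧
      ¬ Sbt (u i) (-1 - mag (u m)) (v i) := by
    intro i hi m hm hmn
    have h4 := not_crossesGap_of_gapCount (hgap m hm hmn).1 hi
    have h5 := not_crossesGap_of_gapCount (hgap m hm hmn).2 hi
    unfold CrossesGap at h4 h5
    unfold Sbt
    omega
  have ha : ∀ i < q + 1, ∀ m, q + 1 ≤ m → m < n → ¬ Sbt (u i) (u m) (v i) := by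
    intro i hi m hm hmn
    have h4 := havoid i hi m hm hmn
    rcases mag_cases (u m) with h | h
    · rw [h.2] at h4
      exact h4.1
    · rw [h.2, sub_sub_cancel] at h4
      exact h4.2
  have hab : ∀ i < q + 1, ∀ m, q + 1 ≤ m → m < n → ¬ Sbt (u i) (-1 - u m) (v i) := by
    intro i hi m hm hmn
    have h4 := havoid i hi m hm hmn
    rcases mag_cases (u m) with h | h
    · rw [h.2] at h4
      exact h4.2
    · rw [h.2] at h4
      exact h4.1
  refine ⟨hk, hu, hv, hag, ha, hab, ?_, h1, h2, h3⟩
  have hz : gapCount (q + 1) u v (-1) = crossings u v (q + 1) := by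
    unfold gapCount crossings
    congr 1
    apply Finset.filter_congr
    intro i hi
    have hi := Finset.mem_range.1 hi
    have h4 := ha i hi (q + 1) le_rfl hk
    have h5 := hab i hi (q + 1) le_rfl hk
    have h6 := hu.inj i (by omega) (q + 1) hk (by omega)
    have h7 := hu.inj_bar i (by omega) (q + 1) hk (by omega)
    have h8 := hv.inj i (by omega) (q + 1) hk (by omega)
    have h9 := hv.inj_bar i (by omega) (q + 1) hk (by omega)
    have h10 := hu.upper (q + 1) hk
    have h11 := hu.lower (q + 1) hk
    rw [← hag (q + 1) le_rfl hk] at h8 h9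
    unfold Sbt at h4 h5
    unfold CrossesGap
    omega
  rw [← hz]
  have : Even (gapCount (q + 1) u v (-1) : ℤ) := by
    rw [show (gapCount (q + 1) u v (-1) : ℤ) = -d by omega]
    exact hd.neg
  exact_mod_cast this

end TypeB.Coded

/-! ### The conditions on columns in terms of windows. -/

namespace TypeB

variable {n : ℕ}

open SignedPerm

namespace Letter

theorem circBetween_iff (a b c : Letter n) :
    CircBetween a b c ↔ Coded.Sbt a.code b.code c.code := by
  unfold CircBetween CircLT Coded.Sbt
  have h1 := circRank_eq a a
  have h2 := circRank_eq a b
  have h3 := circRank_eq a c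
  have ha := a.neg_le_code
  have ha' := a.code_lt
  have hb := b.neg_le_code
  have hb' := b.code_lt
  have hc := c.neg_le_code
  have hc' := c.code_lt
  split_ifs at * <;> omega

theorem eq_iff_code {a b : Letter n} : a = b ↔ a.code = b.code := code_injective.eq_iff.symm

theorem eq_of_abs_eq {a b : Letter n} (h : a.abs = b.abs) : a = b ∨ a = b.bar := by
  cases a <;> cases b <;> simp_all [abs, bar]

@[simp] theorem abs_bar (a : Letter n) : a.bar.abs = a.abs := by cases a <;> rfl

theorem bar_ne_self (a : Letter n) : a.bar ≠ a := by cases a <;> simp [bar]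

theorem abs_eq_mag (a : Letter n) : (a.abs : ℕ) = Coded.mag a.code := by
  have := Coded.mag_cases a.code
  cases a <;> simp only [abs, code] at this ⊢ <;> omega

end Letter

theorem code_column {k : ℕ} (hk : k ≤ n) (u : SignedPerm n) (i : Fin k) :
    (column hk u i).code = window u i := by
  rw [window_of_lt u (i.2.trans_le hk)]
  rfl

/-- Blocking at `i` involves only the entries of `C'` up to `i`, and the entry at `i` is `b` itself.
It is thus enough that `C'` agrees with `v` before `i`, which covers both `C'` and `C't_{il}`. -/
theorem blockedOff_iff {k : ℕ} (hk : k ≤ n) (u v : SignedPerm n) (C' : Fin k → Letter n)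
    (i : Fin k) (hC' : ∀ j < i, C' j = column hk v j) :
    BlockedOff (column hk u) C' i ↔ Coded.Blocked n (window u) (window v) i (C' i).code := by
  have habs : ∀ (j : Fin k) (x : Fin n), (column hk u j).abs = x ↔
      window u j = x ∨ window u j = -1 - (x : ℤ) := fun j x => by
    rw [Letter.abs_eq_iff, code_column]
  have habs' : ∀ j < i, ∀ x : Fin n, (C' j).abs = x ↔
      window v j = x ∨ window v j = -1 - (x : ℤ) := fun j hj x => by
    rw [hC' j hj, Letter.abs_eq_iff, code_column]
  have hodd : ∀ b : Fin n, C' i = .pos b →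
      (Finset.univ.filter fun j => j ≤ i ∧ (column hk u j).IsNeg ∧ (C' j).IsPos).card =
        Coded.crossings (window u) (window v) i + if window u i < 0 then 1 else 0 := by
    intro b hb
    -- The value `0` at position `i` stands for the positive letter `C' i`, of which only the sign
    -- is counted.
    have h1 := Coded.crossings_succ (window u) (fun j => if j = i then 0 else window v j) i
    simp only [if_true, le_refl, and_true] at h1
    have h2 : Coded.crossings (window u) (fun j => if j = i then 0 else window v j) i =
        Coded.crossings (window u) (window v) i := by
      unfold Coded.crossings
      congr 1
      apply Finset.filter_congr
      intro j hj
      simp only [if_neg (Finset.mem_range.1 hj).ne]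
    rw [← h2, ← h1]
    unfold Coded.crossings
    apply Finset.card_bij (fun (j : Fin k) _ => (j : ℕ))
    · intro j hj
      simp only [Finset.mem_filter, Finset.mem_univ, true_and, Letter.isNeg_iff, Letter.isPos_iff,
        code_column, Finset.mem_range] at hj ⊢
      refine ⟨by have := hj.1; rw [Fin.le_def] at this; omega, hj.2.1, ?_⟩
      split_ifs with h
      · rfl
      · have hji : j < i := lt_of_le_of_ne hj.1 fun h' => h (by rw [h'])
        have := hj.2.2
        rwa [hC' j hji, code_column] at this
    · intro j _ j' _ h
      exact Fin.ext h
    · intro j hj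
      simp only [Finset.mem_filter, Finset.mem_range] at hj
      have hjk : j < k := by omega
      refine ⟨⟨j, hjk⟩, ?_, rfl⟩
      simp only [Finset.mem_filter, Finset.mem_univ, true_and, Letter.isNeg_iff, Letter.isPos_iff,
        code_column]
      refine ⟨by rw [Fin.le_def]; simp only; omega, hj.2.1, ?_⟩
      rcases eq_or_ne j (i : ℕ) with h | h
      · have : (⟨j, hjk⟩ : Fin k) = i := Fin.ext h
        rw [this, hb]
        simp [Letter.code]
      · have h3 : (⟨j, hjk⟩ : Fin k) < i := by rw [Fin.lt_def]; simp only; omega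
        rw [hC' _ h3, code_column]
        have := hj.2.2
        rwa [if_neg h] at this
  have hui : (column hk u i).code = window u i := code_column hk u i
  constructor
  · rintro ⟨b, hb, ⟨h1, h2, h3⟩, ⟨h4, h5⟩, h6⟩
    have hcb : (C' i).code = b := by rw [hb]; rfl
    rw [hodd b hb] at h6
    rw [hcb]
    have h7 := Letter.abs_eq_mag (column hk u i)
    have h8 := Coded.mag_cases (column hk u i).code
    rw [Fin.le_def] at h1
    rw [habs, Letter.eq_iff_code, hui] at h3
    rw [hui] at h7 h8
    simp only [Letter.code] at h3
    refine ⟨by omega, by omega, by omega, by omega, ?_, ?_, h6⟩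
    · intro x hx0 hxb
      obtain ⟨j, hj, hjx⟩ := h4 ⟨x.toNat, by omega⟩ (by rw [Fin.le_def]; simp only; omega)
      rw [habs] at hjx
      refine ⟨j, hj, ?_⟩
      simp only at hjx
      omega
    · intro x hx0 hxb
      obtain ⟨j, hj, hjx⟩ := h5 ⟨x.toNat, by omega⟩ (by rw [Fin.le_def]; simp only; omega)
      have hji : j ≠ i := by
        rintro rfl
        rw [hb] at hjx
        simp only [Letter.abs, Fin.ext_iff] at hjx
        omega
      have hlt := lt_of_le_of_ne hj hji
      rw [habs' j hlt] at hjx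
      refine ⟨j, hlt, ?_⟩
      simp only at hjx
      omega
  · rintro ⟨h1, h2, h3, h4, h5, h6, h7⟩
    obtain ⟨b, hb⟩ : ∃ b, C' i = .pos b := (Letter.isPos_iff _).2 h1
    have hcb : (C' i).code = b := by rw [hb]; rfl
    rw [hcb] at h1 h2 h3 h4 h5 h6
    have h8 := Letter.abs_eq_mag (column hk u i)
    have h9 := Coded.mag_cases (column hk u i).code
    rw [hui] at h8 h9
    refine ⟨b, hb, ⟨?_, by omega, ?_⟩, ⟨?_, ?_⟩, ?_⟩
    · rw [Fin.le_def]
      omega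
    · rw [habs, Letter.eq_iff_code, hui]
      simp only [Letter.code]
      omega
    · intro x hx
      rw [Fin.le_def] at hx
      obtain ⟨j, hj, hjx⟩ := h5 x (by omega) (by omega)
      exact ⟨⟨j, by omega⟩, by rw [Fin.le_def]; exact hj, (habs _ _).2 hjx⟩
    · intro x hx
      rcases eq_or_lt_of_le hx with rfl | hx
      · exact ⟨i, le_rfl, by rw [hb]; rfl⟩
      · rw [Fin.lt_def] at hx
        obtain ⟨j, hj, hjx⟩ := h6 x (by omega) (by omega)
        have hlt : (⟨j, by omega⟩ : Fin k) < i := by rw [Fin.lt_def]; exact hj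
        exact ⟨⟨j, by omega⟩, hlt.le, (habs' _ hlt _).2 hjx⟩
    · rw [hodd b hb]
      exact h7

theorem conditions_iff {k : ℕ} (hk : k ≤ n) (u v : SignedPerm n) :
    Conditions (column hk u) (column hk v) ↔
      (∀ i l, i < l → l < k → window u i ≠ window v l) ∧
      (∀ i l, i < l → l < k → Coded.Sbt (window u i) (window v l) (window v i) →
        Coded.Blocked n (window u) (window v) i (window v l)) ∧
      (∀ i, i + 1 < k → ¬ Coded.Blocked n (window u) (window v) i (window v i)) := by
  have hswap : ∀ i l : Fin k, i < l →
      (BlockedOff (column hk u) (column hk v ∘ Equiv.swap i l) i ↔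
        Coded.Blocked n (window u) (window v) i (window v l)) := fun i l hil => by
    rw [blockedOff_iff hk u v _ i fun j hj => by
      rw [Function.comp_apply, Equiv.swap_apply_of_ne_of_ne hj.ne (hj.trans hil).ne]]
    rw [Function.comp_apply, Equiv.swap_apply_left, code_column]
  have hself : ∀ i : Fin k, BlockedOff (column hk u) (column hk v) i ↔
        Coded.Blocked n (window u) (window v) i (window v i) := fun i => by
    rw [blockedOff_iff hk u v _ i fun j hj => rfl, code_column]
  constructor
  · rintro ⟨h1, h2, h3⟩
    refine ⟨fun i l hil hl => ?_, fun i l hil hl hs => ?_, fun i hi => ?_⟩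
    · have := h1 ⟨i, hil.trans hl⟩ ⟨l, hl⟩ hil
      rwa [Ne, Letter.eq_iff_code, code_column, code_column] at this
    · refine (hswap ⟨i, hil.trans hl⟩ ⟨l, hl⟩ hil).1 (h2 _ _ hil ?_)
      rwa [Letter.circBetween_iff, code_column, code_column, code_column]
    · exact mt (hself ⟨i, by omega⟩).2 (h3 ⟨i, by omega⟩ hi)
  · rintro ⟨h1, h2, h3⟩
    refine ⟨fun i l hil => ?_, fun i l hil hs => ?_, fun i hi => ?_⟩
    · rw [Ne, Letter.eq_iff_code, code_column, code_column]
      exact h1 i l hil l.2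
    · rw [Letter.circBetween_iff, code_column, code_column, code_column] at hs
      exact (hswap i l hil).2 (h2 i l hil l.2 hs)
    · exact mt (hself i).1 (h3 i hi)

/-- The signed permutation with a given window. -/
theorem exists_signedPerm (g : Fin n → Letter n) (hg : Function.Injective fun i => (g i).abs) :
    ∃ v : SignedPerm n, ∀ i, v.1 (.pos i) = g i := by
  let f : Letter n → Letter n := fun a => match a with
    | .pos i => g i
    | .neg i => (g i).bar
  have hfa : ∀ a, (f a).abs = (g a.abs).abs := by
    intro a
    cases a with
    | pos i => rfl
    | neg i => exact Letter.abs_bar _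
  have hf : Function.Injective f := by
    intro a b hab
    have h1 : a.abs = b.abs := hg ((hfa a).symm.trans ((congrArg Letter.abs hab).trans (hfa b)))
    cases a <;> cases b <;> simp only [Letter.abs] at h1 <;> subst h1
    · rfl
    · exact absurd hab.symm (Letter.bar_ne_self _)
    · exact absurd hab (Letter.bar_ne_self _)
    · rfl
  refine ⟨⟨Equiv.ofBijective f (Finite.injective_iff_bijective.1 hf), ?_⟩, fun i => rfl⟩
  intro a
  cases a with
  | pos i => rfl
  | neg i => exact (Letter.bar_bar (g i)).symm

theorem abs_injective (u : SignedPerm n) : Function.Injective fun i => (u.1 (.pos i)).abs := by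
  intro i j hij
  rcases Letter.eq_of_abs_eq hij with h | h
  · simpa using u.1.injective h
  · rw [← apply_bar] at h
    simpa [Letter.bar] using u.1.injective h

/-- The statement to be proved speaks of columns, the induction of whole windows. Beyond position
`k` the entries of `u` are kept; injectivity holds because `C'` uses only absolute values of the
first `k` entries of `u`. -/
theorem exists_extension {k : ℕ} (hk : k ≤ n) (u : SignedPerm n) (C' : Fin k → Letter n)
    (hinj : Function.Injective fun i => (C' i).abs)
    (himg : ∀ i, ∃ j, (C' i).abs = (column hk u j).abs) :
    ∃ v : SignedPerm n, column hk v = C' ∧ ∀ m, k ≤ m → window v m = window u m := by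
  obtain ⟨v, hv⟩ := exists_signedPerm
    (fun i : Fin n => if h : (i : ℕ) < k then C' ⟨i, h⟩ else u.1 (.pos i)) (by
      intro i j hij
      simp only at hij
      split_ifs at hij with h1 h2 h2
      · have := hinj hij
        simpa [Fin.ext_iff] using this
      · obtain ⟨l, hl⟩ := himg ⟨i, h1⟩
        have := abs_injective u (hl.symm.trans hij)
        rw [← this] at h2
        exact absurd l.2 h2
      · obtain ⟨l, hl⟩ := himg ⟨j, h2⟩
        have := abs_injective u (hij.trans hl)
        rw [this] at h1
        exact absurd l.2 h1
      · exact abs_injective u hij)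
  refine ⟨v, ?_, fun m hm => ?_⟩
  · funext i
    rw [column, hv, dif_pos (by exact i.2)]
    rfl
  · by_cases hmn : m < n
    · rw [window_of_lt v hmn, window_of_lt u hmn, hv, dif_neg (by simpa using hm)]
    · simp [window, hmn]

end TypeB

/-! ### The greedy splitting and its description by counting. -/

namespace TypeB

variable {n : ℕ}

theorem sortColumn_eq_sort_iff {k : ℕ} (C : Fin k → Letter n) (S : Finset (Letter n)) :
    sortColumn C = S.sort (· ≤ ·) ↔ Function.Injective C ∧ Finset.univ.image C = S := by
  have h1 : sortColumn C = S.sort (· ≤ ·) ↔ Finset.univ.val.map C = S.val := by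
    constructor
    · intro h
      have := congrArg (fun l : List (Letter n) => (l : Multiset (Letter n))) h
      simpa only [sortColumn, Multiset.sort_eq, Finset.sort_eq] using this
    · intro h
      simp only [sortColumn, h]
      rfl
  rw [h1]
  constructor
  · intro h
    have hinj : Function.Injective C := by
      have hnd : (Finset.univ.val.map C).Nodup := h ▸ S.nodup
      exact fun a b hab => Multiset.inj_on_of_nodup_map hnd a (Finset.mem_univ_val a) b
        (Finset.mem_univ_val b) hab
    exact ⟨hinj, by rw [Finset.image, h, Finset.val_toFinset]⟩
  · rintro ⟨hinj, rfl⟩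
    exact (Finset.image_val_of_injOn hinj.injOn).symm

section Splitting

variable {r : ℕ} {D : Fin r → KNLetter n}

theorem KNLetter.pos_lt_pos {i j : Fin n} : KNLetter.pos i < KNLetter.pos j ↔ i < j := Iff.rfl

theorem KNLetter.pos_lt_zero (i : Fin n) : KNLetter.pos i < KNLetter.zero := i.2

theorem KNLetter.zero_lt_neg (i : Fin n) : KNLetter.zero < KNLetter.neg i := by
  change n < 2 * n - i
  omega

theorem KNLetter.neg_lt_neg {i j : Fin n} : KNLetter.neg i < KNLetter.neg j ↔ j < i := by
  change 2 * n - (i : ℕ) < 2 * n - j ↔ (j : ℕ) < i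
  omega

/-- The letter `x` and its bar do not occur in `D`. -/
def Absent (D : Fin r → KNLetter n) (x : Fin n) : Prop := ∀ q, D q ≠ .pos x ∧ D q ≠ .neg x

namespace IsSplittingFrom

theorem length_eq : ∀ {m : ℕ} {zs : List (KNLetter n)} {ts : List (Fin n)},
    IsSplittingFrom D m zs ts → ts.length = zs.length
  | _, [], [], _ => rfl
  | _, _ :: _, _ :: _, h => congrArg (· + 1) h.2.length_eq
  | _, [], _ :: _, h => h.elim
  | _, _ :: _, [], h => h.elim

theorem lt_and_absent : ∀ {m : ℕ} {zs : List (KNLetter n)} {ts : List (Fin n)},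
    IsSplittingFrom D m zs ts → ∀ t ∈ ts, (t : ℕ) < m ∧ Absent D t
  | _, [], [], _ => by simp
  | _, _ :: _, _ :: _, h => by
    have h1 : _ ∧ _ := ⟨h.1.1.1, h.1.1.2.2⟩
    rintro t (_ | ⟨_, ht⟩)
    · exact h1
    · have h2 := h.2.lt_and_absent t ht
      exact ⟨h2.1.trans h1.1, h2.2⟩
  | _, [], _ :: _, h => h.elim
  | _, _ :: _, [], h => h.elim

theorem pairwise : ∀ {m : ℕ} {zs : List (KNLetter n)} {ts : List (Fin n)},
    IsSplittingFrom D m zs ts → ts.Pairwise (· > ·)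
  | _, [], [], _ => List.Pairwise.nil
  | _, _ :: _, _ :: _, h =>
    List.pairwise_cons.2 ⟨fun t ht => (h.2.lt_and_absent t ht).1, h.2.pairwise⟩
  | _, [], _ :: _, h => h.elim
  | _, _ :: _, [], h => h.elim

/-- Corresponding letters satisfy `t_i < z_i`, so each `t_i` above `x` comes with a `z_i` above `x`.
-/
theorem countP_le (x : Fin n) : ∀ {m : ℕ} {zs : List (KNLetter n)} {ts : List (Fin n)},
    IsSplittingFrom D m zs ts → ts.countP (x < ·) ≤ zs.countP (KNLetter.pos x < ·)
  | _, [], [], _ => le_rfl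
  | _, z :: zs, t :: ts, h => by
    have h1 := h.2.countP_le x
    have h2 : KNLetter.pos t < z := h.1.1.2.1
    rw [List.countP_cons, List.countP_cons]
    by_cases hx : x < t
    · have h3 : KNLetter.pos x < z := lt_trans (KNLetter.pos_lt_pos.2 hx) h2
      simp only [hx, h3, decide_true, if_true]
      omega
    · simp only [hx, decide_false]
      simp only [Bool.false_eq_true, if_false]
      omega
  | _, [], _ :: _, h => h.elim
  | _, _ :: _, [], h => h.elim

/-- At the first `t_i` below `x` the available letter `x` was not chosen, so `z_i ≤ x`. From there
on no letter of either list is above `x`, and before it all are. -/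
theorem countP_eq {x : Fin n} (hx : Absent D x) :
    ∀ {m : ℕ} {zs : List (KNLetter n)} {ts : List (Fin n)},
    IsSplittingFrom D m zs ts → (x : ℕ) < m → zs.Pairwise (· ≥ ·) → x ∉ ts →
      ts.countP (x < ·) = zs.countP (KNLetter.pos x < ·)
  | _, [], [], _, _, _, _ => rfl
  | m, z :: zs, t :: ts, h, hm, hz, hxt => by
    have h2 : KNLetter.pos t < z := h.1.1.2.1
    rw [List.mem_cons, not_or] at hxt
    rcases lt_or_ge x t with hlt | hge
    · have h3 : KNLetter.pos x < z := lt_trans (KNLetter.pos_lt_pos.2 hlt) h2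
      rw [List.countP_cons, List.countP_cons,
        h.2.countP_eq hx hlt (List.pairwise_cons.1 hz).2 hxt.2]
      simp only [hlt, h3, decide_true, if_true]
    · have hlt : t < x := lt_of_le_of_ne hge (Ne.symm hxt.1)
      have h3 : ¬ KNLetter.pos x < z := fun h3 => absurd (h.1.2 ⟨hm, h3, hx⟩) (not_le.2 hlt)
      have h4 : (t :: ts).countP (x < ·) = 0 := by
        rw [List.countP_eq_zero]
        intro s hs
        have : s ≤ t := by
          rcases List.mem_cons.1 hs with rfl | hs
          · exact le_rfl
          · exact ((List.pairwise_cons.1 h.pairwise).1 s hs).le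
        simpa using this.trans hge
      have h5 : (z :: zs).countP (KNLetter.pos x < ·) = 0 := by
        rw [List.countP_eq_zero]
        intro s hs
        have : s ≤ z := by
          rcases List.mem_cons.1 hs with rfl | hs
          · exact le_rfl
          · exact (List.pairwise_cons.1 hz).1 s hs
        simpa using this.trans (not_lt.1 h3)
      rw [h4, h5]
  | _, [], _ :: _, h, _, _, _ => h.elim
  | _, _ :: _, [], h, _, _, _ => h.elim

/-- The counts determine the greedy choice: if an available letter `y` below `z_1` were larger than
`t_1`, no `t_i` would lie above `y` although `z_1` does. The tails of both lists satisfy the same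
hypotheses. -/
theorem of_countP : ∀ {m : ℕ} {zs : List (KNLetter n)} {ts : List (Fin n)},
    ts.length = zs.length → zs.Pairwise (· ≥ ·) → ts.Pairwise (· > ·) →
    (∀ t ∈ ts, (t : ℕ) < m ∧ Absent D t ∧ KNLetter.pos t ∉ zs) →
    (∀ x ∈ ts, ts.countP (x ≤ ·) ≤ zs.countP (KNLetter.pos x ≤ ·)) →
    (∀ x : Fin n, (x : ℕ) < m → Absent D x → x ∉ ts →
      ts.countP (x < ·) = zs.countP (KNLetter.pos x < ·)) →
    IsSplittingFrom D m zs ts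
  | _, [], [], _, _, _, _, _, _ => trivial
  | m, z :: zs, t :: ts, hlen, hz, ht, hmem, hle, heq => by
    have hz' := List.pairwise_cons.1 hz
    have ht' := List.pairwise_cons.1 ht
    have htm := hmem t List.mem_cons_self
    have htz : KNLetter.pos t < z := by
      have h1 := hle t List.mem_cons_self
      have h2 : 0 < (z :: zs).countP (KNLetter.pos t ≤ ·) := by
        refine lt_of_lt_of_le ?_ h1
        rw [List.countP_pos_iff]
        exact ⟨t, List.mem_cons_self, by simp⟩
      obtain ⟨s, hs, hts⟩ := List.countP_pos_iff.1 h2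
      have hts : KNLetter.pos t ≤ s := by simpa using hts
      have hsz : s ≤ z := by
        rcases List.mem_cons.1 hs with rfl | hs
        · exact le_rfl
        · exact hz'.1 s hs
      refine lt_of_le_of_ne (hts.trans hsz) fun h => htm.2.2 (h ▸ List.mem_cons_self)
    refine ⟨⟨⟨htm.1, htz, htm.2.1⟩, ?_⟩, ?_⟩
    · rintro y ⟨hym, hyz, hyD⟩
      by_contra hyt
      have hyt : t < y := not_le.1 hyt
      have hle' : ∀ s ∈ t :: ts, s < y := by
        intro s hs
        rcases List.mem_cons.1 hs with rfl | hs
        · exact hyt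
        · exact lt_trans (ht'.1 s hs) hyt
      have h1 := heq y hym hyD fun h => lt_irrefl _ (hle' y h)
      have h2 : (t :: ts).countP (y < ·) = 0 := by
        rw [List.countP_eq_zero]
        intro s hs
        simpa using (hle' s hs).le
      rw [h2, eq_comm, List.countP_eq_zero] at h1
      exact h1 z List.mem_cons_self (by simpa using hyz)
    · refine of_countP (by simpa using hlen) hz'.2 ht'.2 (fun s hs => ⟨ht'.1 s hs, ?_, ?_⟩) ?_ ?_
      · exact (hmem s (List.mem_cons_of_mem _ hs)).2.1
      · exact fun h => (hmem s (List.mem_cons_of_mem _ hs)).2.2 (List.mem_cons_of_mem _ h)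
      · intro x hx
        have h1 := hle x (List.mem_cons_of_mem _ hx)
        have h2 : x ≤ t := (ht'.1 x hx).le
        have h3 : KNLetter.pos x ≤ z := (lt_of_le_of_lt (by exact h2) htz).le
        rw [List.countP_cons, List.countP_cons] at h1
        simp only [h2, h3, decide_true, if_true] at h1
        omega
      · intro x hx hxD hxt
        have hxt' : x < t := hx
        have h1 := heq x (hx.trans htm.1) hxD
          (by rw [List.mem_cons, not_or]; exact ⟨hxt'.ne, hxt⟩)
        have h3 : KNLetter.pos x < z := lt_trans (KNLetter.pos_lt_pos.2 hxt') htz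
        rw [List.countP_cons, List.countP_cons] at h1
        simp only [hxt', h3, decide_true, if_true] at h1
        omega
  | _, [], _ :: _, h, _, _, _, _, _ => by simp at h
  | _, _ :: _, [], h, _, _, _, _, _ => by simp at h

end IsSplittingFrom

theorem countP_ofFn {α : Type*} (D : Fin r → α) (f : α → Bool) :
    (List.ofFn D).countP f = (Finset.univ.filter fun q => f (D q) = true).card := by
  have h : f = fun a => decide (f a = true) := by
    funext a
    simp
  conv_lhs => rw [h]
  rw [← Multiset.coe_countP, ← Fin.univ_val_map, Multiset.countP_map, Finset.card_def,
    Finset.filter_val]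

/-- The unbarred letters in `D`. -/
def posLetters (D : Fin r → KNLetter n) : Finset (Fin n) :=
  Finset.univ.filter fun i => ∃ q, D q = .pos i

/-- The absolute values of the barred letters in `D`. -/
def negLetters (D : Fin r → KNLetter n) : Finset (Fin n) :=
  Finset.univ.filter fun i => ∃ q, D q = .neg i

/-- The number of entries `0` of `D`. -/
def zeroCount (D : Fin r → KNLetter n) : ℕ := (Finset.univ.filter fun q => D q = .zero).card

theorem mem_posLetters {i : Fin n} : i ∈ posLetters D ↔ ∃ q, D q = .pos i := by simp [posLetters]

theorem mem_negLetters {i : Fin n} : i ∈ negLetters D ↔ ∃ q, D q = .neg i := by simp [negLetters]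

theorem absent_iff {x : Fin n} : Absent D x ↔ x ∉ posLetters D ∧ x ∉ negLetters D := by
  simp only [Absent, mem_posLetters, mem_negLetters, not_exists, forall_and, ne_eq]

/-- Increasing from top to bottom, except that `0` may be repeated. -/
def IncreasingUpToZero (D : Fin r → KNLetter n) : Prop :=
  ∀ p q : Fin r, p < q → D p < D q ∨ (D p = .zero ∧ D q = .zero)

theorem IncreasingUpToZero.eq_of_eq (hD : IncreasingUpToZero D) {p q : Fin r} (h : D p = D q)
    (h0 : D p ≠ .zero) : p = q := by
  rcases lt_trichotomy p q with h1 | h1 | h1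
  · rcases hD p q h1 with h2 | h2
    · exact absurd h2 (h ▸ lt_irrefl _)
    · exact absurd h2.1 h0
  · exact h1
  · rcases hD q p h1 with h2 | h2
    · exact absurd h2 (h ▸ lt_irrefl _)
    · exact absurd h2.2 h0

theorem IncreasingUpToZero.splitSource_pairwise (hD : IncreasingUpToZero D) :
    (splitSource D).Pairwise (· ≥ ·) := by
  apply List.Pairwise.filter
  rw [List.pairwise_reverse, List.pairwise_ofFn]
  intro p q hpq
  rcases hD p q hpq with h | h
  · exact h.le
  · rw [h.1, h.2]

theorem IncreasingUpToZero.countP_splitSource (hD : IncreasingUpToZero D) (f : KNLetter n → Bool)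
    (hf : f .zero = true) : (splitSource D).countP f =
      zeroCount D + ((posLetters D ∩ negLetters D).filter fun i => f (.pos i) = true).card := by
  have h1 : (splitSource D).countP f = (Finset.univ.filter fun q => f (D q) = true ∧
      (D q = .zero ∨ ∃ i ∈ negLetters D, D q = .pos i)).card := by
    rw [splitSource, List.countP_filter, List.countP_reverse, countP_ofFn]
    congr 1
    apply Finset.filter_congr
    intro q _
    rcases hq : D q with i | _ | i <;> simp [mem_negLetters]
  rw [h1]
  have h2 : (Finset.univ.filter fun q => f (D q) = true ∧
      (D q = .zero ∨ ∃ i ∈ negLetters D, D q = .pos i)) =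
      (Finset.univ.filter fun q => D q = .zero) ∪
        Finset.univ.filter fun q => f (D q) = true ∧ ∃ i ∈ negLetters D, D q = .pos i := by
    ext q
    simp only [Finset.mem_filter, Finset.mem_univ, true_and, Finset.mem_union]
    constructor
    · rintro ⟨h3, h4 | h4⟩
      · exact Or.inl h4
      · exact Or.inr ⟨h3, h4⟩
    · rintro (h3 | h3)
      · exact ⟨h3 ▸ hf, Or.inl h3⟩
      · exact ⟨h3.1, Or.inr h3.2⟩
  rw [h2, Finset.card_union_of_disjoint, zeroCount]
  · congr 1
    have h3 : (Finset.univ.filter fun q => f (D q) = true ∧ ∃ i ∈ negLetters D,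
        D q = .pos i).image D = ((posLetters D ∩ negLetters D).filter
          fun i => f (.pos i) = true).image .pos := by
      ext z
      simp only [Finset.mem_image, Finset.mem_filter, Finset.mem_univ, true_and, Finset.mem_inter]
      constructor
      · rintro ⟨q, ⟨h3, i, hi, h4⟩, rfl⟩
        exact ⟨i, ⟨⟨mem_posLetters.2 ⟨q, h4⟩, hi⟩, h4 ▸ h3⟩, h4.symm⟩
      · rintro ⟨i, ⟨⟨h3, h4⟩, h5⟩, rfl⟩
        obtain ⟨q, hq⟩ := mem_posLetters.1 h3
        exact ⟨q, ⟨hq ▸ h5, i, h4, hq⟩, hq⟩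
    have h4 := congrArg Finset.card h3
    rw [Finset.card_image_of_injective _ (fun i j h => KNLetter.pos.inj h),
      Finset.card_image_of_injOn] at h4
    · exact h4
    intro p hp q _ hpq
    obtain ⟨_, i, _, h4⟩ := (Finset.mem_filter.1 hp).2
    exact hD.eq_of_eq hpq (by rw [h4]; simp)
  · rw [Finset.disjoint_left]
    intro q h3 h4
    simp only [Finset.mem_filter, Finset.mem_univ, true_and] at h3 h4
    obtain ⟨_, i, _, h5⟩ := h4
    rw [h3] at h5
    simp at h5

end Splitting

end TypeB

/-! ### Letter counts in extended split columns. -/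

namespace TypeB

variable {n : ℕ}

/-- The number of elements of `F` which have fewer than `m` elements of `F` below them. -/
theorem card_filter_rank_lt {α : Type*} [LinearOrder α] (F : Finset α) (m : ℕ) :
    (F.filter fun i => (F.filter fun j => j < i).card < m).card = min F.card m := by
  have hmono : ∀ i ∈ F, ∀ j, i < j →
      (F.filter fun l => l < i).card < (F.filter fun l => l < j).card := by
    intro i hi j hij
    apply Finset.card_lt_card
    rw [Finset.ssubset_iff_of_subset
      (Finset.monotone_filter_right F fun l _ hl => lt_trans hl hij)]
    exact ⟨i, by simp [hi, hij], by simp⟩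
  have hinj : Set.InjOn (fun i => (F.filter fun j => j < i).card) F := by
    intro i hi j hj hij
    rcases lt_trichotomy i j with h | h | h
    · exact absurd hij (hmono i hi j h).ne
    · exact h
    · exact absurd hij (hmono j hj i h).ne'
  have himg : F.image (fun i => (F.filter fun j => j < i).card) = Finset.range F.card := by
    apply Finset.eq_of_subset_of_card_le
    · intro x hx
      obtain ⟨i, hi, rfl⟩ := Finset.mem_image.1 hx
      rw [Finset.mem_range]
      apply Finset.card_lt_card
      rw [Finset.ssubset_iff_of_subset (Finset.filter_subset _ _)]
      exact ⟨i, hi, by simp⟩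
    · rw [Finset.card_image_of_injOn hinj, Finset.card_range]
  rw [← Finset.card_image_of_injOn (hinj.mono (Finset.coe_subset.2 (Finset.filter_subset _ F)))]
  have h := Finset.filter_image (s := F) (f := fun i => (F.filter fun j => j < i).card)
    (p := fun x => x < m)
  rw [← h, himg]
  have h2 : (Finset.range F.card).filter (fun x => x < m) = Finset.range (min F.card m) := by
    ext x
    simp
  rw [h2, Finset.card_range]

/-- The number of unbarred letters up to `x` in `L`, minus the same number for `R`. -/
def letterDiff (L R : Finset (Letter n)) (x : Fin n) : ℤ :=
  ((Finset.univ.filter fun i => Letter.pos i ∈ L ∧ i ≤ x).card : ℤ) -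
    (Finset.univ.filter fun i => Letter.pos i ∈ R ∧ i ≤ x).card

section Split

variable {r : ℕ} {D : Fin r → KNLetter n} {t : List (Fin n)}

theorem pos_mem_leftEntries {i : Fin n} :
    .pos i ∈ leftEntries D t ↔ (i ∈ posLetters D ∧ i ∉ negLetters D) ∨ i ∈ t := by
  simp [leftEntries, mem_posLetters, mem_negLetters]

theorem neg_mem_leftEntries {i : Fin n} : .neg i ∈ leftEntries D t ↔ i ∈ negLetters D := by
  simp [leftEntries, mem_negLetters]

theorem pos_mem_rightEntries {i : Fin n} : .pos i ∈ rightEntries D t ↔ i ∈ posLetters D := by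
  simp [rightEntries, mem_posLetters]

theorem neg_mem_rightEntries {i : Fin n} :
    .neg i ∈ rightEntries D t ↔ (i ∈ negLetters D ∧ i ∉ posLetters D) ∨ i ∈ t := by
  simp [rightEntries, mem_posLetters, mem_negLetters]

theorem mem_freeLetters_iff {L R : Finset (Letter n)} {i : Fin n} :
    i ∈ freeLetters L R ↔ .pos i ∉ L ∧ .neg i ∉ L ∧ .pos i ∉ R ∧ .neg i ∉ R := by
  simp only [freeLetters, Finset.mem_filter, Finset.mem_univ, true_and, Finset.mem_union]
  constructor
  · intro h
    exact ⟨fun h' => h _ (Or.inl h') rfl, fun h' => h _ (Or.inl h') rfl,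
      fun h' => h _ (Or.inr h') rfl, fun h' => h _ (Or.inr h') rfl⟩
  · rintro ⟨h1, h2, h3, h4⟩ a ha rfl
    cases a <;> simp_all [Letter.abs]

theorem mem_freeLetters {i : Fin n} : i ∈ freeLetters (leftEntries D t) (rightEntries D t) ↔
    i ∉ posLetters D ∧ i ∉ negLetters D ∧ i ∉ t := by
  rw [mem_freeLetters_iff, pos_mem_leftEntries, neg_mem_leftEntries, pos_mem_rightEntries,
    neg_mem_rightEntries]
  tauto

theorem card_le_add_countP (t : List (Fin n)) (ht : t.Nodup) (x : Fin n) :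
    (t.toFinset.filter fun i => i ≤ x).card + t.countP (x < ·) = t.length := by
  rw [← List.toFinset_card_of_nodup ht,
    ← Finset.card_filter_add_card_filter_not (s := t.toFinset) (fun i => i ≤ x)]
  congr 1
  rw [List.countP_eq_length_filter, ← List.toFinset_card_of_nodup (ht.filter _)]
  refine congrArg Finset.card ?_
  ext i
  simp

theorem splitSource_count (hD : IncreasingUpToZero D) (x : Fin n) :
    ((posLetters D ∩ negLetters D).filter fun i => i ≤ x).card +
      (splitSource D).countP (KNLetter.pos x < ·) = (splitSource D).length := by
  have h1 := hD.countP_splitSource (KNLetter.pos x < ·) (by simpa using KNLetter.pos_lt_zero x)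
  have h2 := hD.countP_splitSource (fun _ => true) rfl
  rw [List.countP_true] at h2
  rw [h1, h2, ← Finset.card_filter_add_card_filter_not (s := (posLetters D ∩ negLetters D).filter
    fun i => true = true) (fun i => i ≤ x)]
  simp only [Finset.filter_true, not_le, decide_eq_true_eq, KNLetter.pos_lt_pos]
  omega

theorem IsSplitting.nodup (ht : IsSplitting D t) : t.Nodup :=
  (IsSplittingFrom.pairwise ht).imp fun h => ne_of_gt h

/-- The two lists have the same length, so counts above `x` turn into counts up to `x`; the zeros
lie above every `x`. -/
theorem IsSplitting.card_le (ht : IsSplitting D t) (hD : IncreasingUpToZero D) (x : Fin n) :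
    ((posLetters D ∩ negLetters D).filter fun i => i ≤ x).card ≤
      (t.toFinset.filter fun i => i ≤ x).card := by
  have h1 := card_le_add_countP t ht.nodup x
  have h2 := splitSource_count hD x
  have h3 := IsSplittingFrom.countP_le x ht
  have h4 := IsSplittingFrom.length_eq ht
  omega

theorem IsSplitting.card_eq (ht : IsSplitting D t) (hD : IncreasingUpToZero D) {x : Fin n}
    (hx : Absent D x) (hxt : x ∉ t) :
    (t.toFinset.filter fun i => i ≤ x).card =
      ((posLetters D ∩ negLetters D).filter fun i => i ≤ x).card := by
  have h1 := card_le_add_countP t ht.nodup x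
  have h2 := splitSource_count hD x
  have h3 := IsSplittingFrom.countP_eq hx ht x.2 hD.splitSource_pairwise hxt
  have h4 := IsSplittingFrom.length_eq ht
  omega

theorem mem_extLetters_free {L R : Finset (Letter n)} {m : ℕ} {i : Fin n}
    (h : i ∈ extLetters L R m) : i ∈ freeLetters L R := (Finset.mem_filter.1 h).1

/-- The letters occurring only unbarred are common to both sides. On the left the letters of `t` are
added; on the right the letters occurring with their bars and the appended ones are. -/
theorem letterDiff_split (ht : IsSplitting D t) (m : ℕ) (x : Fin n) :
    letterDiff
      (leftEntries D t ∪ (extLetters (leftEntries D t) (rightEntries D t) m).image .neg)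
      (rightEntries D t ∪ (extLetters (leftEntries D t) (rightEntries D t) m).image .pos) x =
    ((t.toFinset.filter fun i => i ≤ x).card : ℤ) -
      ((posLetters D ∩ negLetters D).filter fun i => i ≤ x).card -
      ((extLetters (leftEntries D t) (rightEntries D t) m).filter fun i => i ≤ x).card := by
  set E := extLetters (leftEntries D t) (rightEntries D t) m with hE
  have hEfree : ∀ i ∈ E, i ∉ posLetters D ∧ i ∉ negLetters D ∧ i ∉ t := fun i hi =>
    mem_freeLetters.1 (mem_extLetters_free hi)
  have htD : ∀ i ∈ t, i ∉ posLetters D ∧ i ∉ negLetters D := fun i hi =>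
    absent_iff.1 (IsSplittingFrom.lt_and_absent ht i hi).2
  have h1 : (Finset.univ.filter fun i => Letter.pos i ∈ leftEntries D t ∪ E.image .neg ∧ i ≤ x) =
      ((posLetters D \ negLetters D).filter fun i => i ≤ x) ∪
        t.toFinset.filter fun i => i ≤ x := by
    ext i
    simp only [Finset.mem_filter, Finset.mem_univ, true_and, Finset.mem_union, pos_mem_leftEntries,
      Finset.mem_image, reduceCtorEq, and_false, exists_false, or_false, Finset.mem_sdiff,
      List.mem_toFinset]
    tauto
  have h2 : (Finset.univ.filter fun i => Letter.pos i ∈ rightEntries D t ∪ E.image .pos ∧ i ≤ x) =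
      (((posLetters D \ negLetters D).filter fun i => i ≤ x) ∪
        (posLetters D ∩ negLetters D).filter fun i => i ≤ x) ∪ E.filter fun i => i ≤ x := by
    ext i
    simp only [Finset.mem_filter, Finset.mem_univ, true_and, Finset.mem_union, pos_mem_rightEntries,
      Finset.mem_image, Letter.pos.injEq, exists_eq_right, Finset.mem_sdiff, Finset.mem_inter]
    tauto
  rw [letterDiff, h1, h2, Finset.card_union_of_disjoint, Finset.card_union_of_disjoint,
    Finset.card_union_of_disjoint]
  · push_cast
    ring
  · rw [Finset.disjoint_left]
    intro i h3 h4
    simp only [Finset.mem_filter, Finset.mem_sdiff, Finset.mem_inter] at h3 h4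
    tauto
  · rw [Finset.disjoint_left]
    intro i h3 h4
    simp only [Finset.mem_filter, Finset.mem_sdiff, Finset.mem_inter, Finset.mem_union] at h3 h4
    have := hEfree i h4.1
    tauto
  · rw [Finset.disjoint_left]
    intro i h3 h4
    simp only [Finset.mem_filter, Finset.mem_sdiff, List.mem_toFinset] at h3 h4
    have := htD i h4.1
    tauto

theorem neg_le_letterDiff (hD : IncreasingUpToZero D) (ht : IsSplitting D t) (m : ℕ) (x : Fin n) :
    -(m : ℤ) ≤ letterDiff
      (leftEntries D t ∪ (extLetters (leftEntries D t) (rightEntries D t) m).image .neg)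
      (rightEntries D t ∪ (extLetters (leftEntries D t) (rightEntries D t) m).image .pos) x := by
  rw [letterDiff_split ht]
  have h1 := ht.card_le hD x
  have h2 := card_filter_rank_lt (freeLetters (leftEntries D t) (rightEntries D t)) m
  have h3 := Finset.card_le_card (Finset.filter_subset (fun i => i ≤ x)
    (extLetters (leftEntries D t) (rightEntries D t) m))
  change (extLetters (leftEntries D t) (rightEntries D t) m).card = _ at h2
  omega

/-- A free letter that is not appended lies above all `m` appended ones, and below it the letters of
`t` balance the split ones by `card_eq`. -/
theorem letterDiff_of_free (hD : IncreasingUpToZero D) (ht : IsSplitting D t) (m : ℕ) {x : Fin n}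
    (hx : x ∈ freeLetters (leftEntries D t) (rightEntries D t))
    (hxE : x ∉ extLetters (leftEntries D t) (rightEntries D t) m) :
    letterDiff
      (leftEntries D t ∪ (extLetters (leftEntries D t) (rightEntries D t) m).image .neg)
      (rightEntries D t ∪ (extLetters (leftEntries D t) (rightEntries D t) m).image .pos) x =
      -(m : ℤ) := by
  rw [letterDiff_split ht]
  have hx' := mem_freeLetters.1 hx
  rw [ht.card_eq hD (absent_iff.2 ⟨hx'.1, hx'.2.1⟩) hx'.2.2]
  have h2 := card_filter_rank_lt (freeLetters (leftEntries D t) (rightEntries D t)) m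
  change (extLetters (leftEntries D t) (rightEntries D t) m).card = _ at h2
  have h3 : ¬ ((freeLetters (leftEntries D t) (rightEntries D t)).filter
      fun j => j < x).card < m := fun h => hxE (Finset.mem_filter.2 ⟨hx, h⟩)
  have h4 : (extLetters (leftEntries D t) (rightEntries D t) m).filter (fun i => i ≤ x) =
      extLetters (leftEntries D t) (rightEntries D t) m := by
    apply Finset.filter_true_of_mem
    intro i hi
    by_contra hxi
    have h5 := (Finset.mem_filter.1 hi).2
    have h6 := Finset.card_le_card (Finset.monotone_filter_right
      (freeLetters (leftEntries D t) (rightEntries D t))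
      (p := fun j => j < x) (q := fun j => j < i) fun j _ hj => lt_trans hj (not_le.1 hxi))
    omega
  have h5 := Finset.card_le_card (Finset.filter_subset (fun j => j < x)
    (freeLetters (leftEntries D t) (rightEntries D t)))
  rw [h4, h2, min_eq_right (by omega)]
  ring

/-! ### Constructing a column -/

/-- The boxes from the top down to `j` contain distinct unbarred letters up to `j`, and those from
its bar down to the bottom contain bars of such letters, so box numbers are bounded by counts. -/
theorem IncreasingUpToZero.isKNColumn (hD : IncreasingUpToZero D)
    (h : ∀ j ∈ posLetters D ∩ negLetters D, ((posLetters D).filter fun i => i ≤ j).card +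
      ((negLetters D).filter fun i => i ≤ j).card ≤ (j : ℕ) + 1) : IsKNColumn D := by
  refine ⟨hD, fun p q j hp hq => le_trans ?_ (h j (Finset.mem_inter.2
    ⟨mem_posLetters.2 ⟨p, hp⟩, mem_negLetters.2 ⟨q, hq⟩⟩))⟩
  apply add_le_add
  · have h1 : (Finset.Iic p).image D ⊆ ((posLetters D).filter fun i => i ≤ j).image .pos := by
      intro z hz
      obtain ⟨l, hl, rfl⟩ := Finset.mem_image.1 hz
      have hl : l ≤ p := Finset.mem_Iic.1 hl
      have h2 : D l ≤ .pos j := by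
        rcases eq_or_lt_of_le hl with rfl | hl
        · exact hp.le
        · rcases hD l p hl with h2 | h2
          · exact hp ▸ h2.le
          · rw [hp] at h2
            simp at h2
      rcases hDl : D l with i | _ | i
      · rw [hDl] at h2
        exact Finset.mem_image.2 ⟨i, Finset.mem_filter.2 ⟨mem_posLetters.2 ⟨l, hDl⟩, h2⟩, rfl⟩
      · rw [hDl] at h2
        exact absurd h2 (not_le.2 (KNLetter.pos_lt_zero j))
      · rw [hDl] at h2
        exact absurd h2 (not_le.2 ((KNLetter.pos_lt_zero j).trans (KNLetter.zero_lt_neg i)))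
    have h2 := Finset.card_le_card h1
    rw [Finset.card_image_of_injective _ (fun i j h => KNLetter.pos.inj h),
      Finset.card_image_of_injOn, Fin.card_Iic] at h2
    · exact h2
    · intro a ha b _ hab
      refine hD.eq_of_eq hab fun h3 => ?_
      have h4 := h1 (Finset.mem_image_of_mem D ha)
      rw [h3] at h4
      simp at h4
  · have h1 : (Finset.Ici q).image D ⊆ ((negLetters D).filter fun i => i ≤ j).image .neg := by
      intro z hz
      obtain ⟨l, hl, rfl⟩ := Finset.mem_image.1 hz
      have hl : q ≤ l := Finset.mem_Ici.1 hl
      have h2 : .neg j ≤ D l := by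
        rcases eq_or_lt_of_le hl with rfl | hl
        · exact hq.ge
        · rcases hD q l hl with h2 | h2
          · exact hq ▸ h2.le
          · rw [hq] at h2
            simp at h2
      rcases hDl : D l with i | _ | i
      · rw [hDl] at h2
        exact absurd h2 (not_le.2 ((KNLetter.pos_lt_zero i).trans (KNLetter.zero_lt_neg j)))
      · rw [hDl] at h2
        exact absurd h2 (not_le.2 (KNLetter.zero_lt_neg j))
      · rw [hDl] at h2
        refine Finset.mem_image.2 ⟨i, Finset.mem_filter.2 ⟨mem_negLetters.2 ⟨l, hDl⟩, ?_⟩, rfl⟩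
        by_contra h3
        exact absurd h2 (not_le.2 (KNLetter.neg_lt_neg.2 (not_le.1 h3)))
    have h2 := Finset.card_le_card h1
    rw [Finset.card_image_of_injective _ (fun i j h => KNLetter.neg.inj h),
      Finset.card_image_of_injOn, Fin.card_Ici] at h2
    · exact h2
    · intro a ha b _ hab
      refine hD.eq_of_eq hab fun h3 => ?_
      have h4 := h1 (Finset.mem_image_of_mem D ha)
      rw [h3] at h4
      simp at h4

/-- The increasing column with given letters. -/
theorem exists_increasing (P N : Finset (Fin n)) (z : ℕ) :
    ∃ r, r = P.card + z + N.card ∧ ∃ D : Fin r → KNLetter n, IncreasingUpToZero D ∧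
      posLetters D = P ∧ negLetters D = N ∧ zeroCount D = z := by
  let l : List (KNLetter n) := (P.sort (· ≤ ·)).map .pos ++ List.replicate z .zero ++
    (N.sort (· ≤ ·)).reverse.map .neg
  have hmem : ∀ a, (∃ q, l.get q = a) ↔ a ∈ l := fun a => List.mem_iff_get.symm
  refine ⟨l.length, by simp [l, add_assoc], l.get, ?_, ?_, ?_, ?_⟩
  · have h : l.Pairwise fun a b => a < b ∨ (a = .zero ∧ b = .zero) := by
      rw [List.pairwise_append, List.pairwise_append]
      refine ⟨⟨?_, ?_, ?_⟩, ?_, ?_⟩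
      · rw [List.pairwise_map]
        exact (Finset.sortedLT_sort P).pairwise.imp fun h => Or.inl h
      · rw [List.pairwise_replicate]
        exact Or.inr (Or.inr ⟨rfl, rfl⟩)
      · intro a ha b hb
        obtain ⟨i, _, rfl⟩ := List.mem_map.1 ha
        rw [List.eq_of_mem_replicate hb]
        exact Or.inl (KNLetter.pos_lt_zero i)
      · rw [List.pairwise_map, List.pairwise_reverse]
        exact (Finset.sortedLT_sort N).pairwise.imp fun h => Or.inl (KNLetter.neg_lt_neg.2 h)
      · intro a ha b hb
        obtain ⟨j, _, rfl⟩ := List.mem_map.1 hb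
        rcases List.mem_append.1 ha with ha | ha
        · obtain ⟨i, _, rfl⟩ := List.mem_map.1 ha
          exact Or.inl ((KNLetter.pos_lt_zero i).trans (KNLetter.zero_lt_neg j))
        · rw [List.eq_of_mem_replicate ha]
          exact Or.inl (KNLetter.zero_lt_neg j)
    intro p q hpq
    exact List.pairwise_iff_get.1 h p q hpq
  · ext i
    rw [mem_posLetters, hmem]
    simp [l]
  · ext i
    rw [mem_negLetters, hmem]
    simp [l]
  · have h := countP_ofFn l.get (fun a => decide (a = .zero))
    rw [List.ofFn_get] at h
    simp only [decide_eq_true_eq] at h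
    rw [zeroCount, ← h]
    simp [l, List.countP_append, List.countP_map, Function.comp_def, List.countP_replicate]

end Split

end TypeB

/-! ### Reconstructing the column from the running minimum. -/

namespace TypeB

variable {n : ℕ}

/-- The number of elements of `F` below `x`. -/
def countBelow (F : Finset (Fin n)) (x : ℕ) : ℕ := (F.filter fun i : Fin n => (i : ℕ) < x).card

theorem countBelow_succ (F : Finset (Fin n)) (i : Fin n) :
    countBelow F (i + 1) = countBelow F i + if i ∈ F then 1 else 0 := by
  unfold countBelow
  split_ifs with h
  · rw [← Finset.card_insert_of_notMem (s := F.filter fun j : Fin n => (j : ℕ) < i) (a := i) (by simp)]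
    congr 1
    ext j
    simp only [Finset.mem_filter, Finset.mem_insert, Fin.ext_iff]
    constructor
    · intro hj
      by_cases hji : (j : ℕ) = i
      · exact Or.inl hji
      · exact Or.inr ⟨hj.1, by omega⟩
    · rintro (hj | hj)
      · have : j = i := Fin.ext hj
        subst this
        exact ⟨h, by omega⟩
      · exact ⟨hj.1, by omega⟩
  · rw [add_zero]
    congr 1
    apply Finset.filter_congr
    intro j hj
    have : (j : ℕ) ≠ i := fun h' => h ((Fin.ext h' : j = i) ▸ hj)
    omega

theorem countBelow_eq_card (F : Finset (Fin n)) {x : ℕ} (hx : n ≤ x) : countBelow F x = F.card := by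
  unfold countBelow
  rw [Finset.filter_true_of_mem fun i _ => by omega]

theorem card_filter_le_eq (F : Finset (Fin n)) (x : Fin n) :
    (F.filter fun i => i ≤ x).card = countBelow F (x + 1) := by
  unfold countBelow
  congr 1
  apply Finset.filter_congr
  intro i _
  rw [Fin.le_def]
  omega

theorem countBelow_sdiff {E F : Finset (Fin n)} (h : E ⊆ F) (x : ℕ) :
    countBelow (F \ E) x + countBelow E x = countBelow F x := by
  unfold countBelow
  rw [← Finset.card_union_of_disjoint]
  · congr 1
    ext i
    have := @h i
    simp only [Finset.mem_union, Finset.mem_filter, Finset.mem_sdiff]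
    tauto
  · rw [Finset.disjoint_left]
    intro i h1 h2
    simp only [Finset.mem_filter, Finset.mem_sdiff] at h1 h2
    exact h1.1.2 h2.1

theorem countBelow_union {E F : Finset (Fin n)} (h : Disjoint E F) (x : ℕ) :
    countBelow (E ∪ F) x = countBelow E x + countBelow F x := by
  unfold countBelow
  rw [Finset.filter_union, Finset.card_union_of_disjoint (Finset.disjoint_filter_filter h)]

/-- The surplus of elements of `T` over elements of `N` below `x`. -/
def surplus (T N : Finset (Fin n)) (x : ℕ) : ℤ := countBelow T x - countBelow N x

theorem surplus_succ (T N : Finset (Fin n)) (i : Fin n) :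
    surplus T N (i + 1) = surplus T N i + (if i ∈ T then 1 else 0) - if i ∈ N then 1 else 0 := by
  unfold surplus
  rw [countBelow_succ, countBelow_succ]
  push_cast
  ring

/-- There is a set of elements of `N` which counts down the running minimum of the surplus. -/
theorem exists_records (T N : Finset (Fin n)) : ∃ E ⊆ N,
    (∀ x ≤ n, (∀ y ≤ x, -(countBelow E x : ℤ) ≤ surplus T N y) ∧
      ∃ y ≤ x, surplus T N y = -(countBelow E x : ℤ)) ∧
    ∀ i ∈ E, surplus T N (i + 1) = -(countBelow E (i + 1) : ℤ) := by
  classical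
  -- `E` collects the positions at which the surplus reaches a strict new minimum. As it starts at 0
  -- and falls by at most one each time, their number is minus the running minimum.
  let E : Finset (Fin n) := N.filter fun i => ∀ y ≤ (i : ℕ), surplus T N (i + 1) < surplus T N y
  have hmain : ∀ x ≤ n, (∀ y ≤ x, -(countBelow E x : ℤ) ≤ surplus T N y) ∧
      ∃ y ≤ x, surplus T N y = -(countBelow E x : ℤ) := by
    intro x
    induction x with
    | zero =>
      intro _
      refine ⟨fun y hy => ?_, 0, le_rfl, ?_⟩
      · obtain rfl : y = 0 := by omega
        simp [surplus, countBelow]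
      · simp [surplus, countBelow]
    | succ x ih =>
      intro hx
      obtain ⟨h1, y₀, hy₀, h2⟩ := ih (by omega)
      let i : Fin n := ⟨x, hx⟩
      have h3 := countBelow_succ E i
      have h4 := surplus_succ T N i
      change countBelow E (x + 1) = countBelow E x + _ at h3
      change surplus T N (x + 1) = surplus T N x + _ - _ at h4
      by_cases hE : i ∈ E
      · rw [if_pos hE] at h3
        have h5 : ∀ y ≤ x, surplus T N (x + 1) < surplus T N y := (Finset.mem_filter.1 hE).2
        have h6 := h5 y₀ hy₀
        have h7 := h1 x le_rfl
        have h8 : surplus T N (x + 1) = -(countBelow E (x + 1) : ℤ) := by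
          split_ifs at h4 <;> omega
        refine ⟨fun y hy => ?_, x + 1, le_rfl, h8⟩
        rcases Nat.le_add_one_iff.1 hy with hy | rfl
        · have := h5 y hy
          omega
        · exact h8.ge
      · rw [if_neg hE, add_zero] at h3
        rw [h3]
        refine ⟨fun y hy => ?_, y₀, by omega, h2⟩
        rcases Nat.le_add_one_iff.1 hy with hy | rfl
        · exact h1 y hy
        · by_cases hN : i ∈ N
          · have h5 : ¬ ∀ y ≤ x, surplus T N (x + 1) < surplus T N y := fun h =>
              hE (Finset.mem_filter.2 ⟨hN, h⟩)
            push Not at h5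
            obtain ⟨y, hy, h6⟩ := h5
            exact (h1 y hy).trans h6
          · rw [if_neg hN] at h4
            have := h1 x le_rfl
            split_ifs at h4 <;> omega
  refine ⟨E, Finset.filter_subset _ _, hmain, fun i hi => ?_⟩
  obtain ⟨h1, y₀, hy₀, h2⟩ := hmain (i + 1) i.2
  have h3 := (Finset.mem_filter.1 hi).2
  rcases Nat.le_add_one_iff.1 hy₀ with hy | rfl
  · have := h3 y₀ hy
    have := h1 (i + 1) le_rfl
    omega
  · exact h2

theorem filter_rank_lt_eq {α : Type*} [LinearOrder α] {E F : Finset α} (hEF : E ⊆ F)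
    (h : ∀ e ∈ E, ∀ x ∈ F, x ∉ E → e < x) :
    (F.filter fun i => (F.filter fun j => j < i).card < E.card) = E := by
  ext i
  rw [Finset.mem_filter]
  constructor
  · rintro ⟨hi, hc⟩
    by_contra hiE
    have : E ⊆ F.filter fun j => j < i := fun e he =>
      Finset.mem_filter.2 ⟨hEF he, h e he i hi hiE⟩
    exact absurd (Finset.card_le_card this) (by omega)
  · intro hi
    refine ⟨hEF hi, Finset.card_lt_card ?_⟩
    rw [Finset.ssubset_iff_of_subset]
    · exact ⟨i, hi, by simp⟩
    · intro j hj
      obtain ⟨hj, hji⟩ := Finset.mem_filter.1 hj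
      by_contra hjE
      exact absurd hji (not_lt.2 (h i hi j hj hjE).le)

/-- The `i` for which `i` belongs to `S`. -/
def posPart (S : Finset (Letter n)) : Finset (Fin n) := Finset.univ.filter fun i => .pos i ∈ S

/-- The `i` for which `ī` belongs to `S`. -/
def negPart (S : Finset (Letter n)) : Finset (Fin n) := Finset.univ.filter fun i => .neg i ∈ S

theorem mem_posPart {S : Finset (Letter n)} {i : Fin n} : i ∈ posPart S ↔ .pos i ∈ S := by
  simp [posPart]

theorem mem_negPart {S : Finset (Letter n)} {i : Fin n} : i ∈ negPart S ↔ .neg i ∈ S := by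
  simp [negPart]

theorem card_posPart_add_card_negPart (S : Finset (Letter n)) :
    (posPart S).card + (negPart S).card = S.card := by
  rw [← Finset.card_image_of_injective (posPart S) (fun i j h => Letter.pos.inj h),
    ← Finset.card_image_of_injective (negPart S) (fun i j h => Letter.neg.inj h),
    ← Finset.card_union_of_disjoint]
  · congr 1
    ext a
    cases a <;> simp [mem_posPart, mem_negPart]
  · rw [Finset.disjoint_left]
    intro a ha hb
    obtain ⟨i, _, rfl⟩ := Finset.mem_image.1 ha
    simp at hb

theorem letterDiff_eq (L R : Finset (Letter n)) (x : Fin n) :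
    letterDiff L R x = (countBelow (posPart L) (x + 1) : ℤ) - countBelow (posPart R) (x + 1) := by
  rw [letterDiff, ← card_filter_le_eq, ← card_filter_le_eq]
  congr 3 <;> (ext i; simp [mem_posPart])

section Entries

variable {L R : Finset (Letter n)} {E : Finset (Fin n)} {r : ℕ} {D : Fin r → KNLetter n}
  {t : List (Fin n)}

theorem eq_leftEntries_union (hL : ∀ i, i ∈ posPart L → i ∉ negPart L)
    (hA : ∀ i, i ∈ posPart L ∨ i ∈ negPart L ↔ i ∈ posPart R ∨ i ∈ negPart R)
    (hE : ∀ i ∈ E, i ∈ negPart L ∧ i ∈ posPart R) (hP : posLetters D = posPart R \ E)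
    (hN : negLetters D = negPart L \ E) (ht : ∀ i, i ∈ t ↔ i ∈ posPart L ∧ i ∈ negPart R) :
    L = leftEntries D t ∪ E.image .neg := by
  ext a
  rcases a with i | i
  · have h3 := hA i
    have h4 := hL i
    have h5 := hE i
    rw [← mem_posPart, Finset.mem_union, pos_mem_leftEntries, hP, hN, Finset.mem_sdiff,
      Finset.mem_sdiff, ht]
    simp only [Finset.mem_image, reduceCtorEq, and_false, exists_false, or_false]
    tauto
  · have h5 := hE i
    rw [← mem_negPart, Finset.mem_union, neg_mem_leftEntries, hN, Finset.mem_sdiff]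
    simp only [Finset.mem_image, Letter.neg.injEq, exists_eq_right]
    tauto

theorem eq_rightEntries_union (hR : ∀ i, i ∈ posPart R → i ∉ negPart R)
    (hA : ∀ i, i ∈ posPart L ∨ i ∈ negPart L ↔ i ∈ posPart R ∨ i ∈ negPart R)
    (hE : ∀ i ∈ E, i ∈ negPart L ∧ i ∈ posPart R) (hP : posLetters D = posPart R \ E)
    (hN : negLetters D = negPart L \ E) (ht : ∀ i, i ∈ t ↔ i ∈ posPart L ∧ i ∈ negPart R) :
    R = rightEntries D t ∪ E.image .pos := by
  ext a
  rcases a with i | i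
  · have h5 := hE i
    rw [← mem_posPart, Finset.mem_union, pos_mem_rightEntries, hP, Finset.mem_sdiff]
    simp only [Finset.mem_image, Letter.pos.injEq, exists_eq_right]
    tauto
  · have h3 := hA i
    have h4 := hR i
    have h5 := hE i
    rw [← mem_negPart, Finset.mem_union, neg_mem_rightEntries, hP, hN, Finset.mem_sdiff,
      Finset.mem_sdiff, ht]
    simp only [Finset.mem_image, reduceCtorEq, and_false, exists_false, or_false]
    tauto

end Entries

set_option maxHeartbeats 1000000 in
/-- A pair of sets of letters which satisfies the counting condition consists of the extended split
columns of a KN column. -/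
theorem exists_split {L R : Finset (Letter n)} (hL : Disjoint (posPart L) (negPart L))
    (hR : Disjoint (posPart R) (negPart R)) (hA : posPart L ∪ negPart L = posPart R ∪ negPart R)
    {d : ℤ} (hd : Even d) (hd0 : d ≤ 0) (hmin : ∀ x, d ≤ letterDiff L R x)
    (hun : ∀ a ∉ posPart L ∪ negPart L, letterDiff L R a = d)
    (hex : ∃ a, a ∉ posPart L ∪ negPart L) :
    ∃ r ≤ L.card, Even (L.card - r) ∧ ∃ D : Fin r → KNLetter n, IsKNColumn D ∧
      ∃ t, IsSplitting D t ∧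
      L = (leftEntries D t ∪
        (extLetters (leftEntries D t) (rightEntries D t) (L.card - r)).image .neg) ∧
      R = (rightEntries D t ∪
        (extLetters (leftEntries D t) (rightEntries D t) (L.card - r)).image .pos) := by
  classical
  set Lp := posPart L with hLp
  set Ln := negPart L with hLn
  set Rp := posPart R with hRp
  set Rn := negPart R with hRn
  have hL' : ∀ i, i ∈ Lp → i ∉ Ln := fun i h1 h2 => Finset.disjoint_left.1 hL h1 h2
  have hR' : ∀ i, i ∈ Rp → i ∉ Rn := fun i h1 h2 => Finset.disjoint_left.1 hR h1 h2
  have hA' : ∀ i, i ∈ Lp ∨ i ∈ Ln ↔ i ∈ Rp ∨ i ∈ Rn := fun i => by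
    rw [← Finset.mem_union, hA, Finset.mem_union]
  -- `T` will be the letters `t_i` of the splitting. The letters of `N` are of two kinds: appended
  -- letters, and letters that occur together with their bars in `D`.
  set T := Lp ∩ Rn with hT
  set N := Ln ∩ Rp with hN
  have hTmem : ∀ i, i ∈ T ↔ i ∈ Lp ∧ i ∈ Rn := fun i => Finset.mem_inter
  have hNmem : ∀ i, i ∈ N ↔ i ∈ Ln ∧ i ∈ Rp := fun i => Finset.mem_inter
  have hLpT : ∀ x, countBelow Lp x = countBelow (Lp ∩ Rp) x + countBelow T x := fun x => by
    rw [← countBelow_union]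
    · congr 1
      ext i
      have := hA' i
      simp only [Finset.mem_union, Finset.mem_inter, hTmem]
      tauto
    · rw [Finset.disjoint_left]
      intro i h1 h2
      exact hR' i (Finset.mem_inter.1 h1).2 ((hTmem i).1 h2).2
  have hRpN : ∀ x, countBelow Rp x = countBelow (Lp ∩ Rp) x + countBelow N x := fun x => by
    rw [← countBelow_union]
    · congr 1
      ext i
      have := hA' i
      simp only [Finset.mem_union, Finset.mem_inter, hNmem]
      tauto
    · rw [Finset.disjoint_left]
      intro i h1 h2
      exact hL' i (Finset.mem_inter.1 h1).1 ((hNmem i).1 h2).1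
  have hdiff : ∀ x : Fin n, letterDiff L R x = surplus T N (x + 1) := fun x => by
    rw [letterDiff_eq, ← hLp, ← hRp, hLpT, hRpN, surplus]
    push_cast
    ring
  have hsur : ∀ y ≤ n, d ≤ surplus T N y := by
    intro y hy
    rcases y with _ | y
    · simpa [surplus, countBelow] using hd0
    · have := hmin ⟨y, hy⟩
      rwa [hdiff] at this
  -- The records are the letters to be appended. Since the minimum `d` is attained at every unused
  -- letter, there are `-d` of them and all lie below the unused letters.
  obtain ⟨E, hEN, hE, hErec⟩ := exists_records T N
  have hEmem : ∀ i ∈ E, i ∈ Ln ∧ i ∈ Rp := fun i hi => (hNmem i).1 (hEN hi)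
  obtain ⟨a₀, ha₀⟩ := hex
  have hcE : ∀ a ∉ Lp ∪ Ln, (countBelow E (a + 1) : ℤ) = -d := by
    intro a ha
    obtain ⟨h1, y, hy, h2⟩ := hE (a + 1) a.2
    have h3 := h1 (a + 1) le_rfl
    rw [← hdiff, hun a ha] at h3
    have h4 := hsur y (by omega)
    omega
  have hEcard : (E.card : ℤ) = -d := by
    obtain ⟨h1, y, hy, h2⟩ := hE n le_rfl
    have h3 := h1 (a₀ + 1) a₀.2
    rw [← hdiff, hun a₀ ha₀] at h3
    have h4 := hsur y hy
    rw [countBelow_eq_card E le_rfl] at h2 h3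
    omega
  have hEbelow : ∀ a ∉ Lp ∪ Ln, ∀ e ∈ E, e < a := by
    intro a ha e he
    have h1 : (E.filter fun i : Fin n => (i : ℕ) < a + 1) = E := by
      apply Finset.eq_of_subset_of_card_le (Finset.filter_subset _ _)
      have := hcE a ha
      unfold countBelow at this
      omega
    rw [← h1] at he
    have h2 := (Finset.mem_filter.1 he).2
    have h3 : e ≠ a := fun h => ha (Finset.mem_union_right _ (h ▸ (hEmem e (h1 ▸ he)).1))
    rw [Fin.lt_def]
    have : (e : ℕ) ≠ a := fun h => h3 (Fin.ext h)
    omega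
  set P := Rp \ E with hP
  set Q := Ln \ E with hQ
  have hPQ : P ∩ Q = N \ E := by
    ext i
    simp only [hP, hQ, Finset.mem_inter, Finset.mem_sdiff, hNmem]
    tauto
  have hZT : ∀ x ≤ n, countBelow (N \ E) x ≤ countBelow T x := by
    intro x hx
    have h1 := (hE x hx).1 x le_rfl
    have h2 := countBelow_sdiff hEN x
    unfold surplus at h1
    omega
  have hcard0 := hZT n le_rfl
  rw [countBelow_eq_card _ le_rfl, countBelow_eq_card _ le_rfl] at hcard0
  -- The number of zeros is chosen so that there are as many letters to be split as there are
  -- elements of `T`.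
  obtain ⟨r, hr, D, hD, hDP, hDQ, hDz⟩ := exists_increasing P Q (T.card - (N \ E).card)
  have hrk : r + E.card = L.card := by
    have h1 := countBelow_sdiff (E := E) (F := Rp) (fun i hi => (hEmem i hi).2) n
    have h2 := countBelow_sdiff (E := E) (F := Ln) (fun i hi => (hEmem i hi).1) n
    have h3 := countBelow_sdiff hEN n
    have h4 := hLpT n
    have h5 := hRpN n
    have h6 := card_posPart_add_card_negPart L
    simp only [countBelow_eq_card _ le_rfl] at h1 h2 h3 h4 h5
    rw [← hP] at h1
    rw [← hQ] at h2
    rw [← hLp, ← hLn] at h6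
    omega
  have habs : ∀ x, Absent D x → x ∉ T → x ∈ E ∨ x ∉ Lp ∪ Ln := by
    intro x hx hxT
    rw [absent_iff, hDP, hDQ, hP, hQ, Finset.mem_sdiff, Finset.mem_sdiff] at hx
    have := hA' x
    rw [hTmem] at hxT
    rw [Finset.mem_union]
    tauto
  have hTD : ∀ x ∈ T, Absent D x := by
    intro x hx
    rw [absent_iff, hDP, hDQ, hP, hQ, Finset.mem_sdiff, Finset.mem_sdiff]
    have h1 := (hTmem x).1 hx
    have := hL' x h1.1
    have := hR' x
    tauto
  have htc : ∀ f : Fin n → Bool, (T.sort (· ≥ ·)).countP f = (T.filter fun i => f i = true).card := by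
    intro f
    rw [List.countP_eq_length_filter,
      ← List.toFinset_card_of_nodup ((Finset.sort_nodup T _).filter _)]
    refine congrArg Finset.card ?_
    ext i
    simp
  have hlen : (splitSource D).length = T.card := by
    have h1 := hD.countP_splitSource (fun _ => true) rfl
    rw [List.countP_true, hDz, hDP, hDQ, hPQ] at h1
    simp only [Finset.filter_true] at h1
    omega
  have ht : IsSplitting D (T.sort (· ≥ ·)) := by
    apply IsSplittingFrom.of_countP
    · rw [hlen, Finset.length_sort]
    · exact hD.splitSource_pairwise
    · exact (Finset.sortedGT_sort T).pairwise
    · intro x hx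
      have hx := (Finset.mem_sort _).1 hx
      refine ⟨x.2, hTD x hx, fun h => ?_⟩
      have h1 := (List.mem_filter.1 h).1
      rw [List.mem_reverse, List.mem_ofFn] at h1
      obtain ⟨q, hq⟩ := h1
      exact (hTD x hx q).1 hq
    · intro x hx
      have h1 := hD.countP_splitSource (KNLetter.pos x ≤ ·)
        (by simpa using (KNLetter.pos_lt_zero x).le)
      rw [htc, h1, hDz, hDP, hDQ, hPQ]
      have h2 : ∀ F : Finset (Fin n), countBelow F x + (F.filter fun i => x ≤ i).card = F.card := by
        intro F
        rw [← Finset.card_filter_add_card_filter_not (s := F) (fun i : Fin n => (i : ℕ) < x)]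
        simp only [countBelow, not_lt, Fin.le_def]
      have h3 := h2 T
      have h4 := h2 (N \ E)
      have h5 := hZT x x.2.le
      have h6 : ∀ i : Fin n, KNLetter.pos x ≤ KNLetter.pos i ↔ x ≤ i := fun i => Iff.rfl
      simp only [decide_eq_true_eq, h6]
      omega
    · intro x _ hxD hxt
      have hxt : x ∉ T := fun h => hxt ((Finset.mem_sort _).2 h)
      have h1 := hD.countP_splitSource (KNLetter.pos x < ·)
        (by simpa using KNLetter.pos_lt_zero x)
      rw [htc, h1, hDz, hDP, hDQ, hPQ]
      have h2 : ∀ F : Finset (Fin n),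
          countBelow F (x + 1) + (F.filter fun i => x < i).card = F.card := by
        intro F
        rw [← Finset.card_filter_add_card_filter_not (s := F) (fun i : Fin n => (i : ℕ) < x + 1)]
        simp only [countBelow, not_lt, Fin.lt_def, Nat.succ_le_iff]
      have h3 := h2 T
      have h4 := h2 (N \ E)
      -- An absent letter outside `T` is a record or unused; in both cases the surplus equals its
      -- running minimum there, which is the equality of counts that the greedy choice needs.
      have h5 : surplus T N (x + 1) = -(countBelow E (x + 1) : ℤ) := by
        rcases habs x hxD hxt with h | h
        · exact hErec x h
        · rw [hcE x h, ← hdiff, hun x h, neg_neg]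
      have h6 := countBelow_sdiff hEN (x + 1)
      unfold surplus at h5
      simp only [decide_eq_true_eq, KNLetter.pos_lt_pos]
      omega
  have hext : extLetters (leftEntries D (T.sort (· ≥ ·))) (rightEntries D (T.sort (· ≥ ·)))
      E.card = E := by
    apply filter_rank_lt_eq
    · intro i hi
      rw [mem_freeLetters, hDP, hDQ, hP, hQ, Finset.mem_sdiff, Finset.mem_sdiff, Finset.mem_sort,
        hTmem]
      have h1 := hEmem i hi
      have h2 := hR' i
      tauto
    · intro e he x hx hxE
      rw [mem_freeLetters, Finset.mem_sort] at hx
      exact hEbelow x ((habs x (absent_iff.2 ⟨hx.1, hx.2.1⟩) hx.2.2).resolve_left hxE) e he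
  have hkr : L.card - r = E.card := by omega
  refine ⟨r, by omega, ?_, D, hD.isKNColumn ?_, _, ht, ?_, ?_⟩
  · rw [hkr]
    have : Even (E.card : ℤ) := hEcard ▸ hd.neg
    exact_mod_cast this
  -- Up to `j`, the letters of `P ∪ Q` and of `T` are disjoint and number at most `j + 1`, while the
  -- letters of `N \ E`, counted twice in `P` and `Q`, are at most as many as those of `T`.
  · intro j hj
    rw [hDP, hDQ]
    rw [card_filter_le_eq, card_filter_le_eq]
    have h1 : countBelow P (j + 1) + countBelow Q (j + 1) =
        countBelow (P ∪ Q) (j + 1) + countBelow (N \ E) (j + 1) := by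
      rw [← hPQ]
      unfold countBelow
      rw [Finset.filter_union, Finset.filter_inter_distrib, Finset.card_union_add_card_inter]
    have h2 := hZT (j + 1) j.2
    have h3 : countBelow (P ∪ Q) (j + 1) + countBelow T (j + 1) ≤ j + 1 := by
      rw [← countBelow_union, ← card_filter_le_eq]
      · refine (Finset.card_le_card fun i hi => ?_).trans (Fin.card_Iic j).le
        exact Finset.mem_Iic.2 (Finset.mem_filter.1 hi).2
      · rw [Finset.disjoint_left]
        intro i h3 h4
        have h5 := absent_iff.1 (hTD i h4)
        rw [hDP, hDQ] at h5
        rw [Finset.mem_union] at h3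
        tauto
    omega
  · rw [hkr, hext]
    exact eq_leftEntries_union hL' hA' hEmem hDP hDQ fun i => (Finset.mem_sort _).trans (hTmem i)
  · rw [hkr, hext]
    exact eq_rightEntries_union hR' hA' hEmem hDP hDQ fun i => (Finset.mem_sort _).trans (hTmem i)

end TypeB

/-! ### Split pairs characterized by counting, and the conclusion. -/

namespace TypeB

variable {n k : ℕ}

open SignedPerm

theorem exists_mem_left_abs {r m : ℕ} {D : Fin r → KNLetter n} {t : List (Fin n)} {i : Fin n} :
    (∃ a ∈ leftEntries D t ∪ (extLetters (leftEntries D t) (rightEntries D t) m).image .neg,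
      a.abs = i) ↔ (i ∈ posLetters D ∨ i ∈ negLetters D ∨ i ∈ t) ∨
        i ∈ extLetters (leftEntries D t) (rightEntries D t) m := by
  have h1 := pos_mem_leftEntries (D := D) (t := t) (i := i)
  have h2 := neg_mem_leftEntries (D := D) (t := t) (i := i)
  constructor
  · rintro ⟨a, ha, rfl⟩
    rcases a with i | i <;> simp only [Finset.mem_union, Finset.mem_image, reduceCtorEq, and_false,
      exists_false, or_false, Letter.neg.injEq, exists_eq_right, Letter.abs] at ha h1 h2 ⊢ <;> tauto
  · intro h
    by_cases h3 : Letter.pos i ∈ leftEntries D t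
    · exact ⟨.pos i, Finset.mem_union_left _ h3, rfl⟩
    · refine ⟨.neg i, ?_, rfl⟩
      simp only [Finset.mem_union, Finset.mem_image, Letter.neg.injEq, exists_eq_right]
      tauto

theorem exists_mem_right_abs {r m : ℕ} {D : Fin r → KNLetter n} {t : List (Fin n)} {i : Fin n} :
    (∃ a ∈ rightEntries D t ∪ (extLetters (leftEntries D t) (rightEntries D t) m).image .pos,
      a.abs = i) ↔ (i ∈ posLetters D ∨ i ∈ negLetters D ∨ i ∈ t) ∨
        i ∈ extLetters (leftEntries D t) (rightEntries D t) m := by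
  have h1 := pos_mem_rightEntries (D := D) (t := t) (i := i)
  have h2 := neg_mem_rightEntries (D := D) (t := t) (i := i)
  constructor
  · rintro ⟨a, ha, rfl⟩
    rcases a with i | i <;> simp only [Finset.mem_union, Finset.mem_image, reduceCtorEq, and_false,
      exists_false, or_false, Letter.pos.injEq, exists_eq_right, Letter.abs] at ha h1 h2 ⊢ <;> tauto
  · intro h
    by_cases h3 : Letter.neg i ∈ rightEntries D t
    · exact ⟨.neg i, Finset.mem_union_left _ h3, rfl⟩
    · refine ⟨.pos i, ?_, rfl⟩
      simp only [Finset.mem_union, Finset.mem_image, Letter.pos.injEq, exists_eq_right]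
      tauto

/-- In one direction the bound is `d = r - k` and the estimates of `letterDiff` apply; in the other
the column is built by `exists_split`. An absolute value not used by `C` exists because `k < n`. -/
theorem isSplitPair_iff (hk : k < n) (C C' : Fin k → Letter n)
    (hC : Function.Injective fun i => (C i).abs) :
    IsSplitPair k (sortColumn C) (sortColumn C') ↔
      (Function.Injective fun i => (C' i).abs) ∧ (∀ i, ∃ j, (C' i).abs = (C j).abs) ∧
      ∃ d : ℤ, Even d ∧ d ≤ 0 ∧
        (∀ x, d ≤ letterDiff (Finset.univ.image C) (Finset.univ.image C') x) ∧
        ∀ a, (∀ j, (C j).abs ≠ a) →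
          letterDiff (Finset.univ.image C) (Finset.univ.image C') a = d := by
  have hCinj : Function.Injective C := fun i j h => hC (congrArg Letter.abs h)
  have hmem : ∀ (C : Fin k → Letter n) (i : Fin n),
      (∃ a ∈ Finset.univ.image C, a.abs = i) ↔ ∃ j, (C j).abs = i := fun C i => by simp
  constructor
  · rintro ⟨r, hr, hev, D, hD, t, ht, hL, hR⟩
    rw [sortColumn_eq_sort_iff] at hL hR
    have habs : ∀ i, (∃ j, (C j).abs = i) ↔ ∃ j, (C' j).abs = i := fun i => by
      rw [← hmem C, ← hmem C', hL.2, hR.2, exists_mem_left_abs, exists_mem_right_abs]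
    refine ⟨?_, fun i => ?_, -((k - r : ℕ) : ℤ), ?_, by omega, fun x => ?_, fun a ha => ?_⟩
    · choose f hf using fun j => (habs _).1 ⟨j, rfl⟩
      have hfinj : Function.Injective f := fun i j hij => hC (by
        simp only
        rw [← hf i, ← hf j, hij])
      intro i j hij
      obtain ⟨i, rfl⟩ := Finite.surjective_of_injective hfinj i
      obtain ⟨j, rfl⟩ := Finite.surjective_of_injective hfinj j
      simp only [hf] at hij
      rw [hC hij]
    · obtain ⟨j, hj⟩ := (habs _).2 ⟨i, rfl⟩
      exact ⟨j, hj.symm⟩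
    · exact (by exact_mod_cast hev : Even ((k - r : ℕ) : ℤ)).neg
    · rw [hL.2, hR.2]
      exact neg_le_letterDiff hD.increasing ht _ x
    · have h1 : ¬ ∃ j, (C j).abs = a := fun ⟨j, hj⟩ => ha j hj
      rw [← hmem, hL.2, exists_mem_left_abs] at h1
      rw [hL.2, hR.2]
      apply letterDiff_of_free hD.increasing ht
      · rw [mem_freeLetters]
        tauto
      · tauto
  · rintro ⟨hC', himg, d, hd, hd0, hmin, hun⟩
    have hC'inj : Function.Injective C' := fun i j h => hC' (congrArg Letter.abs h)
    have hparts : ∀ (C : Fin k → Letter n) (i : Fin n), (i ∈ posPart (Finset.univ.image C) ∨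
        i ∈ negPart (Finset.univ.image C)) ↔ ∃ j, (C j).abs = i := by
      intro C i
      rw [← hmem C, mem_posPart, mem_negPart]
      constructor
      · rintro (h | h)
        · exact ⟨_, h, rfl⟩
        · exact ⟨_, h, rfl⟩
      · rintro ⟨a, ha, rfl⟩
        cases a
        · exact Or.inl ha
        · exact Or.inr ha
    have hdisj : ∀ C : Fin k → Letter n, (Function.Injective fun i => (C i).abs) →
        Disjoint (posPart (Finset.univ.image C)) (negPart (Finset.univ.image C)) := by
      intro C hC
      rw [Finset.disjoint_left]
      intro i h1 h2
      rw [mem_posPart] at h1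
      rw [mem_negPart] at h2
      obtain ⟨a, _, ha⟩ := Finset.mem_image.1 h1
      obtain ⟨b, _, hb⟩ := Finset.mem_image.1 h2
      have hab : a = b := hC (by simp only [ha, hb, Letter.abs])
      rw [hab, hb] at ha
      simp at ha
    have hcard : (Finset.univ.image C).card = k := by
      rw [Finset.card_image_of_injective _ hCinj, Finset.card_univ, Fintype.card_fin]
    have hA : posPart (Finset.univ.image C) ∪ negPart (Finset.univ.image C) =
        posPart (Finset.univ.image C') ∪ negPart (Finset.univ.image C') := by
      ext i
      rw [Finset.mem_union, Finset.mem_union, hparts, hparts]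
      choose f hf using himg
      have hfinj : Function.Injective f := fun i j hij => hC' (by
        simp only
        rw [hf i, hf j, hij])
      constructor
      · rintro ⟨j, rfl⟩
        obtain ⟨j, rfl⟩ := Finite.surjective_of_injective hfinj j
        exact ⟨j, hf j⟩
      · rintro ⟨j, rfl⟩
        exact ⟨f j, (hf j).symm⟩
    have hex : ∃ a, a ∉ posPart (Finset.univ.image C) ∪ negPart (Finset.univ.image C) := by
      by_contra hcon
      push Not at hcon
      have h1 : Function.Surjective fun j => (C j).abs := fun a => by
        have := hcon a
        rwa [Finset.mem_union, hparts] at this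
      have := Fintype.card_le_of_surjective _ h1
      simp only [Fintype.card_fin] at this
      omega
    obtain ⟨r, hr, hev, D, hD, t, ht, hL, hR⟩ := exists_split (hdisj C hC) (hdisj C' hC') hA hd hd0
      hmin (fun a ha => hun a (by
        rw [Finset.mem_union, hparts] at ha
        exact fun j hj => ha ⟨j, hj⟩)) hex
    rw [hcard] at hr hev hL hR
    exact ⟨r, hr, hev, D, hD, t, ht, (sortColumn_eq_sort_iff _ _).2 ⟨hCinj, hL⟩,
      (sortColumn_eq_sort_iff _ _).2 ⟨hC'inj, hR⟩⟩

theorem sum_window_eq (hk : k ≤ n) (u : SignedPerm n) (x : Fin n) :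
    ∑ i ∈ Finset.range k, (if 0 ≤ window u i ∧ window u i ≤ x then (1 : ℤ) else 0) =
      (Finset.univ.filter fun i =>
        Letter.pos i ∈ Finset.univ.image (column hk u) ∧ i ≤ x).card := by
  rw [Finset.sum_range, ← Finset.natCast_card_filter]
  have h1 : (Finset.univ.filter fun j : Fin k => 0 ≤ window u j ∧ window u j ≤ x).image
      (column hk u) = (Finset.univ.filter fun i =>
        Letter.pos i ∈ Finset.univ.image (column hk u) ∧ i ≤ x).image .pos := by
    ext a
    simp only [Finset.mem_image, Finset.mem_filter, Finset.mem_univ, true_and, ← code_column hk]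
    constructor
    · rintro ⟨j, ⟨h1, h2⟩, rfl⟩
      obtain ⟨i, hi⟩ := (Letter.isPos_iff _).2 h1
      refine ⟨i, ⟨⟨j, hi⟩, ?_⟩, hi.symm⟩
      rw [hi] at h2
      rw [Fin.le_def]
      simpa [Letter.code] using h2
    · rintro ⟨i, ⟨⟨j, hj⟩, h1⟩, rfl⟩
      refine ⟨j, ?_, hj⟩
      rw [hj]
      rw [Fin.le_def] at h1
      simp only [Letter.code]
      omega
  have h2 := congrArg Finset.card h1
  rw [Finset.card_image_of_injective _ (fun i j h => Letter.pos.inj h),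
    Finset.card_image_of_injective] at h2
  · rw [h2]
  · intro i j h
    have := abs_injective u (congrArg Letter.abs h)
    simpa [Fin.ext_iff] using this

theorem posDiff_eq_letterDiff (hk : k ≤ n) (u v : SignedPerm n) (x : Fin n) :
    Coded.posDiff k (window u) (window v) x =
      letterDiff (Finset.univ.image (column hk u)) (Finset.univ.image (column hk v)) x := by
  rw [Coded.posDiff, Finset.sum_sub_distrib, sum_window_eq hk, sum_window_eq hk, letterDiff]

theorem abs_column_injective (hk : k ≤ n) (u : SignedPerm n) :
    Function.Injective fun i => (column hk u i).abs := fun i j h => by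
  have := abs_injective u h
  simpa [Fin.ext_iff] using this

theorem exists_abs_eq (u : SignedPerm n) (a : Fin n) : ∃ m, (u.1 (.pos m)).abs = a :=
  Finite.surjective_of_injective (abs_injective u) a

theorem mag_window (u : SignedPerm n) (m : Fin n) :
    Coded.mag (window u m) = (u.1 (.pos m)).abs := by
  rw [window_coe, Letter.abs_eq_mag]

/-- Both conditions count the same letters. The value `x = -1`, where the difference vanishes,
encodes `d ≤ 0`. -/
theorem isSplitPair_iff_splitCondition (hk : k < n) (u v : SignedPerm n)
    (hag : ∀ m, k ≤ m → window v m = window u m) :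
    IsSplitPair k (sortColumn (column hk.le u)) (sortColumn (column hk.le v)) ↔
      Coded.SplitCondition n k (window u) (window v) := by
  rw [isSplitPair_iff hk _ _ (abs_column_injective hk.le u)]
  have himg : ∀ i, ∃ j, (column hk.le v i).abs = (column hk.le u j).abs := by
    intro i
    obtain ⟨m, hm⟩ := exists_abs_eq u (column hk.le v i).abs
    rcases lt_or_ge (m : ℕ) k with h | h
    · exact ⟨⟨m, h⟩, hm.symm⟩
    · have h1 := hag m h
      rw [window_coe, window_coe] at h1
      rw [← Letter.code_injective h1] at hm
      have h2 := abs_injective v hm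
      rw [h2] at h
      exact absurd i.2 (not_lt.2 h)
  have hiff : (∀ a, (∀ j, (column hk.le u j).abs ≠ a) ↔
      ∃ m : Fin n, k ≤ m ∧ Coded.mag (window u m) = (a : ℕ)) := by
    intro a
    constructor
    · intro h
      obtain ⟨m, hm⟩ := exists_abs_eq u a
      refine ⟨m, ?_, by rw [mag_window, hm]⟩
      by_contra hmk
      exact h ⟨m, not_le.1 hmk⟩ hm
    · rintro ⟨m, hm, hma⟩ j hj
      rw [mag_window] at hma
      have h1 := abs_injective u ((Fin.ext hma).trans hj.symm)
      rw [h1] at hm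
      exact absurd j.2 (not_lt.2 hm)
  constructor
  · rintro ⟨-, -, d, hd, hd0, hmin, hun⟩
    refine ⟨d, hd, fun x hx1 hx2 => ?_, fun m hm hmn => ?_⟩
    · rcases lt_or_ge x 0 with hx | hx
      · rw [Coded.posDiff_neg hx]
        exact hd0
      · obtain ⟨y, rfl⟩ := Int.eq_ofNat_of_zero_le hx
        have := posDiff_eq_letterDiff hk.le u v ⟨y, by omega⟩
        simp only at this
        rw [this]
        exact hmin _
    · have h1 := hun (u.1 (.pos ⟨m, hmn⟩)).abs
        ((hiff _).2 ⟨⟨m, hmn⟩, hm, mag_window u ⟨m, hmn⟩⟩)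
      rw [← posDiff_eq_letterDiff, ← mag_window] at h1
      exact h1
  · rintro ⟨d, hd, hmin, hun⟩
    refine ⟨abs_column_injective hk.le v, himg, d, hd, ?_, fun x => ?_, fun a ha => ?_⟩
    · have := hmin (-1) le_rfl (by omega)
      rwa [Coded.posDiff_neg (by omega)] at this
    · rw [← posDiff_eq_letterDiff]
      exact hmin x (by omega) (by omega)
    · obtain ⟨m, hm, hma⟩ := (hiff a).1 ha
      rw [← posDiff_eq_letterDiff, ← hma]
      exact hun m hm m.2

theorem good_iff_conditions (hk1 : 1 ≤ k) (hk : k < n) (u v : SignedPerm n)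
    (hag : ∀ m, k ≤ m → window v m = window u m) :
    Coded.Good n k (window u) (window v) ↔ Conditions (column hk.le u) (column hk.le v) ∧
      IsSplitPair k (sortColumn (column hk.le u)) (sortColumn (column hk.le v)) := by
  rw [Coded.good_iff_splitCondition hk1 hk (isWindow u) (isWindow v) fun m hm _ => (hag m hm).symm,
    conditions_iff, isSplitPair_iff_splitCondition hk u v hag, and_comm]

theorem IsColumnPath.isPathTo {hk : k ≤ n} {u : SignedPerm n} {C' : Fin k → Letter n}
    {P : List (PosRoot n × SignedPerm n)} (h : IsColumnPath hk u C' P) :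
    IsPathTo (gammaR n k) u (endpoint u P) P := ⟨h.path, h.labels, rfl⟩

theorem IsColumnPath.window_endpoint (hk : k < n) {u : SignedPerm n} {C' : Fin k → Letter n}
    {P : List (PosRoot n × SignedPerm n)} (h : IsColumnPath hk.le u C' P) {m : ℕ} (hm : k ≤ m) :
    window (endpoint u P) m = window u m :=
  (isQPath_gammaR hk h.path fun _ hα => h.labels.subset hα).2 m hm

/-- Labels of the chain fix all entries from position `k` on, so the column `C'` determines the end
of the path. Uniqueness for fixed ends thereby becomes uniqueness for a fixed column. -/
theorem IsColumnPath.endpoint_eq (hk : k < n) {u : SignedPerm n} {C' : Fin k → Letter n}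
    {P Q : List (PosRoot n × SignedPerm n)} (hP : IsColumnPath hk.le u C' P)
    (hQ : IsColumnPath hk.le u C' Q) : endpoint u Q = endpoint u P := by
  apply ext_window
  intro i _
  rcases lt_or_ge i k with h | h
  · rw [← code_column hk.le (endpoint u Q) ⟨i, h⟩, ← code_column hk.le (endpoint u P) ⟨i, h⟩,
      hP.target, hQ.target]
  · rw [hP.window_endpoint hk h, hQ.window_endpoint hk h]

end TypeB

theorem mainTheorem4 (n k : ℕ) (hk1 : 1 ≤ k) (hk : k < n) (u : TypeB.SignedPerm n)
    (C' : Fin k → TypeB.Letter n) :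
    -- the characterization, with `C = u[1, k]`
    ((TypeB.Conditions (TypeB.column hk.le u) C' ∧
        TypeB.IsSplitPair k (TypeB.sortColumn (TypeB.column hk.le u)) (TypeB.sortColumn C')) ↔
      ∃ P, TypeB.IsColumnPath hk.le u C' P) ∧
    -- the path is unique
    (∀ P Q, TypeB.IsColumnPath hk.le u C' P → TypeB.IsColumnPath hk.le u C' Q → P = Q) ∧
    -- each row is weakly increasing along the path
    (∀ P, TypeB.IsColumnPath hk.le u C' P → ∀ i : Fin k,
      ((TypeB.vertices u P).map fun w => TypeB.column hk.le w i).Pairwise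
        (TypeB.Letter.CircLE (TypeB.column hk.le u i))) := by
  have hchar := TypeB.characterizes_gammaR hk
  refine ⟨⟨?_, ?_⟩, fun P Q hP hQ => ?_, fun P hP => TypeB.rows_pairwise hk hP.path hP.labels⟩
  · rintro ⟨hcond, hsplit⟩
    obtain ⟨hinj, himg, -⟩ :=
      (TypeB.isSplitPair_iff hk _ _ (TypeB.abs_column_injective hk.le u)).1 hsplit
    obtain ⟨v, rfl, hag⟩ := TypeB.exists_extension hk.le u C' hinj himg
    obtain ⟨P, hP⟩ := (hchar.1 u v).1
      ((TypeB.good_iff_conditions hk1 hk u v hag).2 ⟨hcond, hsplit⟩)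
    exact ⟨P, hP.path, hP.labels, by rw [hP.target]⟩
  · rintro ⟨P, hP⟩
    rw [← hP.target]
    exact (TypeB.good_iff_conditions hk1 hk u _ fun m hm => hP.window_endpoint hk hm).1
      ((hchar.1 u _).2 ⟨P, hP.isPathTo⟩)
  · exact hchar.2 u _ P Q hP.isPathTo (hP.endpoint_eq hk hQ ▸ hQ.isPathTo)
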